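/- Let $R$ be a commutative ring in which $2$ is invertible, and let $X=\operatorname{Spec} R$. All complexes are bounded complexes of finite locally free sheaves on $X$ (equivalently, of finitely generated projective $R$-modules) with differentials raising the degree, unless stated otherwise. For a complex $A^\bullet$, the dual $A^{\bullet\vee}$ has $(A^{-i})^\vee$ in degree $i$, with the transposed differentials (no signs). The derived dual of a perfect complex is the dual of a representing complex of this kind. A quadratic complex on $X$ is a perfect complex $\mathbb{E}$ with an isomorphism $\theta:\mathbb{E}\to\mathbb{E}^\vee$ in the derived category such that $\theta^\vee=\theta$. Fix one. A self-dual representative of $\mathbb{E}$ is a complex $E^\bullet$ with an isomorphism of complexes $\theta_E:E^\bullet\to E^{\bullet\vee}$ such that $\theta_{E,i}^\vee=\theta_{E,-i}$ for all $i$, together with an isomorphism $\alpha_E:E^\bullet\to\mathbb{E}$ in the derived category such that $\alpha_E^\vee\circ\theta\circ\alpha_E=[\theta_E]$. For self-dual representatives $F^\bullet,E^\bullet$, an isotropic reduction $F^\bullet\rightsquigarrow E^\bullet$ is a complex $A^\bullet$ with quasi-isomorphisms of complexes $F^\bullet\xleftarrow{f}A^\bullet\xrightarrow{e}E^\bullet$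 such that $\alpha_F\circ[f]=\alpha_E\circ[e]$ and 1. $f$ is an isomorphism in degrees $\geq 1$ and $e$ is an isomorphism in degrees $\leq -1$; 2. $(e_1,d):A^1\to E^1\oplus A^2$ is an inclusion of vector bundles, i.e. its dual is surjective; 3. $f^\vee\circ\theta_F\circ f=e^\vee\circ\theta_E\circ e$ as maps $A^\bullet\to A^{\bullet\vee}$. Two such diagrams are identified if there is an isomorphism of the complexes $A^\bullet$ compatible with $f$ and $e$. The composition of $G^\bullet\leftarrow A^\bullet\to F^\bullet$ and $F^\bullet\leftarrow B^\bullet\to E^\bullet$ is $G^\bullet\leftarrow A^\bullet\times_{F^\bullet}B^\bullet\to E^\bullet$. Self-dual representatives of $\mathbb{E}$ and isotropic reductions form a category $\mathcal{R}$. **Proposition.** The category $\mathcal{R}$ is weakly simply connected: for every groupoid $\mathcal{G}$ and every functor $\Phi:\mathcal{R}\to\mathcal{G}$ there is an object $c$ of $\mathcal{G}$ such that $\Phi$ is naturally isomorphic to the constant functor with value $c$. -/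

import Mathlib

universe u v w

noncomputable section

open CategoryTheory Limits

namespace QuadCx

variable {R : Type u} [CommRing R]

/-- The derived category `D(R)` of the abelian category of `R`-modules. -/
instance derivedCategoryInst (R : Type u) [CommRing R] :
    HasDerivedCategory.{u + 1} (ModuleCat.{u} R) :=
  HasDerivedCategory.standard _

/-! ### Bounded complexes of vector bundles and their duals -/

/-- A bounded complex of finite locally free sheaves on `Spec R`, i.e. of finitely generated
projective `R`-modules. Differentials raise the degree. -/
structure VBComplex (R : Type u) [CommRing R] where
  cx : CochainComplex (ModuleCat.{u} R) ℤ
  bounded : ∃ a b : ℤ, ∀ i : ℤ, i < a ∨ b < i → IsZero (cx.X i)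
  finite : ∀ i, Module.Finite R (cx.X i)
  projective : ∀ i, Module.Projective R (cx.X i)

/-- The dual `Hom(M, R)` of a module. -/
abbrev dualMod (M : ModuleCat.{u} R) : ModuleCat.{u} R := ModuleCat.of R (Module.Dual R M)

/-- The transpose of a linear map. -/
def dualModMap {M N : ModuleCat.{u} R} (f : M ⟶ N) : dualMod N ⟶ dualMod M :=
  ModuleCat.ofHom f.hom.dualMap

lemma dualModMap_id (M : ModuleCat.{u} R) : dualModMap (𝟙 M) = 𝟙 (dualMod M) := rfl

lemma dualModMap_comp {M N P : ModuleCat.{u} R} (f : M ⟶ N) (g : N ⟶ P) :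
    dualModMap (f ≫ g) = dualModMap g ≫ dualModMap f := rfl

lemma dualModMap_zero (M N : ModuleCat.{u} R) : dualModMap (0 : M ⟶ N) = 0 :=
  ModuleCat.hom_ext (LinearMap.ext fun φ => LinearMap.ext fun _ => map_zero φ)

lemma dualModMap_add {M N : ModuleCat.{u} R} (f g : M ⟶ N) :
    dualModMap (f + g) = dualModMap f + dualModMap g :=
  ModuleCat.hom_ext (LinearMap.ext fun φ => LinearMap.ext fun _ => map_add φ _ _)

/-- The termwise dual of a complex: it has `Hom(C^{-i}, R)` in degree `i`, and its differentials are
the transposes of those of `C`, without any sign. -/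
@[simps]
def dualCx (C : CochainComplex (ModuleCat.{u} R) ℤ) : CochainComplex (ModuleCat.{u} R) ℤ where
  X i := dualMod (C.X (-i))
  d i j := dualModMap (C.d (-j) (-i))
  shape i j h := by
    rw [C.shape _ _ (by simp only [ComplexShape.up_Rel] at h ⊢; omega), dualModMap_zero]
  d_comp_d' i j k _ _ := by
    rw [← dualModMap_comp, C.d_comp_d, dualModMap_zero]

/-- The transpose of a chain map. -/
@[simps]
def dualCxMap {C D : CochainComplex (ModuleCat.{u} R) ℤ} (f : C ⟶ D) : dualCx D ⟶ dualCx C where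
  f i := dualModMap (f.f (-i))
  comm' i j _ := congrArg dualModMap (f.comm (-j) (-i)).symm

lemma dualCxMap_id (C : CochainComplex (ModuleCat.{u} R) ℤ) :
    dualCxMap (𝟙 C) = 𝟙 (dualCx C) := rfl

lemma dualCxMap_comp {C D E : CochainComplex (ModuleCat.{u} R) ℤ} (f : C ⟶ D) (g : D ⟶ E) :
    dualCxMap (f ≫ g) = dualCxMap g ≫ dualCxMap f := rfl

/-- The transpose of a homotopy. -/
def dualCxHomotopy {C D : CochainComplex (ModuleCat.{u} R) ℤ} {f g : C ⟶ D} (h : Homotopy f g) :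
    Homotopy (dualCxMap f) (dualCxMap g) where
  hom i j := (dualModMap (h.hom (-j) (-i)) : (dualCx D).X i ⟶ (dualCx C).X j)
  zero i j hij := by
    rw [h.zero _ _ (by simp only [ComplexShape.up_Rel] at hij ⊢; omega)]
    exact dualModMap_zero _ _
  comm i := by
    have hc := h.comm (-i)
    rw [dNext_eq _ (show (ComplexShape.up ℤ).Rel (-i) (-(i - 1)) by simp; omega),
      prevD_eq _ (show (ComplexShape.up ℤ).Rel (-(i + 1)) (-i) by simp)] at hc
    have key (k : ∀ i j, (dualCx D).X i ⟶ (dualCx C).X j) :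
        dNext i k + prevD i k = (dualCx D).d i (i + 1) ≫ k (i + 1) i +
          k i (i - 1) ≫ (dualCx C).d (i - 1) i := by
      rw [dNext_eq _ (show (ComplexShape.up ℤ).Rel i (i + 1) by simp),
        prevD_eq _ (show (ComplexShape.up ℤ).Rel (i - 1) i by simp)]
    refine (congrArg dualModMap hc).trans (Eq.trans ?_ (congrArg (· + _) (key _).symm))
    rw [dualModMap_add, dualModMap_add, dualModMap_comp, dualModMap_comp, add_comm (_ ≫ _) (_ ≫ _)]
    rfl

/-- The canonical map `C ⟶ C^∨∨`, given in degree `i` by evaluation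
`C^i = C^{-(-i)} ⟶ Hom(Hom(C^{-(-i)}, R), R)`. -/
def toBidualCx (C : CochainComplex (ModuleCat.{u} R) ℤ) : C ⟶ dualCx (dualCx C) where
  f i := (C.XIsoOfEq (neg_neg i).symm).hom ≫ ModuleCat.ofHom (Module.Dual.eval R (C.X (-(-i))))
  comm' i j _ := by
    have : (C.XIsoOfEq (neg_neg i).symm).hom ≫ C.d (-(-i)) (-(-j)) =
        C.d i j ≫ (C.XIsoOfEq (neg_neg j).symm).hom := by simp
    refine ModuleCat.hom_ext (LinearMap.ext fun x => LinearMap.ext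
      fun (φ : Module.Dual R (C.X (-(-j)))) => ?_)
    exact congrArg φ (congr($this x))

/-- The dual of a bounded complex of vector bundles. -/
abbrev VBComplex.dual (P : VBComplex R) : VBComplex R where
  cx := dualCx P.cx
  bounded := by
    obtain ⟨a, b, h⟩ := P.bounded
    refine ⟨-b, -a, fun i hi => ?_⟩
    have h0 : IsZero (P.cx.X (-i)) := h (-i) (by omega)
    have := ModuleCat.subsingleton_of_isZero h0
    exact ModuleCat.isZero_of_subsingleton (dualMod (P.cx.X (-i)))
  finite i := by
    have := P.finite (-i)
    have := P.projective (-i)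
    exact inferInstanceAs (Module.Finite R (Module.Dual R (P.cx.X (-i))))
  projective i := by
    have := P.finite (-i)
    have := P.projective (-i)
    exact inferInstanceAs (Module.Projective R (Module.Dual R (P.cx.X (-i))))

/-! ### Perfect complexes and the derived dual -/

/-- The localization functor from complexes of `R`-modules to `D(R)`. -/
abbrev Q (R : Type u) [CommRing R] :
    CochainComplex (ModuleCat.{u} R) ℤ ⥤ DerivedCategory (ModuleCat.{u} R) :=
  DerivedCategory.Q

lemma VBComplex.isKProjective (P : VBComplex R) : P.cx.IsKProjective := by
  obtain ⟨a, b, h⟩ := P.bounded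
  have : P.cx.IsStrictlyLE b := by
    rw [CochainComplex.isStrictlyLE_iff]
    exact fun i hi => h i (Or.inr hi)
  have (n : ℤ) : Projective (P.cx.X n) := by
    have := P.projective n
    infer_instance
  exact CochainComplex.isKProjective_of_projective _ b

/-- Every morphism of `D(R)` out of a bounded complex of vector bundles is represented by a
chain map. -/
lemma VBComplex.exists_chainMap (P : VBComplex R) {C : CochainComplex (ModuleCat.{u} R) ℤ}
    (f : (Q R).obj P.cx ⟶ (Q R).obj C) : ∃ φ : P.cx ⟶ C, (Q R).map φ = f := by
  have := P.isKProjective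
  obtain ⟨g, hg⟩ := (CochainComplex.IsKProjective.Qh_map_bijective P.cx
    ((HomotopyCategory.quotient _ _).obj C)).surjective
      ((DerivedCategory.quotientCompQhIso _).hom.app P.cx ≫ f ≫
        (DerivedCategory.quotientCompQhIso _).inv.app C)
  obtain ⟨φ, rfl⟩ := (HomotopyCategory.quotient _ _).map_surjective g
  refine ⟨φ, ?_⟩
  rw [← cancel_epi ((DerivedCategory.quotientCompQhIso _).hom.app P.cx),
    ← DerivedCategory.quotientCompQhIso_hom_naturality, hg]
  simp

/-- Two chain maps out of a bounded complex of vector bundles agree in `D(R)` only if they are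
homotopic. -/
lemma VBComplex.homotopy_of_map_eq (P : VBComplex R) {C : CochainComplex (ModuleCat.{u} R) ℤ}
    {φ ψ : P.cx ⟶ C} (h : (Q R).map φ = (Q R).map ψ) : Nonempty (Homotopy φ ψ) := by
  have := P.isKProjective
  refine ⟨HomotopyCategory.homotopyOfEq _ _
    ((CochainComplex.IsKProjective.Qh_map_bijective P.cx
      ((HomotopyCategory.quotient _ _).obj C)).injective ?_)⟩
  rw [← cancel_mono ((DerivedCategory.quotientCompQhIso _).hom.app C),
    DerivedCategory.quotientCompQhIso_hom_naturality,
    DerivedCategory.quotientCompQhIso_hom_naturality]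
  exact congrArg _ h

/-- Homotopic chain maps agree in `D(R)`. -/
lemma map_eq_of_homotopy {C D : CochainComplex (ModuleCat.{u} R) ℤ} {φ ψ : C ⟶ D}
    (h : Homotopy φ ψ) : (Q R).map φ = (Q R).map ψ := by
  rw [← cancel_epi ((DerivedCategory.quotientCompQhIso _).hom.app C),
    ← DerivedCategory.quotientCompQhIso_hom_naturality,
    ← DerivedCategory.quotientCompQhIso_hom_naturality, HomotopyCategory.eq_of_homotopy _ _ h]

/-- The dual of a morphism of `D(R)` between bounded complexes of vector bundles: the class of the
transpose of any chain map that represents it (`derivedDual_map`). -/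
def derivedDual {P P' : VBComplex R} (f : (Q R).obj P.cx ⟶ (Q R).obj P'.cx) :
    (Q R).obj P'.dual.cx ⟶ (Q R).obj P.dual.cx :=
  (Q R).map (dualCxMap (P.exists_chainMap f).choose)

lemma derivedDual_map {P P' : VBComplex R} (φ : P.cx ⟶ P'.cx) :
    derivedDual (P := P) (P' := P') ((Q R).map φ) = (Q R).map (dualCxMap φ) := by
  obtain ⟨h⟩ := P.homotopy_of_map_eq (P.exists_chainMap ((Q R).map φ)).choose_spec
  exact map_eq_of_homotopy (dualCxHomotopy h)

lemma derivedDual_id (P : VBComplex R) :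
    derivedDual (𝟙 ((Q R).obj P.cx)) = 𝟙 ((Q R).obj P.dual.cx) := by
  rw [← (Q R).map_id, derivedDual_map, dualCxMap_id]
  exact (Q R).map_id _

lemma derivedDual_comp {P P' P'' : VBComplex R} (f : (Q R).obj P.cx ⟶ (Q R).obj P'.cx)
    (g : (Q R).obj P'.cx ⟶ (Q R).obj P''.cx) :
    derivedDual (f ≫ g) = derivedDual g ≫ derivedDual f := by
  obtain ⟨φ, rfl⟩ := P.exists_chainMap f
  obtain ⟨ψ, rfl⟩ := P'.exists_chainMap g
  rw [← (Q R).map_comp, derivedDual_map, derivedDual_map, derivedDual_map, dualCxMap_comp]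
  exact (Q R).map_comp _ _

/-- A perfect complex on `Spec R`: an object of `D(R)` that is isomorphic to a bounded complex of
vector bundles. -/
structure PerfectComplex (R : Type u) [CommRing R] where
  obj : DerivedCategory (ModuleCat.{u} R)
  isPerfect : ∃ P : VBComplex R, Nonempty ((Q R).obj P.cx ≅ obj)

namespace PerfectComplex

/-- A bounded complex of vector bundles that represents a given perfect complex. -/
def rep (𝔼 : PerfectComplex R) : VBComplex R := 𝔼.isPerfect.choose

/-- The isomorphism with the chosen representative. -/
def repIso (𝔼 : PerfectComplex R) : (Q R).obj 𝔼.rep.cx ≅ 𝔼.obj := 𝔼.isPerfect.choose_spec.some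

/-- The derived dual `𝔼^∨` of a perfect complex: the termwise dual of a representative. -/
abbrev dual (𝔼 : PerfectComplex R) : PerfectComplex R where
  obj := (Q R).obj 𝔼.rep.dual.cx
  isPerfect := ⟨𝔼.rep.dual, ⟨Iso.refl _⟩⟩

/-- The dual `f^∨ : 𝔽^∨ ⟶ 𝔼^∨` of a morphism `f : 𝔼 ⟶ 𝔽` of perfect complexes. -/
def dualHom {𝔼 𝔽 : PerfectComplex R} (f : 𝔼.obj ⟶ 𝔽.obj) : 𝔽.dual.obj ⟶ 𝔼.dual.obj :=
  derivedDual (P := 𝔼.rep) (P' := 𝔽.rep) (𝔼.repIso.hom ≫ f ≫ 𝔽.repIso.inv)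

lemma dualHom_id (𝔼 : PerfectComplex R) : dualHom (𝟙 𝔼.obj) = 𝟙 𝔼.dual.obj := by
  simp only [dualHom, Category.id_comp, Iso.hom_inv_id]
  exact derivedDual_id _

lemma dualHom_comp {𝔼 𝔽 𝔾 : PerfectComplex R} (f : 𝔼.obj ⟶ 𝔽.obj) (g : 𝔽.obj ⟶ 𝔾.obj) :
    dualHom (𝔼 := 𝔼) (𝔽 := 𝔾) (f ≫ g) =
      dualHom (𝔼 := 𝔽) (𝔽 := 𝔾) g ≫ dualHom (𝔼 := 𝔼) (𝔽 := 𝔽) f := by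
  refine (congrArg (derivedDual (P := 𝔼.rep) (P' := 𝔾.rep)) ?_).trans
    (derivedDual_comp (P := 𝔼.rep) (P' := 𝔽.rep) (P'' := 𝔾.rep) (𝔼.repIso.hom ≫ f ≫ 𝔽.repIso.inv)
      (𝔽.repIso.hom ≫ g ≫ 𝔾.repIso.inv))
  simp

/-- The dual `f^∨ : 𝔼^∨ ⟶ P^∨` of a morphism `f : P ⟶ 𝔼` of `D(R)`, where `P` is a bounded complex of
vector bundles and `P^∨` is its termwise dual. -/
def dualHomTo (𝔼 : PerfectComplex R) {P : VBComplex R} (f : (Q R).obj P.cx ⟶ 𝔼.obj) :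
    𝔼.dual.obj ⟶ (Q R).obj P.dual.cx :=
  derivedDual (P := P) (P' := 𝔼.rep) (f ≫ 𝔼.repIso.inv)

/-- The canonical morphism `𝔼 ⟶ 𝔼^∨∨`. -/
def toBidual (𝔼 : PerfectComplex R) : 𝔼.obj ⟶ 𝔼.dual.dual.obj :=
  𝔼.repIso.inv ≫ (Q R).map (toBidualCx 𝔼.rep.cx) ≫
    derivedDual (P := 𝔼.dual.rep) (P' := 𝔼.rep.dual) 𝔼.dual.repIso.hom

end PerfectComplex

/-! ### Quadratic complexes and their self-dual representatives -/

/-- A quadratic complex: a perfect complex `𝔼` with an isomorphism `θ : 𝔼 ≅ 𝔼^∨` in `D(R)` such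
that `θ^∨ = θ` (under the identification `𝔼 = 𝔼^∨∨`). -/
structure QuadraticComplex (R : Type u) [CommRing R] extends PerfectComplex R where
  θ : obj ≅ toPerfectComplex.dual.obj
  symm : toPerfectComplex.toBidual ≫
    PerfectComplex.dualHom (𝔼 := toPerfectComplex) (𝔽 := toPerfectComplex.dual) θ.hom = θ.hom

/-- A self-dual representative of `𝔼`: a bounded complex of vector bundles `E` with an isomorphism
of complexes `θ : E ≅ E^∨` such that `θ^∨ = θ` (that is, `θ_i^∨ = θ_{-i}`), and an isomorphism
`α : E ≅ 𝔼` in `D(R)` that carries the class of `θ` to the quadratic structure of `𝔼`. -/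
structure SelfDualRep (𝔼 : QuadraticComplex R) extends VBComplex R where
  θ : cx ≅ dualCx cx
  symm : toBidualCx cx ≫ dualCxMap θ.hom = θ.hom
  α : (Q R).obj cx ≅ 𝔼.obj
  compat : α.hom ≫ 𝔼.θ.hom ≫ 𝔼.dualHomTo (P := toVBComplex) α.hom = (Q R).map θ.hom

/-! ### Isotropic reductions -/

variable {𝔼 : QuadraticComplex R}

/-- The data of an isotropic reduction from `E` to `F`, written `F ⇝ E`: a diagram `F ⟵ A ⟶ E` of
quasi-isomorphisms between bounded complexes of vector bundles, subject to the conditions below. -/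
structure Reduction (F E : SelfDualRep 𝔼) where
  A : VBComplex R
  f : A.cx ⟶ F.cx
  e : A.cx ⟶ E.cx
  quasiIso_f : QuasiIso f
  quasiIso_e : QuasiIso e
  /-- compatibility with the isomorphisms to `𝔼` -/
  compat : (Q R).map f ≫ F.α.hom = (Q R).map e ≫ E.α.hom
  isIso_f : ∀ i : ℤ, 1 ≤ i → IsIso (f.f i)
  isIso_e : ∀ i : ℤ, i ≤ -1 → IsIso (e.f i)
  /-- `(e, d) : A^1 ⟶ E^1 ⊕ A^2` is an inclusion of vector bundles, i.e. its dual is surjective -/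
  incl : Function.Surjective ((e.f 1).hom.prod (A.cx.d 1 2).hom).dualMap
  /-- the two composites `A ⟶ F ≅ F^∨ ⟶ A^∨` and `A ⟶ E ≅ E^∨ ⟶ A^∨` agree -/
  comm : f ≫ F.θ.hom ≫ dualCxMap f = e ≫ E.θ.hom ≫ dualCxMap e

/-- Two diagrams are identified if there is an isomorphism of the middle complexes that is compatible
with the maps to `F` and `E`. -/
instance reductionSetoid (F E : SelfDualRep 𝔼) : Setoid (Reduction F E) where
  r ξ ζ := ∃ φ : ξ.A.cx ≅ ζ.A.cx, φ.hom ≫ ζ.f = ξ.f ∧ φ.hom ≫ ζ.e = ξ.e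
  iseqv :=
    { refl := fun ξ => ⟨Iso.refl _, by simp, by simp⟩
      symm := by
        rintro ξ ζ ⟨φ, h₁, h₂⟩
        exact ⟨φ.symm, by simp [← h₁], by simp [← h₂]⟩
      trans := by
        rintro ξ ζ η ⟨φ, h₁, h₂⟩ ⟨ψ, h₃, h₄⟩
        exact ⟨φ ≪≫ ψ, by simp [h₃, h₁], by simp [h₄, h₂]⟩ }

/-- Isotropic reductions `F ⇝ E`. -/
def IsotropicReduction (F E : SelfDualRep 𝔼) : Type (u + 1) := Quotient (reductionSetoid F E)

namespace Reduction

/-- The identity reduction `E ⟵ E ⟶ E`. -/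
def id (E : SelfDualRep 𝔼) : Reduction E E where
  A := E.toVBComplex
  f := 𝟙 _
  e := 𝟙 _
  quasiIso_f := inferInstance
  quasiIso_e := inferInstance
  compat := rfl
  isIso_f i _ := inferInstanceAs (IsIso (𝟙 (E.cx.X i)))
  isIso_e i _ := inferInstanceAs (IsIso (𝟙 (E.cx.X i)))
  incl φ := ⟨φ ∘ₗ LinearMap.fst R _ _, rfl⟩
  comm := rfl

section Composition

variable {A B F : CochainComplex (ModuleCat.{u} R) ℤ}

lemma isPullback_X (f : A ⟶ F) (f' : B ⟶ F) (i : ℤ) :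
    IsPullback ((pullback.fst f f').f i) ((pullback.snd f f').f i) (f.f i) (f'.f i) :=
  (IsPullback.of_hasPullback f f').map (HomologicalComplex.eval _ _ i)

lemma exists_pullback (f : A ⟶ F) (f' : B ⟶ F) (i : ℤ) (a : A.X i) (b : B.X i)
    (h : f.f i a = f'.f i b) :
    ∃ p : (pullback f f').X i, (pullback.fst f f').f i p = a ∧ (pullback.snd f f').f i p = b :=
  Types.exists_of_isPullback ((isPullback_X f f' i).map (forget (ModuleCat.{u} R))) a b h

lemma pullback_ext (f : A ⟶ F) (f' : B ⟶ F) (i : ℤ) (p q : (pullback f f').X i)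
    (h₁ : (pullback.fst f f').f i p = (pullback.fst f f').f i q)
    (h₂ : (pullback.snd f f').f i p = (pullback.snd f f').f i q) : p = q :=
  Types.ext_of_isPullback ((isPullback_X f f' i).map (forget (ModuleCat.{u} R))) h₁ h₂

lemma exists_add_up_to_refinements (f : A ⟶ F) (f' : B ⟶ F) (hf' : QuasiIso f')
    (hf : ∀ i : ℤ, i ≤ -1 → IsIso (f.f i)) (hf₁ : ∀ i : ℤ, 1 ≤ i → IsIso (f'.f i))
    (i : ℤ) {T : ModuleCat.{u} R} (x : T ⟶ F.X i) :
    ∃ (T' : ModuleCat.{u} R) (π : T' ⟶ T) (_ : Epi π) (a : T' ⟶ A.X i) (b : T' ⟶ B.X i),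
      π ≫ x = a ≫ f.f i + b ≫ f'.f i := by
  rcases lt_trichotomy i 0 with hi | rfl | hi
  · have := hf i (by omega)
    exact ⟨T, 𝟙 _, inferInstance, x ≫ inv (f.f i), 0, by simp⟩
  · have := hf₁ 1 (by omega)
    have := hf₁ 2 (by omega)
    have := hf (-1) (by omega)
    have hm := (HomologicalComplex.mono_homologyMap_iff_up_to_refinements f' 0 1 2
      (by simp) (by simp)).1 inferInstance
    have he := (HomologicalComplex.epi_homologyMap_iff_up_to_refinements f' (-1) 0 1
      (by simp) (by simp)).1 inferInstance
    obtain ⟨T₁, π₁, _, b₀, hb₀⟩ := hm (x ≫ F.d 0 1 ≫ inv (f'.f 1))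
      (by
        rw [← cancel_mono (f'.f 2), Category.assoc, Category.assoc, Category.assoc, ← f'.comm,
          IsIso.inv_hom_id_assoc]
        simp) x (by simp)
    obtain ⟨T₂, π₂, _, b₁, hb₁, y, hy⟩ := he (π₁ ≫ x - b₀ ≫ f'.f 0) (by
      rw [Preadditive.sub_comp, Category.assoc, Category.assoc, f'.comm, ← Category.assoc b₀, ← hb₀]
      simp)
    refine ⟨T₂, π₂ ≫ π₁, epi_comp _ _, y ≫ inv (f.f (-1)) ≫ A.d (-1) 0, π₂ ≫ b₀ + b₁, ?_⟩
    rw [Preadditive.comp_sub, sub_eq_iff_eq_add] at hy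
    simp only [Category.assoc] at hy ⊢
    rw [hy, ← f.comm, IsIso.inv_hom_id_assoc]
    simp only [Preadditive.add_comp, Category.assoc]
    abel
  · have := hf₁ i (by omega)
    exact ⟨T, 𝟙 _, inferInstance, 0, x ≫ inv (f'.f i), by simp⟩

lemma quasiIso_pullback_fst (f : A ⟶ F) (f' : B ⟶ F) (hf' : QuasiIso f')
    (hf : ∀ i : ℤ, i ≤ -1 → IsIso (f.f i)) (hf₁ : ∀ i : ℤ, 1 ≤ i → IsIso (f'.f i)) :
    QuasiIso (pullback.fst f f') := by
  rw [quasiIso_iff]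
  intro j
  rw [quasiIsoAt_iff_isIso_homologyMap]
  have hp : (ComplexShape.up ℤ).prev j = j - 1 := by simp
  have hp' : (ComplexShape.up ℤ).prev (j - 1) = j - 1 - 1 := by simp
  have hn : (ComplexShape.up ℤ).next j = j + 1 := by simp
  have hn' : (ComplexShape.up ℤ).next (j - 1) = j := by simp
  have hm := (HomologicalComplex.mono_homologyMap_iff_up_to_refinements f' _ _ _ hp hn).1
    inferInstance
  have he := (HomologicalComplex.epi_homologyMap_iff_up_to_refinements f' _ _ _ hp hn).1
    inferInstance
  have he' := (HomologicalComplex.epi_homologyMap_iff_up_to_refinements f' _ _ _ hp' hn').1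
    inferInstance
  have hs := exists_add_up_to_refinements f f' hf' hf hf₁
  have : Mono (HomologicalComplex.homologyMap (pullback.fst f f') j) := by
    rw [HomologicalComplex.mono_homologyMap_iff_up_to_refinements _ _ _ _ hp hn]
    intro T x hx a ha
    obtain ⟨T₁, π₁, _, b, hb⟩ := hm (x ≫ (pullback.snd f f').f j)
      (by rw [Category.assoc, HomologicalComplex.Hom.comm, reassoc_of% hx, zero_comp])
      (a ≫ f.f (j - 1)) (by
        rw [Category.assoc, ← (isPullback_X f f' j).w, reassoc_of% ha, Category.assoc, f.comm])
    obtain ⟨T₂, π₂, _, b₁, hb₁, y, hy⟩ := he' (b ≫ f'.f (j - 1) - π₁ ≫ a ≫ f.f (j - 1)) (by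
      simp only [Preadditive.sub_comp, Category.assoc, HomologicalComplex.Hom.comm]
      rw [← reassoc_of% hb, ← (isPullback_X f f' j).w, reassoc_of% ha]
      simp)
    obtain ⟨T₃, π₃, _, a', b', hab⟩ := hs _ y
    let p : T₃ ⟶ (pullback f f').X (j - 1) := (isPullback_X f f' (j - 1)).lift
      (π₃ ≫ π₂ ≫ π₁ ≫ a + a' ≫ A.d _ _) (π₃ ≫ π₂ ≫ b - π₃ ≫ b₁ - b' ≫ B.d _ _) (by
        have := congr(π₃ ≫ $hy)
        simp only [Preadditive.comp_sub, Preadditive.comp_add, reassoc_of% hab] at this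
        simp only [Preadditive.sub_comp, Preadditive.add_comp, Category.assoc,
          HomologicalComplex.Hom.comm] at this ⊢
        rw [sub_eq_iff_eq_add] at this
        rw [this]
        abel)
    refine ⟨T₃, π₃ ≫ π₂ ≫ π₁, inferInstance, p, (isPullback_X f f' j).hom_ext ?_ ?_⟩
    · rw [Category.assoc p, ← HomologicalComplex.Hom.comm, (isPullback_X f f' _).lift_fst_assoc]
      simp [ha]
    · rw [Category.assoc p, ← HomologicalComplex.Hom.comm, (isPullback_X f f' _).lift_snd_assoc]
      simp [hb, hb₁]
  have : Epi (HomologicalComplex.homologyMap (pullback.fst f f') j) := by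
    rw [HomologicalComplex.epi_homologyMap_iff_up_to_refinements _ _ _ _ hp hn]
    intro T a ha
    obtain ⟨T₁, π₁, _, b, hb, y, hy⟩ := he (a ≫ f.f j) (by
      rw [Category.assoc, f.comm, reassoc_of% ha, zero_comp])
    obtain ⟨T₂, π₂, _, a', b', hab⟩ := hs _ y
    let p : T₂ ⟶ (pullback f f').X j := (isPullback_X f f' j).lift
      (π₂ ≫ π₁ ≫ a - a' ≫ A.d _ _) (π₂ ≫ b + b' ≫ B.d _ _) (by
        have := congr(π₂ ≫ $hy)
        simp only [Preadditive.comp_add, reassoc_of% hab] at this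
        simp only [Preadditive.sub_comp, Preadditive.add_comp, Category.assoc,
          HomologicalComplex.Hom.comm] at this ⊢
        rw [this]
        abel)
    refine ⟨T₂, π₂ ≫ π₁, inferInstance, p, (isPullback_X f f' (j + 1)).hom_ext ?_ ?_, a', ?_⟩
    · rw [Category.assoc p, ← HomologicalComplex.Hom.comm, (isPullback_X f f' _).lift_fst_assoc]
      simp [ha]
    · rw [Category.assoc p, ← HomologicalComplex.Hom.comm, (isPullback_X f f' _).lift_snd_assoc]
      simp [hb]
    · rw [(isPullback_X f f' _).lift_fst]
      simp
  exact isIso_of_mono_of_epi _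

/-- The fibre product of `f` and `f'` is a bounded complex of vector bundles. -/
def pullbackVB {A B F : VBComplex R} (f : A.cx ⟶ F.cx) (f' : B.cx ⟶ F.cx) (hf' : QuasiIso f')
    (hf : ∀ i : ℤ, i ≤ -1 → IsIso (f.f i)) (hf₁ : ∀ i : ℤ, 1 ≤ i → IsIso (f'.f i)) :
    VBComplex R := by
  have key (i : ℤ) : Module.Finite R ((pullback f f').X i) ∧
      Module.Projective R ((pullback f f').X i) := by
    have := A.finite i
    have := B.finite i
    have := A.projective i
    have := B.projective i
    have := F.projective i
    let φ : A.cx.X i ⊞ B.cx.X i ⟶ F.cx.X i := biprod.desc (f.f i) (-f'.f i)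
    have : Epi φ := by
      rw [epi_iff_surjective_up_to_refinements]
      intro T x
      obtain ⟨T', π, hπ, a, b, h⟩ := exists_add_up_to_refinements f f' hf' hf hf₁ i x
      exact ⟨T', π, hπ, biprod.lift a (-b), by simp [φ, h]⟩
    obtain ⟨s, hs⟩ : ∃ s : F.cx.X i ⟶ A.cx.X i ⊞ B.cx.X i, s ≫ φ = 𝟙 _ :=
      ⟨Projective.factorThru (𝟙 _) φ, by simp⟩
    let j : (pullback f f').X i ⟶ A.cx.X i ⊞ B.cx.X i :=
      biprod.lift ((pullback.fst f f').f i) ((pullback.snd f f').f i)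
    have hj : j ≫ φ = 0 := by simp [j, φ, (isPullback_X f f' i).w]
    have hφ : φ = biprod.fst ≫ f.f i - biprod.snd ≫ f'.f i := by
      apply biprod.hom_ext' <;> simp [φ]
    let r : A.cx.X i ⊞ B.cx.X i ⟶ (pullback f f').X i := (isPullback_X f f' i).lift
      ((𝟙 _ - φ ≫ s) ≫ biprod.fst) ((𝟙 _ - φ ≫ s) ≫ biprod.snd) (by
        rw [← sub_eq_zero, Category.assoc, Category.assoc, ← Preadditive.comp_sub, ← hφ,
          Preadditive.sub_comp, Category.assoc, hs]
        simp)
    have hr : j ≫ r = 𝟙 _ := by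
      refine (isPullback_X f f' i).hom_ext ?_ ?_
      · rw [Category.assoc, (isPullback_X f f' i).lift_fst, Preadditive.sub_comp,
          Preadditive.comp_sub, Category.assoc, reassoc_of% hj]
        simp [j]
      · rw [Category.assoc, (isPullback_X f f' i).lift_snd, Preadditive.sub_comp,
          Preadditive.comp_sub, Category.assoc, reassoc_of% hj]
        simp [j]
    have e := (ModuleCat.biprodIsoProd (A.cx.X i) (B.cx.X i)).toLinearEquiv.symm
    have : Module.Finite R (A.cx.X i ⊞ B.cx.X i : ModuleCat.{u} R) :=
      Module.Finite.equiv (M := A.cx.X i × B.cx.X i) e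
    have : Module.Projective R (A.cx.X i ⊞ B.cx.X i : ModuleCat.{u} R) :=
      Module.Projective.of_equiv (M := A.cx.X i × B.cx.X i) e
    have hr' : r.hom ∘ₗ j.hom = LinearMap.id := congrArg ModuleCat.Hom.hom hr
    exact ⟨Module.Finite.of_surjective r.hom fun p => ⟨j.hom p, congr($hr' p)⟩,
      Module.Projective.of_split j.hom r.hom hr'⟩
  exact
  { cx := pullback f f'
    bounded := by
      obtain ⟨a, b, h⟩ := A.bounded
      obtain ⟨a', b', h'⟩ := B.bounded
      refine ⟨min a a', max b b', fun i hi => ?_⟩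
      have h₁ : IsZero (A.cx.X i) := h i (by omega)
      have h₂ : IsZero (B.cx.X i) := h' i (by omega)
      rw [IsZero.iff_id_eq_zero]
      exact (isPullback_X f f' i).hom_ext (h₁.eq_of_tgt _ _) (h₂.eq_of_tgt _ _)
    finite := fun i => (key i).1
    projective := fun i => (key i).2 }

lemma isIso_pullback_fst (f : A ⟶ F) (f' : B ⟶ F) (i : ℤ) (h : IsIso (f'.f i)) :
    IsIso ((pullback.fst f f').f i) :=
  (isPullback_X f f' i).isIso_fst_of_isIso

lemma isIso_pullback_snd (f : A ⟶ F) (f' : B ⟶ F) (i : ℤ) (h : IsIso (f.f i)) :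
    IsIso ((pullback.snd f f').f i) :=
  (isPullback_X f f' i).isIso_snd_of_isIso

end Composition

/-- The composition of `ξ : G ⇝ F` and `ζ : F ⇝ E`. The middle complex is the fibre product over `F`
of the two middle complexes. In positive degrees it is `G`, in negative degrees it is `E`, and in
degree `0` it is the kernel of `E^0 ⊕ G^1 ⟶ E^1 ⊕ G^2`, so that it is the complex obtained by
splicing along the composite `G_+ ⟶ F_+ ⟶ E`. -/
def comp {G F E : SelfDualRep 𝔼} (ξ : Reduction G F) (ζ : Reduction F E) : Reduction G E :=
  have hq := ζ.quasiIso_f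
  have hq' := ξ.quasiIso_e
  have hfst : QuasiIso (pullback.fst ξ.e ζ.f) :=
    quasiIso_pullback_fst ξ.e ζ.f hq ξ.isIso_e ζ.isIso_f
  have hsnd : QuasiIso (pullback.snd ξ.e ζ.f) := by
    have : QuasiIso (pullback.snd ξ.e ζ.f ≫ ζ.f) := by
      rw [← pullback.condition]; infer_instance
    exact quasiIso_of_comp_right _ ζ.f
  { A := pullbackVB (F := F.toVBComplex) ξ.e ζ.f hq ξ.isIso_e ζ.isIso_f
    f := pullback.fst ξ.e ζ.f ≫ ξ.f
    e := pullback.snd ξ.e ζ.f ≫ ζ.e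
    quasiIso_f := by
      have := ξ.quasiIso_f
      exact inferInstanceAs (QuasiIso (pullback.fst ξ.e ζ.f ≫ ξ.f))
    quasiIso_e := by
      have := ζ.quasiIso_e
      exact inferInstanceAs (QuasiIso (pullback.snd ξ.e ζ.f ≫ ζ.e))
    compat := by
      have h₁ : (Q R).map (pullback.fst ξ.e ζ.f ≫ ξ.f) ≫ G.α.hom =
          (Q R).map (pullback.fst ξ.e ζ.f ≫ ξ.e) ≫ F.α.hom := by
        rw [Functor.map_comp, Functor.map_comp, Category.assoc, Category.assoc, ξ.compat]
      have h₂ : (Q R).map (pullback.snd ξ.e ζ.f ≫ ζ.e) ≫ E.α.hom =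
          (Q R).map (pullback.snd ξ.e ζ.f ≫ ζ.f) ≫ F.α.hom := by
        rw [Functor.map_comp, Functor.map_comp, Category.assoc, Category.assoc, ζ.compat]
      exact h₁.trans ((congrArg (fun t => (Q R).map t ≫ F.α.hom) pullback.condition).trans h₂.symm)
    isIso_f := fun i hi => by
      have := isIso_pullback_fst ξ.e ζ.f i (ζ.isIso_f i hi)
      have := ξ.isIso_f i hi
      exact inferInstanceAs (IsIso ((pullback.fst ξ.e ζ.f).f i ≫ ξ.f.f i))
    isIso_e := fun i hi => by
      have := isIso_pullback_snd ξ.e ζ.f i (ξ.isIso_e i hi)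
      have := ζ.isIso_e i hi
      exact inferInstanceAs (IsIso ((pullback.snd ξ.e ζ.f).f i ≫ ζ.e.f i))
    incl := fun φ => by
      have := isIso_pullback_fst ξ.e ζ.f 1 (ζ.isIso_f 1 le_rfl)
      obtain ⟨β, hβ⟩ := ξ.incl (φ ∘ₗ (inv ((pullback.fst ξ.e ζ.f).f 1)).hom)
      obtain ⟨δ, hδ⟩ := ζ.incl (β ∘ₗ LinearMap.inl R _ _ ∘ₗ (ζ.f.f 1).hom)
      refine ⟨δ ∘ₗ LinearMap.prodMap LinearMap.id ((pullback.snd ξ.e ζ.f).f 2).hom +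
        β ∘ₗ LinearMap.inr R _ _ ∘ₗ ((pullback.fst ξ.e ζ.f).f 2).hom ∘ₗ LinearMap.snd R _ _,
        LinearMap.ext fun (p : (pullback ξ.e ζ.f).X 1) => ?_⟩
      have h₁ : β (ξ.e.f 1 ((pullback.fst ξ.e ζ.f).f 1 p),
          ξ.A.cx.d 1 2 ((pullback.fst ξ.e ζ.f).f 1 p)) = φ p :=
        (congr($hβ ((pullback.fst ξ.e ζ.f).f 1 p))).trans
          (congrArg φ congr($(IsIso.hom_inv_id ((pullback.fst ξ.e ζ.f).f 1)) p))
      have h₂ : δ (ζ.e.f 1 ((pullback.snd ξ.e ζ.f).f 1 p),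
          ζ.A.cx.d 1 2 ((pullback.snd ξ.e ζ.f).f 1 p)) =
            β (ζ.f.f 1 ((pullback.snd ξ.e ζ.f).f 1 p), 0) :=
        congr($hδ ((pullback.snd ξ.e ζ.f).f 1 p))
      have h₃ : (pullback.snd ξ.e ζ.f).f 2 ((pullback ξ.e ζ.f).d 1 2 p) =
          ζ.A.cx.d 1 2 ((pullback.snd ξ.e ζ.f).f 1 p) :=
        congr($(((pullback.snd ξ.e ζ.f).comm 1 2).symm) p)
      have h₄ : (pullback.fst ξ.e ζ.f).f 2 ((pullback ξ.e ζ.f).d 1 2 p) =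
          ξ.A.cx.d 1 2 ((pullback.fst ξ.e ζ.f).f 1 p) :=
        congr($(((pullback.fst ξ.e ζ.f).comm 1 2).symm) p)
      have h₅ : ξ.e.f 1 ((pullback.fst ξ.e ζ.f).f 1 p) =
          ζ.f.f 1 ((pullback.snd ξ.e ζ.f).f 1 p) :=
        congr($((isPullback_X ξ.e ζ.f 1).w) p)
      have h₆ : δ (ζ.e.f 1 ((pullback.snd ξ.e ζ.f).f 1 p),
            (pullback.snd ξ.e ζ.f).f 2 ((pullback ξ.e ζ.f).d 1 2 p)) +
          β (0, (pullback.fst ξ.e ζ.f).f 2 ((pullback ξ.e ζ.f).d 1 2 p)) = φ p := by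
        rw [h₃, h₄, h₂, ← h₁, h₅, ← map_add, Prod.mk_add_mk, add_zero, zero_add]
      exact h₆
    comm := by
      have h : pullback.fst ξ.e ζ.f ≫ ξ.e = pullback.snd ξ.e ζ.f ≫ ζ.f := pullback.condition
      have h₁ : (pullback.fst ξ.e ζ.f ≫ ξ.f) ≫ G.θ.hom ≫ dualCxMap (pullback.fst ξ.e ζ.f ≫ ξ.f) =
          (pullback.fst ξ.e ζ.f ≫ ξ.e) ≫ F.θ.hom ≫ dualCxMap (pullback.fst ξ.e ζ.f ≫ ξ.e) := by
        simp only [dualCxMap_comp, Category.assoc, reassoc_of% ξ.comm]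
      have h₂ : (pullback.snd ξ.e ζ.f ≫ ζ.e) ≫ E.θ.hom ≫ dualCxMap (pullback.snd ξ.e ζ.f ≫ ζ.e) =
          (pullback.snd ξ.e ζ.f ≫ ζ.f) ≫ F.θ.hom ≫ dualCxMap (pullback.snd ξ.e ζ.f ≫ ζ.f) := by
        simp only [dualCxMap_comp, Category.assoc, ← reassoc_of% ζ.comm]
      exact h₁.trans ((congrArg (fun t => t ≫ F.θ.hom ≫ dualCxMap t) h).trans h₂.symm) }

/-- The projections of the middle complex of a composition. -/
def compFst {G F E : SelfDualRep 𝔼} (ξ : Reduction G F) (ζ : Reduction F E) :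
    (ξ.comp ζ).A.cx ⟶ ξ.A.cx := pullback.fst ξ.e ζ.f

/-- The projections of the middle complex of a composition. -/
def compSnd {G F E : SelfDualRep 𝔼} (ξ : Reduction G F) (ζ : Reduction F E) :
    (ξ.comp ζ).A.cx ⟶ ζ.A.cx := pullback.snd ξ.e ζ.f

lemma comp_f {G F E : SelfDualRep 𝔼} (ξ : Reduction G F) (ζ : Reduction F E) :
    (ξ.comp ζ).f = compFst ξ ζ ≫ ξ.f := rfl

lemma comp_e {G F E : SelfDualRep 𝔼} (ξ : Reduction G F) (ζ : Reduction F E) :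
    (ξ.comp ζ).e = compSnd ξ ζ ≫ ζ.e := rfl

lemma isPullback_comp {G F E : SelfDualRep 𝔼} (ξ : Reduction G F) (ζ : Reduction F E) :
    IsPullback (compFst ξ ζ) (compSnd ξ ζ) ξ.e ζ.f := IsPullback.of_hasPullback ξ.e ζ.f

/-- The composition is computed by any fibre product. -/
lemma comp_equiv_of_isPullback {G F E : SelfDualRep 𝔼} (ξ : Reduction G F) (ζ : Reduction F E)
    (η : Reduction G E) (p : η.A.cx ⟶ ξ.A.cx) (q : η.A.cx ⟶ ζ.A.cx) (h : IsPullback p q ξ.e ζ.f)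
    (hf : p ≫ ξ.f = η.f) (he : q ≫ ζ.e = η.e) : ξ.comp ζ ≈ η := by
  refine ⟨IsPullback.isoIsPullback _ _ (isPullback_comp ξ ζ) h, ?_, ?_⟩
  · rw [← hf, IsPullback.isoIsPullback_hom_fst_assoc, comp_f]
  · rw [← he, IsPullback.isoIsPullback_hom_snd_assoc, comp_e]

lemma comp_congr {G F E : SelfDualRep 𝔼} {ξ ξ' : Reduction G F} {ζ ζ' : Reduction F E}
    (h : ξ ≈ ξ') (h' : ζ ≈ ζ') : ξ.comp ζ ≈ ξ'.comp ζ' := by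
  obtain ⟨φ, h₁, h₂⟩ := h
  obtain ⟨ψ, h₃, h₄⟩ := h'
  refine Setoid.symm (comp_equiv_of_isPullback ξ' ζ' (ξ.comp ζ)
    (compFst ξ ζ ≫ φ.hom) (compSnd ξ ζ ≫ ψ.hom) ?_ ?_ ?_)
  · exact (isPullback_comp ξ ζ).of_iso (Iso.refl _) φ ψ (Iso.refl _)
      (Category.id_comp _).symm (Category.id_comp _).symm (by simp [h₂]) (by simp [h₃])
  · rw [Category.assoc, h₁, comp_f]
  · rw [Category.assoc, h₄, comp_e]

lemma id_comp {F E : SelfDualRep 𝔼} (ξ : Reduction F E) : (id F).comp ξ ≈ ξ :=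
  comp_equiv_of_isPullback (id F) ξ ξ ξ.f (𝟙 _) (IsPullback.of_id_snd (f := ξ.f))
    (Category.comp_id _) (Category.id_comp _)

lemma comp_id {F E : SelfDualRep 𝔼} (ξ : Reduction F E) : ξ.comp (id E) ≈ ξ :=
  comp_equiv_of_isPullback ξ (id E) ξ (𝟙 _) ξ.e (IsPullback.of_id_fst (f := ξ.e))
    (Category.id_comp _) (Category.comp_id _)

lemma assoc {H G F E : SelfDualRep 𝔼} (ξ : Reduction H G) (ζ : Reduction G F)
    (η : Reduction F E) : (ξ.comp ζ).comp η ≈ ξ.comp (ζ.comp η) := by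
  let p : (ξ.comp (ζ.comp η)).A.cx ⟶ (ξ.comp ζ).A.cx := (isPullback_comp ξ ζ).lift
    (compFst ξ (ζ.comp η)) (compSnd ξ (ζ.comp η) ≫ compFst ζ η) (by
      rw [(isPullback_comp ξ (ζ.comp η)).w, comp_f, Category.assoc])
  have hp₁ : p ≫ compFst ξ ζ = compFst ξ (ζ.comp η) := IsPullback.lift_fst _ _ _ _
  have hp₂ : p ≫ compSnd ξ ζ = compSnd ξ (ζ.comp η) ≫ compFst ζ η := IsPullback.lift_snd _ _ _ _
  have h := isPullback_comp ξ (ζ.comp η)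
  rw [← hp₁, comp_f] at h
  have h' : IsPullback p (compSnd ξ (ζ.comp η)) (compSnd ξ ζ) (compFst ζ η) :=
    IsPullback.of_right h hp₂ (isPullback_comp ξ ζ)
  refine comp_equiv_of_isPullback (ξ.comp ζ) η _ p (compSnd ξ (ζ.comp η) ≫ compSnd ζ η)
    (h'.paste_vert (isPullback_comp ζ η)) ?_ ?_
  · rw [comp_f, reassoc_of% hp₁, comp_f]
  · rw [comp_e, comp_e, Category.assoc]

end Reduction

/-- The category `𝓡` of self-dual representatives of `𝔼`: morphisms `F ⟶ E` are the isotropic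
reductions `F ⇝ E`. -/
instance selfDualRepCategory : Category.{u + 1} (SelfDualRep 𝔼) where
  Hom F E := IsotropicReduction F E
  id E := ⟦Reduction.id E⟧
  comp := Quotient.map₂ Reduction.comp fun _ _ h _ _ h' => Reduction.comp_congr h h'
  id_comp := by
    rintro F E ⟨ξ⟩
    exact Quotient.sound (Reduction.id_comp ξ)
  comp_id := by
    rintro F E ⟨ξ⟩
    exact Quotient.sound (Reduction.comp_id ξ)
  assoc := by
    rintro H G F E ⟨ξ⟩ ⟨ζ⟩ ⟨η⟩
    exact Quotient.sound (Reduction.assoc ξ ζ η)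

end QuadCx

end

/-! Below, `*` stands for `adj` and composites are read in diagrammatic order. The idea is to trade
isotropic reductions for isometries. An isometric chain map `s : F ⟶ E` splits `E` orthogonally into
`F` and an acyclic self-dual complement. As 2 is invertible, a contraction of the complement can be
made self-adjoint; its part in low degrees projects onto a Lagrangian `L`, and `F ⟵ F ⊕ L ⟶ E` is a
reduction. It is the only one, up to isomorphism, for which `s` lifts to a section of the left leg
(`IsometricMap.exists_reduction`), so isometries map functorially to reductions.

For a functor `Φ` to a groupoid, three facts then suffice. Any two representatives embed
isometrically into a third (`exists_cospan`). Parallel isometries have the same image under `Φ`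
(`map_red_eq`). Every reduction becomes a fraction of isometries under `Φ` (`exists_map_eq`). Hence
the comparison of `Φ.obj E` with `Φ.obj E₀` through a cospan of isometries does not depend on the
cospan, and it is natural. Some `E₀` exists by `nonempty_selfDualRep`.

The source of the second fact is a scaling argument (`map_expMap`). Let `M` be the orthogonal sum of
`E` and the hyperbolic complex on an acyclic `X`. The isometry `ρ` of `M` that is 2 on `X`, 1/2 on
the dual of `X` and 1 on `E` fixes the embedding of `E`, so `Φ` sends it to the identity.
Conjugation by `ρ` turns certain Eichler transformations into their squares or their square roots;
their image then equals its own square, and is trivial. An isometry `g` homotopic to the identity is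
built, after stabilization, from such transformations (`map_red_eq_id`). Two parallel isometries
become conjugate under a linear automorphism after stabilization, and an adjustment on Lagrangians
replaces that automorphism by an isometry homotopic to the identity (`map_red_eq_of_conj`).

For the third fact, a reduction is enlarged by an acyclic complex in negative degrees until its left
leg is surjective. The leg then has a section, so the enlarged reduction comes from an isometry;
what remains is a reduction of a stabilization back to `E`, a one-sided inverse of the embedding of
`E`. -/

noncomputable section
open CategoryTheory Limits
namespace QuadCx
variable {R : Type u} [CommRing R]

/-! ### Null-homotopic maps -/

/-- Families of maps between the terms of two complexes. -/
abbrev Fam (C D : CochainComplex (ModuleCat.{u} R) ℤ) := ∀ i j : ℤ, C.X i ⟶ D.X j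

section Nul

variable {B C D E : CochainComplex (ModuleCat.{u} R) ℤ}

/-- The null-homotopic chain map `d k + k d`. -/
@[simps]
def nul (k : Fam C D) : C ⟶ D where
  f i := C.d i (i + 1) ≫ k (i + 1) i + k i (i - 1) ≫ D.d (i - 1) i
  comm' i j h := by
    obtain rfl : i + 1 = j := h
    simp only [Preadditive.comp_add, Preadditive.add_comp, Category.assoc,
      HomologicalComplex.d_comp_d, HomologicalComplex.d_comp_d_assoc, comp_zero, zero_comp,
      add_zero, zero_add]
    rw [Int.add_sub_cancel i 1]

lemma nul_f_eq (k : Fam C D) {a i b : ℤ} (h : a + 1 = i) (h' : i + 1 = b) :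
    (nul k).f i = C.d i b ≫ k b i + k i a ≫ D.d a i := by
  obtain rfl : a = i - 1 := by omega
  subst h'
  rfl

lemma nul_congr {k k' : Fam C D} (h : ∀ i j, j + 1 = i → k i j = k' i j) : nul k = nul k' := by
  ext1 i
  simp only [nul_f]
  rw [h (i + 1) i rfl, h i (i - 1) (by omega)]

lemma nul_add (k k' : Fam C D) : nul (k + k') = nul k + nul k' := by
  ext1 i
  simp only [nul_f, Pi.add_apply, Preadditive.comp_add, Preadditive.add_comp,
    HomologicalComplex.add_f_apply]
  abel

lemma nul_sub (k k' : Fam C D) : nul (k - k') = nul k - nul k' := by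
  ext1 i
  simp only [nul_f, Pi.sub_apply, Preadditive.comp_sub, Preadditive.sub_comp,
    HomologicalComplex.sub_f_apply]
  abel

lemma nul_smul (r : R) (k : Fam C D) : nul (r • k) = r • nul k := by
  ext1 i
  simp only [nul_f, Pi.smul_apply, Linear.comp_smul, Linear.smul_comp,
    HomologicalComplex.smul_f_apply, smul_add]

/-- Precomposition of a family with a chain map. -/
def Fam.pre (f : B ⟶ C) (k : Fam C D) : Fam B D := fun i j => f.f i ≫ k i j

/-- Postcomposition of a family with a chain map. -/
def Fam.post (k : Fam C D) (g : D ⟶ E) : Fam C E := fun i j => k i j ≫ g.f j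

lemma nul_pre (f : B ⟶ C) (k : Fam C D) : nul (k.pre f) = f ≫ nul k := by
  ext1 i
  simp [Fam.pre]

lemma nul_post (k : Fam C D) (g : D ⟶ E) : nul (k.post g) = nul k ≫ g := by
  ext1 i
  simp [Fam.post]

lemma Q_map_nul (k : Fam C D) : (Q R).map (nul k) = 0 := by
  -- Homotopies must vanish off the shape of the complex. The other entries of `k` play no role in
  -- `nul k`, so they are cut off.
  let k' : Fam C D := fun i j => if j + 1 = i then k i j else 0
  have h : nul k = Homotopy.nullHomotopicMap k' := by
    ext1 i
    rw [Homotopy.nullHomotopicMap_f (k₂ := i - 1) (k₀ := i + 1) (by simp) (by simp)]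
    simp [k']
  rw [h, map_eq_of_homotopy (Homotopy.nullHomotopy k' fun i j hij => by
    simp only [ComplexShape.up_Rel] at hij
    simp [k', hij]), Functor.map_zero]

lemma eq_add_nul_of_homotopy {f g : C ⟶ D} (h : Homotopy f g) : f = g + nul h.hom := by
  ext1 i
  have := h.comm i
  rw [dNext_eq _ (show (ComplexShape.up ℤ).Rel i (i + 1) by simp),
    prevD_eq _ (show (ComplexShape.up ℤ).Rel (i - 1) i by simp)] at this
  rw [this, HomologicalComplex.add_f_apply, nul_f, add_comm]

lemma VBComplex.exists_nul (P : VBComplex R) {f g : P.cx ⟶ D} (h : (Q R).map f = (Q R).map g) :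
    ∃ k : Fam P.cx D, f - g = nul k := by
  obtain ⟨H⟩ := P.homotopy_of_map_eq h
  exact ⟨H.hom, sub_eq_iff_eq_add'.2 (eq_add_nul_of_homotopy H)⟩

/-- The part of a family that starts in degrees at most `n`. -/
def Fam.low (n : ℤ) (k : Fam C D) : Fam C D := fun i j => if i ≤ n then k i j else 0

lemma nul_low_lt {n : ℤ} (k : Fam C D) {i : ℤ} (h : i < n) :
    (nul (k.low n)).f i = (nul k).f i := by
  simp [Fam.low, h.le, Int.add_one_le_iff.2 h]

lemma nul_low_gt {n : ℤ} (k : Fam C D) {i : ℤ} (h : n < i) : (nul (k.low n)).f i = 0 := by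
  simp [Fam.low, h.not_ge, h.not_gt]

/-- Truncation kills the summand `d k` in degree `n`, so only boundaries remain there. All later
vanishing of products of a low and a high map rests on this. -/
lemma nul_low_self {n a : ℤ} (h : a + 1 = n) (k : Fam C D) :
    (nul (k.low n)).f n = k n a ≫ D.d a n := by
  obtain rfl : a = n - 1 := by omega
  simp [Fam.low]

end Nul

/-! ### Duality -/

section Dual

variable {C D E : CochainComplex (ModuleCat.{u} R) ℤ}

lemma dualModMap_sub {M N : ModuleCat.{u} R} (f g : M ⟶ N) :
    dualModMap (f - g) = dualModMap f - dualModMap g :=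
  ModuleCat.hom_ext (LinearMap.ext fun φ => LinearMap.ext fun _ => map_sub φ _ _)

lemma dualModMap_smul {M N : ModuleCat.{u} R} (r : R) (f : M ⟶ N) :
    dualModMap (r • f) = r • dualModMap f :=
  ModuleCat.hom_ext (LinearMap.ext fun φ => LinearMap.ext fun _ => map_smul φ _ _)

lemma dualCxMap_add (f g : C ⟶ D) : dualCxMap (f + g) = dualCxMap f + dualCxMap g := by
  ext1 i; exact dualModMap_add _ _

lemma dualCxMap_sub (f g : C ⟶ D) : dualCxMap (f - g) = dualCxMap f - dualCxMap g := by
  ext1 i; exact dualModMap_sub _ _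

lemma dualCxMap_smul (r : R) (f : C ⟶ D) : dualCxMap (r • f) = r • dualCxMap f := by
  ext1 i; exact dualModMap_smul _ _

lemma dualCxMap_zero : dualCxMap (0 : C ⟶ D) = 0 := by
  ext1 i; exact dualModMap_zero _ _

/-- The transpose of a family. -/
def Fam.dual (k : Fam C D) : Fam (dualCx D) (dualCx C) := fun i j => dualModMap (k (-j) (-i))

lemma dualCxMap_nul (k : Fam C D) : dualCxMap (nul k) = nul k.dual := by
  ext1 i
  rw [dualCxMap_f, nul_f_eq (a := -(i + 1)) (b := -(i - 1)) k (by omega) (by omega),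
    dualModMap_add, dualModMap_comp, dualModMap_comp, add_comm]
  rfl

lemma XIsoOfEq_naturality (f : C ⟶ D) {i j : ℤ} (h : i = j) :
    (C.XIsoOfEq h).hom ≫ f.f j = f.f i ≫ (D.XIsoOfEq h).hom := by
  subst h
  simp [HomologicalComplex.XIsoOfEq]

lemma toBidualCx_naturality (f : C ⟶ D) :
    f ≫ toBidualCx D = toBidualCx C ≫ dualCxMap (dualCxMap f) := by
  ext1 i
  have : (C.XIsoOfEq (neg_neg i).symm).hom ≫ f.f (-(-i)) =
      f.f i ≫ (D.XIsoOfEq (neg_neg i).symm).hom := XIsoOfEq_naturality f _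
  refine ModuleCat.hom_ext (LinearMap.ext fun x => LinearMap.ext
    fun (φ : Module.Dual R (D.X (-(-i)))) => ?_)
  exact congrArg φ (congr($this x)).symm

/-- Triangle identity of biduality; it makes transposition an involution. -/
lemma toBidualCx_dual (C : CochainComplex (ModuleCat.{u} R) ℤ) :
    toBidualCx (dualCx C) ≫ dualCxMap (toBidualCx C) = 𝟙 (dualCx C) := by
  ext1 i
  refine ModuleCat.hom_ext (LinearMap.ext fun (φ : Module.Dual R (C.X (-i))) =>
    LinearMap.ext fun (x : C.X (-i)) => ?_)
  have key : ∀ (j : ℤ) (h : i = j) (φ : Module.Dual R (C.X (-i))) (x : C.X (-j)),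
      (show Module.Dual R (C.X (-j)) from ((dualCx C).XIsoOfEq h).hom φ) x =
        φ ((C.XIsoOfEq (by omega : -j = -i)).hom x) := by
    rintro j rfl φ x
    rfl
  refine (key _ (neg_neg i).symm φ _).trans (congrArg φ ?_)
  have : (C.XIsoOfEq (neg_neg (-i)).symm).hom ≫ (C.XIsoOfEq (by omega : - -(-i) = -i)).hom =
      𝟙 _ := by simp [HomologicalComplex.XIsoOfEq]
  exact congr($this x)

lemma VBComplex.isIso_toBidual (P : VBComplex R) : IsIso (toBidualCx P.cx) := by
  have (i : ℤ) : IsIso ((toBidualCx P.cx).f i) := by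
    have := P.finite (-(-i))
    have := P.projective (-(-i))
    have : IsIso (ModuleCat.ofHom (Module.Dual.eval R (P.cx.X (-(-i))))) :=
      (Module.evalEquiv R (P.cx.X (-(-i)))).toModuleIso.isIso_hom
    exact inferInstanceAs (IsIso ((P.cx.XIsoOfEq (neg_neg i).symm).hom ≫
      ModuleCat.ofHom (Module.Dual.eval R (P.cx.X (-(-i))))))
  exact HomologicalComplex.Hom.isIso_of_components _

end Dual

end QuadCx
end

noncomputable section
open CategoryTheory Limits
namespace QuadCx
variable {R : Type u} [CommRing R]

/-! ### Adjoints -/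

section

variable {A B C D : CochainComplex (ModuleCat.{u} R) ℤ}

lemma Fam.post_toBidualCx (k : Fam C D) :
    k.post (toBidualCx D) = k.dual.dual.pre (toBidualCx C) := by
  funext i j
  have key : ∀ i' j' (hi : i = i') (hj : j = j'), k i j ≫ (D.XIsoOfEq hj).hom =
      (C.XIsoOfEq hi).hom ≫ k i' j' := by
    rintro _ _ rfl rfl
    simp [HomologicalComplex.XIsoOfEq]
  refine ModuleCat.hom_ext (LinearMap.ext fun x => LinearMap.ext
    fun (φ : Module.Dual R (D.X (-(-j)))) => ?_)
  exact congrArg φ (congr($(key _ _ (neg_neg i).symm (neg_neg j).symm) x))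

lemma Fam.dual_pre (f : B ⟶ C) (k : Fam C D) : (k.pre f).dual = k.dual.post (dualCxMap f) := rfl

lemma Fam.dual_post (k : Fam C D) (f : D ⟶ B) : (k.post f).dual = k.dual.pre (dualCxMap f) := rfl

lemma Fam.pre_pre (f : A ⟶ B) (g : B ⟶ C) (k : Fam C D) : (k.pre g).pre f = k.pre (f ≫ g) := by
  funext i j; simp [Fam.pre]

lemma Fam.post_post (k : Fam A B) (f : B ⟶ C) (g : C ⟶ D) :
    (k.post f).post g = k.post (f ≫ g) := by
  funext i j; simp [Fam.post]

lemma Fam.post_pre (f : A ⟶ B) (k : Fam B C) (g : C ⟶ D) :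
    (k.pre f).post g = (k.post g).pre f := by
  funext i j; simp [Fam.post, Fam.pre]

lemma Fam.post_id (k : Fam A B) : k.post (𝟙 B) = k := by
  funext i j; simp [Fam.post]

end

section Adj

variable {𝔼 : QuadraticComplex R} {E F G : SelfDualRep 𝔼}

/-- The adjoint of a chain map between self-dual complexes. -/
def adj (φ : E.cx ⟶ F.cx) : F.cx ⟶ E.cx := F.θ.hom ≫ dualCxMap φ ≫ E.θ.inv

/-- The adjoint of a family of maps between self-dual complexes. -/
def Fam.adj (k : Fam E.cx F.cx) : Fam F.cx E.cx := (k.dual.post E.θ.inv).pre F.θ.hom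

lemma adj_id : adj (𝟙 E.cx) = 𝟙 E.cx := by
  rw [adj, dualCxMap_id, Category.id_comp, Iso.hom_inv_id]

lemma adj_comp (f : E.cx ⟶ F.cx) (g : F.cx ⟶ G.cx) : adj (f ≫ g) = adj g ≫ adj f := by
  simp [adj, dualCxMap_comp]

lemma adj_add (f g : E.cx ⟶ F.cx) : adj (f + g) = adj f + adj g := by
  simp [adj, dualCxMap_add]

lemma adj_sub (f g : E.cx ⟶ F.cx) : adj (f - g) = adj f - adj g := by
  simp [adj, dualCxMap_sub]

lemma adj_smul (r : R) (f : E.cx ⟶ F.cx) : adj (r • f) = r • adj f := by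
  simp [adj, dualCxMap_smul]

lemma adj_zero : adj (0 : E.cx ⟶ F.cx) = 0 := by
  simp [adj, dualCxMap_zero]

lemma adj_neg (f : E.cx ⟶ F.cx) : adj (-f) = -adj f := by
  rw [← zero_sub, adj_sub, adj_zero, zero_sub]

lemma adj_nul (k : Fam E.cx F.cx) : adj (nul k) = nul k.adj := by
  rw [adj, dualCxMap_nul, ← nul_post, ← nul_pre]
  rfl

lemma SelfDualRep.θ_dual_inv (E : SelfDualRep 𝔼) :
    E.θ.hom ≫ dualCxMap E.θ.inv = toBidualCx E.cx := by
  conv_lhs => rw [← E.symm]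
  rw [Category.assoc, ← dualCxMap_comp, Iso.inv_hom_id, dualCxMap_id, Category.comp_id]

lemma SelfDualRep.toBidual_dual_θ (E : SelfDualRep 𝔼) :
    toBidualCx E.cx ≫ dualCxMap E.θ.hom ≫ E.θ.inv = 𝟙 _ := by
  rw [reassoc_of% E.symm, Iso.hom_inv_id]

lemma Fam.adj_adj (k : Fam E.cx F.cx) : k.adj.adj = k := by
  rw [Fam.adj, Fam.adj, Fam.dual_pre, Fam.dual_post, Fam.post_post, ← Fam.post_pre, Fam.pre_pre,
    E.θ_dual_inv, ← Fam.post_toBidualCx, Fam.post_post, F.toBidual_dual_θ, Fam.post_id]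

@[simp]
lemma adj_adj (f : E.cx ⟶ F.cx) : adj (adj f) = f := by
  rw [adj, adj, dualCxMap_comp, dualCxMap_comp, Category.assoc, Category.assoc,
    reassoc_of% E.θ_dual_inv, ← reassoc_of% toBidualCx_naturality f, F.toBidual_dual_θ,
    Category.comp_id]

lemma Fam.add_adj (k l : Fam E.cx F.cx) : (k + l).adj = k.adj + l.adj := by
  funext i j
  simp only [Fam.adj, Fam.pre, Fam.post, Fam.dual, Pi.add_apply]
  rw [dualModMap_add]
  exact (congrArg _ (Preadditive.add_comp _ _ _ _ _ _)).trans (Preadditive.comp_add _ _ _ _ _ _)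

lemma Fam.smul_adj (r : R) (k : Fam E.cx F.cx) : (r • k).adj = r • k.adj := by
  funext i j
  simp only [Fam.adj, Fam.pre, Fam.post, Fam.dual, Pi.smul_apply]
  rw [dualModMap_smul]
  exact (congrArg _ (Linear.smul_comp _ _ _ _ _ _)).trans (Linear.comp_smul _ _ _ _ _ _)

/-- The adjoint of the lower half of a null-homotopic map is the upper half of its adjoint. -/
lemma adj_nul_low (k : Fam E.cx F.cx) :
    adj (nul (k.low 0)) = nul k.adj - nul (k.adj.low 0) := by
  rw [adj_nul, ← nul_sub]
  refine nul_congr fun i j h => ?_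
  simp only [Fam.adj, Fam.pre, Fam.post, Fam.dual, Fam.low, Pi.sub_apply]
  -- The transposed entry starts in degree `-j = 1 - i`, so it survives the truncation exactly when
  -- `i ≥ 1`. This is why the cut at 0 exchanges the two halves.
  by_cases hi : i ≤ 0
  · rw [if_neg (by omega), if_pos hi, dualModMap_zero, sub_self]
    exact (congrArg _ zero_comp).trans comp_zero
  · rw [if_pos (by omega), if_neg hi, sub_zero]

lemma adj_f_eq_zero {f : E.cx ⟶ F.cx} {i : ℤ} (h : f.f (-i) = 0) : (adj f).f i = 0 := by
  rw [adj, HomologicalComplex.comp_f, HomologicalComplex.comp_f, dualCxMap_f, h, dualModMap_zero]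
  exact (congrArg _ zero_comp).trans comp_zero

/-- A map that compares the identifications with `𝔼` is an isometry in `D(R)`. -/
lemma Q_map_adj (φ : F.cx ⟶ E.cx) (h : (Q R).map φ ≫ E.α.hom = F.α.hom) :
    (Q R).map (φ ≫ adj φ) = 𝟙 _ := by
  have h₁ : 𝔼.dualHomTo (P := F.toVBComplex) F.α.hom =
      𝔼.dualHomTo (P := E.toVBComplex) E.α.hom ≫ (Q R).map (dualCxMap φ) := by
    rw [PerfectComplex.dualHomTo, PerfectComplex.dualHomTo, ← h, Category.assoc,
      derivedDual_comp (P := F.toVBComplex) (P' := E.toVBComplex) (P'' := 𝔼.rep)]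
    exact congrArg _ (derivedDual_map (P := F.toVBComplex) (P' := E.toVBComplex) φ)
  have h₂ : (Q R).map (φ ≫ E.θ.hom ≫ dualCxMap φ) = (Q R).map F.θ.hom := by
    rw [← F.compat, h₁, ← h, Functor.map_comp, Functor.map_comp, ← E.compat]
    simp only [Category.assoc]
  have h₃ : φ ≫ adj φ = (φ ≫ E.θ.hom ≫ dualCxMap φ) ≫ F.θ.inv := by simp [adj]
  rw [h₃, Functor.map_comp, h₂, ← Functor.map_comp, Iso.hom_inv_id, CategoryTheory.Functor.map_id]

end Adj

end QuadCx
end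

noncomputable section
open CategoryTheory Limits
namespace QuadCx
variable {R : Type u} [CommRing R]

/-! ### Homotopy theory of bounded complexes of vector bundles -/

section

variable {K L : VBComplex R}

lemma VBComplex.exists_homotopyInverse (φ : K.cx ⟶ L.cx) [IsIso ((Q R).map φ)] :
    ∃ (ψ : L.cx ⟶ K.cx) (k : Fam K.cx K.cx) (l : Fam L.cx L.cx),
      𝟙 _ - φ ≫ ψ = nul k ∧ 𝟙 _ - ψ ≫ φ = nul l := by
  obtain ⟨ψ, hψ⟩ := L.exists_chainMap (inv ((Q R).map φ))
  obtain ⟨k, hk⟩ := K.exists_nul (f := 𝟙 _) (g := φ ≫ ψ) (by simp [hψ])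
  obtain ⟨l, hl⟩ := L.exists_nul (f := 𝟙 _) (g := ψ ≫ φ) (by simp [hψ])
  exact ⟨ψ, k, l, hk, hl⟩

lemma apply_eq_of_nul {C D : CochainComplex (ModuleCat.{u} R) ℤ} {f g : C ⟶ D} {k : Fam C D}
    (h : f - g = nul k) {a i b : ℤ} (ha : a + 1 = i) (hb : i + 1 = b) (x : C.X i) :
    f.f i x = g.f i x + (k b i (C.d i b x) + D.d a i (k i a x)) := by
  have := congr($(h).f i)
  rw [nul_f_eq k ha hb, HomologicalComplex.sub_f_apply, sub_eq_iff_eq_add'] at this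
  exact congr($this x)

lemma d_d_apply (C : CochainComplex (ModuleCat.{u} R) ℤ) (i j k : ℤ) (x : C.X i) :
    C.d j k (C.d i j x) = 0 := congr($(C.d_comp_d i j k) x)

lemma comm_apply {C D : CochainComplex (ModuleCat.{u} R) ℤ} (f : C ⟶ D) (i j : ℤ) (x : C.X i) :
    f.f j (C.d i j x) = D.d i j (f.f i x) := (congr($(f.comm i j) x)).symm

/-- Surjectivity on cohomology in terms of elements, read off from a homotopy inverse. The next
lemma is the injectivity. -/
lemma VBComplex.exists_of_cocycle (φ : K.cx ⟶ L.cx) [IsIso ((Q R).map φ)] {a i b : ℤ}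
    (ha : a + 1 = i) (hb : i + 1 = b) (y : L.cx.X i) (hy : L.cx.d i b y = 0) :
    ∃ (x : K.cx.X i) (z : L.cx.X a), K.cx.d i b x = 0 ∧ y = φ.f i x + L.cx.d a i z := by
  obtain ⟨ψ, k, l, -, hl⟩ := VBComplex.exists_homotopyInverse φ
  refine ⟨ψ.f i y, l i a y, by rw [← comm_apply, hy, map_zero], ?_⟩
  have := apply_eq_of_nul hl ha hb y
  rw [hy, map_zero, zero_add] at this
  exact this

lemma VBComplex.exists_of_map_coboundary (φ : K.cx ⟶ L.cx) [IsIso ((Q R).map φ)] {a i b : ℤ}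
    (ha : a + 1 = i) (hb : i + 1 = b) (x : K.cx.X i) (hx : K.cx.d i b x = 0) (z : L.cx.X a)
    (hz : φ.f i x = L.cx.d a i z) : ∃ w : K.cx.X a, x = K.cx.d a i w := by
  obtain ⟨ψ, k, l, hk, -⟩ := VBComplex.exists_homotopyInverse φ
  refine ⟨ψ.f a z + k i a x, ?_⟩
  have := apply_eq_of_nul hk ha hb x
  rw [hx, map_zero, zero_add] at this
  rw [map_add, ← comm_apply, ← hz]
  exact this

lemma isIso_of_bijective {M N : ModuleCat.{u} R} (f : M ⟶ N) (h : Function.Bijective f) :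
    IsIso f := by
  rw [ConcreteCategory.isIso_iff_bijective]
  exact h

lemma bijective_of_isIso {M N : ModuleCat.{u} R} (f : M ⟶ N) [h : IsIso f] :
    Function.Bijective f := by
  rwa [ConcreteCategory.isIso_iff_bijective] at h

/-- A quasi-isomorphism that is an isomorphism in all degrees but one is an isomorphism. -/
lemma VBComplex.isIso_f_of_ne (φ : K.cx ⟶ L.cx) [IsIso ((Q R).map φ)] (n : ℤ)
    (h : ∀ i, i ≠ n → IsIso (φ.f i)) : IsIso (φ.f n) := by
  -- The chase for injectivity uses degrees `n - 2`, `n - 1` and `n + 1`; the one for surjectivity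
  -- uses `n - 1`, `n + 1` and `n + 2`.
  have := h (n - 2) (by omega)
  have := h (n - 1) (by omega)
  have := h (n + 1) (by omega)
  have := h (n + 2) (by omega)
  refine isIso_of_bijective _ ⟨(injective_iff_map_eq_zero _).2 fun x hx => ?_, fun y => ?_⟩
  · have hdx : K.cx.d n (n + 1) x = 0 := (bijective_of_isIso (φ.f (n + 1))).1 (by
      rw [comm_apply, hx, map_zero, map_zero])
    obtain ⟨w, rfl⟩ := VBComplex.exists_of_map_coboundary φ (sub_add_cancel n 1) rfl x hdx 0
      (by rw [hx, map_zero])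
    obtain ⟨a, z, ha, hz⟩ := VBComplex.exists_of_cocycle φ (a := n - 2) (by omega)
      (sub_add_cancel n 1) (φ.f (n - 1) w) (by rw [← comm_apply, hx])
    obtain ⟨z, rfl⟩ := (bijective_of_isIso (φ.f (n - 2))).2 z
    rw [← comm_apply, ← map_add] at hz
    rw [(bijective_of_isIso (φ.f (n - 1))).1 hz, map_add, ha, d_d_apply, add_zero]
  · obtain ⟨x₁, hx₁⟩ := (bijective_of_isIso (φ.f (n + 1))).2 (L.cx.d n (n + 1) y)
    have hdx : K.cx.d (n + 1) (n + 2) x₁ = 0 := (bijective_of_isIso (φ.f (n + 2))).1 (by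
      rw [comm_apply, hx₁, d_d_apply, map_zero])
    obtain ⟨x, rfl⟩ := VBComplex.exists_of_map_coboundary φ rfl (by omega) x₁ hdx y hx₁
    obtain ⟨a, z, ha, hz⟩ := VBComplex.exists_of_cocycle φ (sub_add_cancel n 1) rfl
      (y - φ.f n x) (by rw [map_sub, ← comm_apply, hx₁, sub_self])
    obtain ⟨z, rfl⟩ := (bijective_of_isIso (φ.f (n - 1))).2 z
    refine ⟨x + a + K.cx.d (n - 1) n z, ?_⟩
    rw [map_add, map_add, comm_apply, add_assoc, ← hz, add_sub_cancel]

lemma VBComplex.isIso_of_isIso_f_of_ne (φ : K.cx ⟶ L.cx) (hφ : IsIso ((Q R).map φ)) (n : ℤ)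
    (h : ∀ i, i ≠ n → IsIso (φ.f i)) : IsIso φ := by
  have (i : ℤ) : IsIso (φ.f i) := by
    by_cases hi : i = n
    · exact hi ▸ VBComplex.isIso_f_of_ne φ n h
    · exact h i hi
  exact HomologicalComplex.Hom.isIso_of_components φ

/-- A degreewise surjective quasi-isomorphism has a section. -/
lemma VBComplex.exists_section (φ : K.cx ⟶ L.cx) [IsIso ((Q R).map φ)]
    (h : ∀ i, Function.Surjective (φ.f i)) : ∃ σ : L.cx ⟶ K.cx, σ ≫ φ = 𝟙 _ := by
  obtain ⟨ψ, k, l, -, hl⟩ := VBComplex.exists_homotopyInverse φ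
  -- The homotopy `l` lifts termwise through the surjection. Adding `nul m` to the homotopy inverse
  -- `ψ` then removes the defect `nul l` exactly.
  have key : ∀ i j, ∃ m : L.cx.X i ⟶ K.cx.X j, m ≫ φ.f j = l i j := fun i j => by
    have := L.projective i
    obtain ⟨m, hm⟩ := Module.projective_lifting_property (φ.f j).hom (l i j).hom (h j)
    exact ⟨ModuleCat.ofHom m, ModuleCat.hom_ext hm⟩
  choose m hm using key
  have hm' : Fam.post m φ = l := by
    funext i j
    exact hm i j
  refine ⟨ψ + nul m, ?_⟩
  rw [Preadditive.add_comp, ← nul_post, hm', ← hl, add_sub_cancel]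

/-- Idempotents split in bounded complexes of vector bundles. -/
lemma VBComplex.exists_splitting (K : VBComplex R) (q : K.cx ⟶ K.cx) (hq : q ≫ q = q) :
    ∃ (A : VBComplex R) (ι : A.cx ⟶ K.cx) (r : K.cx ⟶ A.cx), ι ≫ r = 𝟙 _ ∧ r ≫ ι = q := by
  obtain ⟨A, ι, r, h₁, h₂⟩ := IsIdempotentComplete.idempotents_split K.cx q hq
  have h₁' (i : ℤ) : ι.f i ≫ r.f i = 𝟙 _ := congr($(h₁).f i)
  refine ⟨⟨A, ?_, fun i => ?_, fun i => ?_⟩, ι, r, h₁, h₂⟩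
  · obtain ⟨a, b, h⟩ := K.bounded
    refine ⟨a, b, fun i hi => ?_⟩
    rw [IsZero.iff_id_eq_zero, ← h₁' i, (h i hi).eq_of_tgt (ι.f i) 0, zero_comp]
  · have := K.finite i
    exact Module.Finite.of_surjective (r.f i).hom fun x => ⟨ι.f i x, congr($(h₁' i) x)⟩
  · have := K.projective i
    exact Module.Projective.of_split (ι.f i).hom (r.f i).hom
      (congrArg ModuleCat.Hom.hom (h₁' i))

end

/-! ### Truncated contractions -/

section

variable {C D : CochainComplex (ModuleCat.{u} R) ℤ}

/-- Below degree `n` the truncated contractions agree with the idempotents, which `Ω` intertwines.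
In degree `n` the first factor ends in a differential, which moves the claim to degree `n - 1`;
above `n` both sides vanish. Thus `Ω` carries the lower Lagrangian of one complex into that of the
other, and `Ω = 𝟙` gives idempotence. -/
lemma nul_low_intertwine (n : ℤ) (h : Fam C C) (h' : Fam D D) (Ω : C ⟶ D)
    (hh : h.post (nul h) = h) (hΩ : nul h ≫ Ω = Ω ≫ nul h') :
    nul (h.low n) ≫ Ω ≫ nul (h'.low n) = nul (h.low n) ≫ Ω := by
  have hε : nul h ≫ nul h = nul h := by rw [← nul_post, hh]
  have hΩ' (i : ℤ) := congr($(hΩ).f i)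
  ext1 i
  simp only [HomologicalComplex.comp_f]
  rcases lt_trichotomy i n with hi | rfl | hi
  · rw [nul_low_lt h hi, nul_low_lt h' hi]
    simp only [← HomologicalComplex.comp_f]
    rw [← hΩ, reassoc_of% hε]
  · rw [nul_low_self (sub_add_cancel i 1)]
    have h₁ : h i (i - 1) ≫ (nul h).f (i - 1) = h i (i - 1) := congr($hh i (i - 1))
    have h₂ := hΩ' (i - 1)
    simp only [HomologicalComplex.comp_f] at h₂
    rw [Category.assoc, ← HomologicalComplex.Hom.comm_assoc, ← HomologicalComplex.Hom.comm,
      nul_low_lt h' (sub_one_lt i), ← reassoc_of% h₂, reassoc_of% h₁, Category.assoc,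
      HomologicalComplex.Hom.comm]
  · rw [nul_low_gt h hi, zero_comp, zero_comp]

lemma nul_low_idem (n : ℤ) (h : Fam C C) (hh : h.post (nul h) = h) :
    nul (h.low n) ≫ nul (h.low n) = nul (h.low n) := by
  simpa using nul_low_intertwine n h h (𝟙 C) hh (by simp)

lemma Fam.low_post (n : ℤ) (h : Fam C C) (f : C ⟶ D) : (h.low n).post f = (h.post f).low n := by
  funext i j
  simp only [Fam.low, Fam.post]
  split_ifs <;> simp

lemma Fam.low_pre (n : ℤ) (f : D ⟶ C) (h : Fam C C) : (h.low n).pre f = (h.pre f).low n := by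
  funext i j
  simp only [Fam.low, Fam.pre]
  split_ifs <;> simp

/-- A contraction of the image of an idempotent may be chosen to live on that image. -/
lemma exists_normalized {ε : C ⟶ C} (hε : ε ≫ ε = ε) (h : Fam C C) (hh : ε = nul h) :
    ∃ h' : Fam C C, nul h' = ε ∧ h'.post ε = h' ∧ h'.pre ε = h' := by
  refine ⟨(h.pre ε).post ε, ?_, ?_, ?_⟩
  · rw [nul_post, nul_pre, ← hh, hε, hε]
  · rw [Fam.post_post, hε]
  · rw [← Fam.post_pre, Fam.pre_pre, hε]

end

end QuadCx
end

noncomputable section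
open CategoryTheory Limits
namespace QuadCx
variable {R : Type u} [CommRing R]

/-! ### Cones of identities -/

lemma finite_projective_biprod (M N : ModuleCat.{u} R) [Module.Finite R M] [Module.Finite R N]
    [Module.Projective R M] [Module.Projective R N] :
    Module.Finite R (M ⊞ N : ModuleCat.{u} R) ∧ Module.Projective R (M ⊞ N : ModuleCat.{u} R) := by
  have e := (ModuleCat.biprodIsoProd M N).toLinearEquiv.symm
  exact ⟨Module.Finite.equiv (M := M × N) e, Module.Projective.of_equiv (M := M × N) e⟩

lemma isZero_biprod {M N : ModuleCat.{u} R} (hM : IsZero M) (hN : IsZero N) : IsZero (M ⊞ N) := by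
  rw [IsZero.iff_id_eq_zero]
  exact biprod.hom_ext _ _ (hM.eq_of_tgt _ _) (hN.eq_of_tgt _ _)

namespace VBComplex

variable (K : VBComplex R)

/-- The cone of the identity of a complex, with `K^i ⊕ K^{i+1}` in degree `i`. -/
def cone : VBComplex R where
  -- In these coordinates the differential does not involve that of `K`, which enters only through
  -- `toCone`.
  cx := CochainComplex.of (fun i => K.cx.X i ⊞ K.cx.X (i + 1)) (fun _ => biprod.snd ≫ biprod.inl)
    (fun _ => by simp)
  bounded := by
    obtain ⟨a, b, h⟩ := K.bounded
    exact ⟨a - 1, b, fun i hi => isZero_biprod (h i (by omega)) (h (i + 1) (by omega))⟩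
  finite i := by
    have := K.finite i
    have := K.finite (i + 1)
    have := K.projective i
    have := K.projective (i + 1)
    exact (finite_projective_biprod (K.cx.X i) (K.cx.X (i + 1))).1
  projective i := by
    have := K.finite i
    have := K.finite (i + 1)
    have := K.projective i
    have := K.projective (i + 1)
    exact (finite_projective_biprod (K.cx.X i) (K.cx.X (i + 1))).2

/-- The inclusion of the first summand. -/
def coneInl (i : ℤ) : K.cx.X i ⟶ K.cone.cx.X i :=
  (biprod.inl : K.cx.X i ⟶ K.cx.X i ⊞ K.cx.X (i + 1))

/-- The inclusion of the second summand. -/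
def coneInr (i : ℤ) : K.cx.X (i + 1) ⟶ K.cone.cx.X i :=
  (biprod.inr : K.cx.X (i + 1) ⟶ K.cx.X i ⊞ K.cx.X (i + 1))

/-- The first projection. -/
def coneFst (i : ℤ) : K.cone.cx.X i ⟶ K.cx.X i :=
  (biprod.fst : K.cx.X i ⊞ K.cx.X (i + 1) ⟶ K.cx.X i)

/-- The second projection. -/
def coneSnd (i : ℤ) : K.cone.cx.X i ⟶ K.cx.X (i + 1) :=
  (biprod.snd : K.cx.X i ⊞ K.cx.X (i + 1) ⟶ K.cx.X (i + 1))

@[simp]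
lemma coneInl_fst (i : ℤ) : K.coneInl i ≫ K.coneFst i = 𝟙 _ := biprod.inl_fst

@[simp]
lemma coneInl_snd (i : ℤ) : K.coneInl i ≫ K.coneSnd i = 0 := biprod.inl_snd

@[simp]
lemma coneInr_fst (i : ℤ) : K.coneInr i ≫ K.coneFst i = 0 := biprod.inr_fst

@[simp]
lemma coneInr_snd (i : ℤ) : K.coneInr i ≫ K.coneSnd i = 𝟙 _ := biprod.inr_snd

@[simp]
lemma coneInl_fst_assoc (i : ℤ) {Z : ModuleCat.{u} R} (f : K.cx.X (i) ⟶ Z) :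
    K.coneInl i ≫ K.coneFst i ≫ f = f := by
  rw [reassoc_of% K.coneInl_fst]

@[simp]
lemma coneInl_snd_assoc (i : ℤ) {Z : ModuleCat.{u} R} (f : K.cx.X (i + 1) ⟶ Z) :
    K.coneInl i ≫ K.coneSnd i ≫ f = 0 := by
  rw [reassoc_of% K.coneInl_snd, zero_comp]

@[simp]
lemma coneInr_fst_assoc (i : ℤ) {Z : ModuleCat.{u} R} (f : K.cx.X (i) ⟶ Z) :
    K.coneInr i ≫ K.coneFst i ≫ f = 0 := by
  rw [reassoc_of% K.coneInr_fst, zero_comp]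

@[simp]
lemma coneInr_snd_assoc (i : ℤ) {Z : ModuleCat.{u} R} (f : K.cx.X (i + 1) ⟶ Z) :
    K.coneInr i ≫ K.coneSnd i ≫ f = f := by
  rw [reassoc_of% K.coneInr_snd]

lemma cone_total (i : ℤ) :
    K.coneFst i ≫ K.coneInl i + K.coneSnd i ≫ K.coneInr i = 𝟙 _ := biprod.total

@[simp]
lemma cone_d (i : ℤ) : K.cone.cx.d i (i + 1) = K.coneSnd i ≫ K.coneInl (i + 1) :=
  (CochainComplex.of_d (fun i => K.cx.X i ⊞ K.cx.X (i + 1)) (fun _ => biprod.snd ≫ biprod.inl) i :)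

/-- The inclusion of a complex into the cone of its identity. -/
def toCone : K.cx ⟶ K.cone.cx where
  f i := K.coneInl i + K.cx.d i (i + 1) ≫ K.coneInr i
  comm' i j h := by
    obtain rfl : i + 1 = j := h
    simp

/-- The map out of the cone of the identity that is given by a family. -/
def fromCone {D : CochainComplex (ModuleCat.{u} R) ℤ} (k : Fam K.cx D) : K.cone.cx ⟶ D where
  f i := K.coneFst i ≫ k i (i - 1) ≫ D.d (i - 1) i + K.coneSnd i ≫ k (i + 1) i
  comm' i j h := by
    obtain rfl : i + 1 = j := h
    simp only [cone_d, Preadditive.add_comp, Preadditive.comp_add, Category.assoc,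
      HomologicalComplex.d_comp_d, comp_zero, zero_add, coneInl_fst_assoc, coneInl_snd_assoc,
      add_zero]
    rw [Int.add_sub_cancel i 1]

/-- The purpose of the cone: every null-homotopic map factors through an acyclic complex of vector
bundles, so it can be realized by maps to and from a hyperbolic summand. -/
lemma toCone_fromCone {D : CochainComplex (ModuleCat.{u} R) ℤ} (k : Fam K.cx D) :
    K.toCone ≫ K.fromCone k = nul k := by
  ext1 i
  simp [toCone, fromCone, add_comm]

/-- Dually, the transpose of `toCone` is surjective in every degree, which supplies the acyclic
covers used later. -/
lemma toCone_f_split (i : ℤ) : ∃ r : K.cone.cx.X i ⟶ K.cx.X i, K.toCone.f i ≫ r = 𝟙 _ :=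
  ⟨K.coneFst i, by simp [toCone]⟩

lemma Q_map_id_cone : (Q R).map (𝟙 K.cone.cx) = 0 := by
  let k : Fam K.cone.cx K.cone.cx := fun i j => if h : i = j + 1 then
    K.coneFst i ≫ (K.cx.XIsoOfEq h).hom ≫ K.coneInr j else 0
  have h₁ (i : ℤ) : k (i + 1) i = K.coneFst (i + 1) ≫ K.coneInr i := by
    simp [k, HomologicalComplex.XIsoOfEq]
  have h₂ : nul k = 𝟙 K.cone.cx := by
    ext1 i
    obtain ⟨i, rfl⟩ : ∃ j, i = j + 1 := ⟨i - 1, by omega⟩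
    rw [nul_f_eq k rfl rfl, cone_d, cone_d, h₁, h₁]
    simpa [add_comm] using K.cone_total (i + 1)
  rw [← h₂, Q_map_nul]

lemma fromCone_low_gt {D : CochainComplex (ModuleCat.{u} R) ℤ} (k : Fam K.cx D) {i : ℤ}
    (h : 0 < i) : (K.fromCone (k.low 0)).f i = 0 := by
  simp [fromCone, Fam.low, h.not_ge, h.not_gt]

lemma fromCone_low_zero {D : CochainComplex (ModuleCat.{u} R) ℤ} (k : Fam K.cx D) :
    ∃ c : K.cone.cx.X 0 ⟶ D.X (-1), (K.fromCone (k.low 0)).f 0 = c ≫ D.d (-1) 0 :=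
  ⟨K.coneFst 0 ≫ k 0 (-1), by simp [fromCone, Fam.low]⟩

end VBComplex

end QuadCx
end

noncomputable section
open CategoryTheory Limits
namespace QuadCx
variable {R : Type u} [CommRing R]

/-! ### Isometries and the reductions they define -/

section

variable {𝔼 : QuadraticComplex R} {E F G : SelfDualRep 𝔼}

lemma Fam.adj_pre (f : E.cx ⟶ F.cx) (k : Fam F.cx G.cx) : (k.pre f).adj = k.adj.post (QuadCx.adj f) := by
  simp only [Fam.adj, QuadCx.adj, Fam.dual_pre, Fam.post_post, Fam.post_pre,
    Iso.inv_hom_id_assoc]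

lemma Fam.adj_post (k : Fam E.cx F.cx) (f : F.cx ⟶ G.cx) :
    (k.post f).adj = k.adj.pre (QuadCx.adj f) := by
  rw [← Fam.adj_adj (k.adj.pre _), Fam.adj_pre, Fam.adj_adj, QuadCx.adj_adj]

/-- An isometric chain map that is compatible with the identifications with `𝔼`. -/
@[ext]
structure IsometricMap (F E : SelfDualRep 𝔼) where
  hom : F.cx ⟶ E.cx
  isom : hom ≫ adj hom = 𝟙 _
  compat : (Q R).map hom ≫ E.α.hom = F.α.hom

namespace IsometricMap

/-- The identity isometry. -/
@[simps]
def refl (E : SelfDualRep 𝔼) : IsometricMap E E where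
  hom := 𝟙 _
  isom := by rw [adj_id, Category.comp_id]
  compat := by rw [CategoryTheory.Functor.map_id, Category.id_comp]

/-- The composition of isometries. -/
@[simps]
def comp (s : IsometricMap G F) (t : IsometricMap F E) : IsometricMap G E where
  hom := s.hom ≫ t.hom
  isom := by rw [adj_comp, Category.assoc, reassoc_of% t.isom, s.isom]
  compat := by rw [Functor.map_comp, Category.assoc, t.compat, s.compat]

variable (s : IsometricMap F E)

instance : IsIso ((Q R).map s.hom) := by
  have : (Q R).map s.hom = F.α.hom ≫ E.α.inv := by rw [← s.compat, Category.assoc, Iso.hom_inv_id,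
    Category.comp_id]
  rw [this]
  infer_instance

/-- An isometry is an isomorphism in `D(R)`, so its orthogonal complement is acyclic. -/
lemma Q_map_proj : (Q R).map (adj s.hom ≫ s.hom) = 𝟙 _ := by
  rw [← cancel_epi ((Q R).map s.hom), ← Functor.map_comp, reassoc_of% s.isom, Category.comp_id]

end IsometricMap

namespace Reduction

/-- A reduction is split by `s` if `s` lifts to a section of the left leg. -/
def IsSplitBy (ξ : Reduction F E) (s : F.cx ⟶ E.cx) : Prop :=
  ∃ σ : F.cx ⟶ ξ.A.cx, σ ≫ ξ.f = 𝟙 _ ∧ σ ≫ ξ.e = s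

/-- Transposing the isotropy relation along the section shows that the left leg is determined by the
right one and `s`. -/
lemma IsSplitBy.f_eq {ξ : Reduction F E} {s : F.cx ⟶ E.cx} (h : ξ.IsSplitBy s) :
    ξ.f = ξ.e ≫ adj s := by
  obtain ⟨σ, h₁, rfl⟩ := h
  have := congr($(ξ.comm) ≫ dualCxMap σ)
  simp only [Category.assoc, ← dualCxMap_comp, h₁] at this
  rw [dualCxMap_id, Category.comp_id] at this
  rw [adj, ← reassoc_of% this, Iso.hom_inv_id, Category.comp_id]

instance (ξ : Reduction F E) : IsIso ((Q R).map ξ.f) :=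
  (DerivedCategory.isIso_Q_map_iff_quasiIso _ _).2 ξ.quasiIso_f

instance (ξ : Reduction F E) : IsIso ((Q R).map ξ.e) :=
  (DerivedCategory.isIso_Q_map_iff_quasiIso _ _).2 ξ.quasiIso_e

end Reduction

lemma θ_dualCxMap (f : E.cx ⟶ F.cx) : F.θ.hom ≫ dualCxMap f = adj f ≫ E.θ.hom := by
  simp [adj]

variable [Invertible (2 : R)]

lemma half_add {C D : CochainComplex (ModuleCat.{u} R) ℤ} (f : C ⟶ D) :
    (⅟2 : R) • (f + f) = f := by
  rw [← two_smul R f, smul_smul, invOf_mul_self, one_smul]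

/-- A self-adjoint idempotent that vanishes in `D(R)` has a symmetric contraction, whose lower half
is a projection onto a Lagrangian subcomplex. -/
lemma exists_polarization {ε : E.cx ⟶ E.cx} (hε : ε ≫ ε = ε) (hε' : adj ε = ε)
    (h0 : (Q R).map ε = 0) : ∃ h : Fam E.cx E.cx, nul h = ε ∧ h.post ε = h ∧ h.pre ε = h ∧
      adj (nul (h.low 0)) = ε - nul (h.low 0) := by
  obtain ⟨k, hk⟩ := E.exists_nul (f := ε) (g := 0) (by rw [h0, Functor.map_zero])
  rw [sub_zero] at hk
  -- Averaging with the adjoint keeps `nul k = ε`, since `ε` is self-adjoint. Compressing by `ε` on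
  -- both sides then makes the contraction live on the image of `ε`.
  let l : Fam E.cx E.cx := (⅟2 : R) • (k + k.adj)
  have hl : nul l = ε := by
    rw [nul_smul, nul_add, ← adj_nul, ← hk, hε', half_add]
  have hl' : l.adj = l := by
    rw [Fam.smul_adj, Fam.add_adj, Fam.adj_adj, add_comm]
  obtain ⟨h₁, h₂, h₃, h₄⟩ :
      nul ((l.pre ε).post ε) = ε ∧ ((l.pre ε).post ε).post ε = (l.pre ε).post ε ∧
      ((l.pre ε).post ε).pre ε = (l.pre ε).post ε ∧
      ((l.pre ε).post ε).adj = (l.pre ε).post ε := by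
    refine ⟨?_, ?_, ?_, ?_⟩
    · rw [nul_post, nul_pre, hl, hε, hε]
    · rw [Fam.post_post, hε]
    · rw [← Fam.post_pre, Fam.pre_pre, hε]
    · rw [Fam.adj_post, Fam.adj_pre, hl', hε', Fam.post_pre]
  exact ⟨_, h₁, h₂, h₃, by rw [adj_nul_low, h₄, h₁]⟩

namespace IsometricMap

variable (s : IsometricMap F E)

/-- The complement projection of an isometry is a self-adjoint idempotent that vanishes in `D(R)`,
so the preceding construction applies. -/
lemma exists_polarization : ∃ h : Fam E.cx E.cx, nul h = 𝟙 _ - adj s.hom ≫ s.hom ∧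
    h.post (𝟙 _ - adj s.hom ≫ s.hom) = h ∧ h.pre (𝟙 _ - adj s.hom ≫ s.hom) = h ∧
    adj (nul (h.low 0)) = 𝟙 _ - adj s.hom ≫ s.hom - nul (h.low 0) := by
  refine QuadCx.exists_polarization ?_ ?_ ?_
  · simp [reassoc_of% s.isom]
  · rw [adj_sub, adj_id, adj_comp, adj_adj]
  · rw [Functor.map_sub, s.Q_map_proj, CategoryTheory.Functor.map_id, sub_self]

/-- Every isometry splits a reduction, and that reduction is unique. -/
lemma exists_reduction : ∃ ξ : Reduction F E, ξ.IsSplitBy s.hom ∧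
    ∀ ζ : Reduction F E, ζ.IsSplitBy s.hom → ζ ≈ ξ := by
  obtain ⟨h, h₁, h₂, h₃, h₄⟩ := s.exists_polarization
  set ε := 𝟙 E.cx - adj s.hom ≫ s.hom with hε
  set π := nul (h.low 0) with hπ
  have sε : s.hom ≫ ε = 0 := by simp [hε, reassoc_of% s.isom]
  have εs : ε ≫ adj s.hom = 0 := by simp [hε, s.isom]
  have hεε : ε ≫ ε = ε := by
    conv_lhs => rw [hε]
    rw [Preadditive.sub_comp, Category.assoc, sε, comp_zero, sub_zero, Category.id_comp]
  have ππ : π ≫ π = π := nul_low_idem 0 h (by rw [h₁, h₂])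
  have πε : π ≫ ε = π := by rw [hπ, ← nul_post, Fam.low_post, h₂]
  have επ : ε ≫ π = π := by rw [hπ, ← nul_pre, Fam.low_pre, h₃]
  have sπ : s.hom ≫ π = 0 := by rw [← επ, reassoc_of% sε, zero_comp]
  have πs : π ≫ adj s.hom = 0 := by rw [← πε, Category.assoc, εs, comp_zero]
  -- The projection onto `F ⊕ L`, where `L` is the image of `π`. Its image is the middle complex.
  have hq : (adj s.hom ≫ s.hom + π) ≫ (adj s.hom ≫ s.hom + π) = adj s.hom ≫ s.hom + π := by
    simp [reassoc_of% s.isom, sπ, reassoc_of% πs, ππ]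
  obtain ⟨A, ι, r, hι, hr⟩ := E.exists_splitting _ hq
  have Qr : (Q R).map (r ≫ ι) = 𝟙 _ := by
    rw [hr, Functor.map_add, s.Q_map_proj, Q_map_nul, add_zero]
  have hQι : IsIso ((Q R).map ι) := ⟨(Q R).map r, by rw [← Functor.map_comp, hι,
    CategoryTheory.Functor.map_id], by rw [← Functor.map_comp, Qr]⟩
  have hQs : IsIso ((Q R).map (adj s.hom)) := ⟨(Q R).map s.hom, by rw [← Functor.map_comp,
    s.Q_map_proj], by rw [← Functor.map_comp, s.isom, CategoryTheory.Functor.map_id]⟩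
  have hQf : IsIso ((Q R).map (ι ≫ adj s.hom)) := by rw [Functor.map_comp]; infer_instance
  have hsr : (s.hom ≫ r) ≫ ι ≫ adj s.hom = 𝟙 _ := by
    rw [Category.assoc, reassoc_of% hr, Preadditive.add_comp, Preadditive.comp_add, πs, comp_zero]
    simp [s.isom]
  have hrι (i : ℤ) : r.f i ≫ ι.f i = (adj s.hom ≫ s.hom).f i + π.f i := congr($(hr).f i)
  have hιr (i : ℤ) : ι.f i ≫ r.f i = 𝟙 _ := congr($(hι).f i)
  have hsf (i : ℤ) : s.hom.f i ≫ (adj s.hom).f i = 𝟙 _ := congr($(s.isom).f i)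
  have hιq : ι ≫ (adj s.hom ≫ s.hom + π) = ι := by rw [← hr, reassoc_of% hι]
  let ξ : Reduction F E :=
    { A := A
      f := ι ≫ adj s.hom
      e := ι
      quasiIso_f := (DerivedCategory.isIso_Q_map_iff_quasiIso _ _).1 hQf
      quasiIso_e := (DerivedCategory.isIso_Q_map_iff_quasiIso _ _).1 hQι
      compat := by
        rw [← s.compat, ← Functor.map_comp_assoc, Category.assoc, Functor.map_comp, s.Q_map_proj,
          Category.comp_id]
      -- Above degree 0 the Lagrangian vanishes and the middle complex is `F`. Below degree 0 it is
      -- the whole complement and the middle complex is `E`.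
      isIso_f := fun i hi => by
        refine ⟨(s.hom ≫ r).f i, ?_, congr($(hsr).f i)⟩
        have h' := hrι i
        rw [hπ, nul_low_gt h (by omega), add_zero, HomologicalComplex.comp_f] at h'
        rw [HomologicalComplex.comp_f, HomologicalComplex.comp_f, Category.assoc,
          ← reassoc_of% h', reassoc_of% hιr, hιr]
      isIso_e := fun i hi => by
        refine ⟨r.f i, hιr i, ?_⟩
        rw [hrι, hπ, nul_low_lt h (by omega), h₁, ← HomologicalComplex.add_f_apply, hε,
          add_sub_cancel]
        rfl
      incl := fun φ => ⟨φ ∘ₗ (r.f 1).hom ∘ₗ LinearMap.fst R _ _, LinearMap.ext fun x =>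
        congrArg φ congr($(hιr 1) x)⟩
      comm := by
        -- The complementary part of the form vanishes on the middle complex: the adjoint of the
        -- projection has complementary part `ε - π`, and `π ≫ (ε - π) = 0`.
        have h' : ι ≫ ε ≫ E.θ.hom ≫ dualCxMap ι = 0 := by
          have hq' : adj (adj s.hom ≫ s.hom + π) = adj s.hom ≫ s.hom + (ε - π) := by
            rw [adj_add, adj_comp, adj_adj, h₄]
          rw [← hιq, dualCxMap_comp, reassoc_of% θ_dualCxMap, hq']
          simp only [Preadditive.add_comp, Preadditive.comp_add, Preadditive.sub_comp,
            Preadditive.comp_sub, Category.assoc, reassoc_of% sε, reassoc_of% πs, reassoc_of% ππ,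
            reassoc_of% πε, zero_comp, comp_zero, add_zero, sub_self]
        rw [hε, Preadditive.sub_comp, Preadditive.comp_sub, Category.id_comp, sub_eq_zero] at h'
        rw [h', dualCxMap_comp, Category.assoc, reassoc_of% θ_dualCxMap, adj_adj, Category.assoc] }
  refine ⟨ξ, ⟨s.hom ≫ r, hsr, ?_⟩, fun ζ hζ => ?_⟩
  · rw [Category.assoc]
    refine (congrArg _ hr).trans ?_
    rw [Preadditive.comp_add, sπ, reassoc_of% s.isom, add_zero]
  · have hζ' := hζ
    obtain ⟨σ, hσ₁, hσ₂⟩ := hζ'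
    have hf := hζ.f_eq
    -- The projection onto the kernel of the left leg. Uniqueness amounts to showing that the right
    -- leg carries this kernel into `L`.
    set κ := 𝟙 ζ.A.cx - ζ.f ≫ σ with hκ
    have hκe : ζ.e ≫ ε = κ ≫ ζ.e := by
      rw [hε, hκ, Preadditive.comp_sub, Preadditive.sub_comp, Category.comp_id, Category.id_comp,
        Category.assoc, hσ₂, ← Category.assoc, ← hf]
    have hκf : κ ≫ ζ.f = 0 := by simp [hκ, hσ₁]
    have hκ0 (i : ℤ) (hi : 1 ≤ i) : κ.f i = 0 := by
      have := ζ.isIso_f i hi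
      rw [← cancel_mono (ζ.f.f i), ← HomologicalComplex.comp_f, hκf]
      simp
    have heq : ζ.e ≫ π = κ ≫ ζ.e := by
      ext1 i
      rcases lt_trichotomy i 0 with hi | rfl | hi
      · rw [HomologicalComplex.comp_f, hπ, nul_low_lt h hi, h₁, ← HomologicalComplex.comp_f, hκe]
      -- In degree 0 the values of `κ ≫ ζ.e` are cocycles, because `κ` vanishes in degree 1. On
      -- cocycles `ε = nul h` reduces to `h d`, which is `π`.
      · have hsh : s.hom.f 0 ≫ h 0 (-1) = 0 := by
          rw [← h₃, Fam.pre, ← HomologicalComplex.comp_f_assoc, sε]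
          simp
        have h₅ : (κ ≫ ζ.e).f 0 ≫ ε.f 0 = (κ ≫ ζ.e).f 0 := by
          rw [← HomologicalComplex.comp_f, ← hκe, Category.assoc, hεε]
        have h₆ : (κ ≫ ζ.e).f 0 ≫ E.cx.d 0 1 = 0 := by
          rw [HomologicalComplex.Hom.comm, HomologicalComplex.comp_f, hκ0 1 le_rfl]
          simp
        have h₇ : ζ.e.f 0 = (ζ.f ≫ s.hom).f 0 + (κ ≫ ζ.e).f 0 := by
          rw [← HomologicalComplex.add_f_apply, hκ, ← hσ₂]
          simp
        rw [← h₁, nul_f_eq h (a := -1) (b := 1) (by omega) (by omega), Preadditive.comp_add,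
          reassoc_of% h₆, zero_comp, zero_add] at h₅
        rw [HomologicalComplex.comp_f, hπ, nul_low_self (a := -1) (by omega), h₇,
          Preadditive.add_comp, h₅, HomologicalComplex.comp_f, Category.assoc, reassoc_of% hsh,
          zero_comp, comp_zero, zero_add]
      · rw [HomologicalComplex.comp_f, HomologicalComplex.comp_f, hκ0 i (by omega), hπ,
          nul_low_gt h hi, comp_zero, zero_comp]
    have heq' : ζ.e ≫ r ≫ ι = ζ.e := by
      have : ζ.e ≫ adj s.hom ≫ s.hom = ζ.f ≫ s.hom := by rw [hf, Category.assoc]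
      rw [hr, Preadditive.comp_add, heq, hκ, Preadditive.sub_comp, Category.id_comp,
        Category.assoc, hσ₂, this, add_sub_cancel]
    have hcomp : (ζ.e ≫ r) ≫ ι ≫ adj s.hom = ζ.f := by
      rw [hf]; simpa using congr($heq' ≫ adj s.hom)
    have hQ : IsIso ((Q R).map (ζ.e ≫ r)) := by
      have : IsIso ((Q R).map (ζ.e ≫ r) ≫ (Q R).map ι) := by
        rw [← Functor.map_comp, Category.assoc, heq']; infer_instance
      exact IsIso.of_isIso_comp_right _ ((Q R).map ι)
    have : IsIso (ζ.e ≫ r) := by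
      refine VBComplex.isIso_of_isIso_f_of_ne (K := ζ.A) (L := A) _ hQ 0 fun i hi => ?_
      rcases lt_or_gt_of_ne hi with hi | hi
      · have h₁ := ξ.isIso_e i (by omega)
        have h₂ := ζ.isIso_e i (by omega)
        have : IsIso ((ζ.e ≫ r).f i ≫ ξ.e.f i) := by
          have : (ζ.e ≫ r).f i ≫ ξ.e.f i = ζ.e.f i := by
            rw [← HomologicalComplex.comp_f, Category.assoc]
            exact congr($(heq').f i)
          rw [this]
          exact h₂
        exact IsIso.of_isIso_comp_right _ (ξ.e.f i)
      · have h₁ := ξ.isIso_f i (by omega)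
        have h₂ := ζ.isIso_f i (by omega)
        have : IsIso ((ζ.e ≫ r).f i ≫ ξ.f.f i) := by
          have : (ζ.e ≫ r).f i ≫ ξ.f.f i = ζ.f.f i := by
            rw [← HomologicalComplex.comp_f]
            exact congr($(hcomp).f i)
          rw [this]
          exact h₂
        exact IsIso.of_isIso_comp_right _ (ξ.f.f i)
    exact ⟨asIso (ζ.e ≫ r), hcomp, heq'⟩

/-- The isotropic reduction defined by an isometry. -/
def red : F ⟶ E := (⟦s.exists_reduction.choose⟧ : IsotropicReduction F E)

lemma eq_red {ξ : Reduction F E} (h : ξ.IsSplitBy s.hom) :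
    (⟦ξ⟧ : IsotropicReduction F E) = s.red :=
  Quotient.sound (s.exists_reduction.choose_spec.2 ξ h)

lemma red_refl (E : SelfDualRep 𝔼) : (refl E).red = 𝟙 E :=
  (eq_red (ξ := Reduction.id E) (refl E) ⟨𝟙 _, Category.comp_id _, Category.comp_id _⟩).symm

/-- Sections lift to the fibre product, so the composite reduction is split by the composite
isometry; uniqueness concludes. -/
lemma red_comp (s : IsometricMap G F) (t : IsometricMap F E) :
    (s.comp t).red = s.red ≫ t.red := by
  obtain ⟨σ, hσ₁, hσ₂⟩ := s.exists_reduction.choose_spec.1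
  obtain ⟨τ, hτ₁, hτ₂⟩ := t.exists_reduction.choose_spec.1
  refine (eq_red (ξ := s.exists_reduction.choose.comp t.exists_reduction.choose) (s.comp t)
    ⟨(Reduction.isPullback_comp _ _).lift σ (s.hom ≫ τ) ?_, ?_, ?_⟩).symm
  · rw [hσ₂, Category.assoc, hτ₁, Category.comp_id]
  · rw [Reduction.comp_f, IsPullback.lift_fst_assoc, hσ₁]
  · rw [Reduction.comp_e, IsPullback.lift_snd_assoc, Category.assoc, hτ₂, comp_hom]

end IsometricMap

end
end QuadCx
end

noncomputable section
open CategoryTheory Limits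
namespace QuadCx
variable {R : Type u} [CommRing R]

/-! ### Stabilization by hyperbolic complexes -/

/-- The direct sum of two complexes. -/
abbrev VBComplex.biprod (K L : VBComplex R) : VBComplex R where
  cx := K.cx ⊞ L.cx
  bounded := by
    obtain ⟨a, b, h⟩ := K.bounded
    obtain ⟨a', b', h'⟩ := L.bounded
    exact ⟨min a a', max b b', fun i hi => (isZero_biprod (h i (by omega)) (h' i (by omega))).of_iso
      (HomologicalComplex.biprodXIso _ _ _)⟩
  finite i := by
    have := K.finite i
    have := L.finite i
    have := K.projective i
    have := L.projective i
    have := (finite_projective_biprod (K.cx.X i) (L.cx.X i)).1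
    exact Module.Finite.equiv (HomologicalComplex.biprodXIso K.cx L.cx i).symm.toLinearEquiv
  projective i := by
    have := K.finite i
    have := L.finite i
    have := K.projective i
    have := L.projective i
    have := (finite_projective_biprod (K.cx.X i) (L.cx.X i)).2
    exact Module.Projective.of_equiv
      (HomologicalComplex.biprodXIso K.cx L.cx i).symm.toLinearEquiv

lemma VBComplex.Q_map_id_dual (X : VBComplex R) (hX : (Q R).map (𝟙 X.cx) = 0) :
    (Q R).map (𝟙 (dualCx X.cx)) = 0 := by
  obtain ⟨k, hk⟩ := X.exists_nul (f := 𝟙 X.cx) (g := 0) (by rw [hX, Functor.map_zero])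
  rw [sub_zero] at hk
  rw [← dualCxMap_id, hk, dualCxMap_nul, Q_map_nul]

lemma Q_map_eq_zero_of_factor {C D X : CochainComplex (ModuleCat.{u} R) ℤ}
    (hX : (Q R).map (𝟙 X) = 0) (f : C ⟶ X) (g : X ⟶ D) : (Q R).map (f ≫ g) = 0 := by
  rw [← Category.id_comp g, Functor.map_comp, Functor.map_comp, hX, zero_comp, comp_zero]

variable {𝔼 : QuadraticComplex R}

/-- The orthogonal sum of a self-dual representative and the hyperbolic complex of an acyclic
complex `X`. -/
structure Stabilization (E : SelfDualRep 𝔼) (X : VBComplex R) where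
  M : SelfDualRep 𝔼
  ι : IsometricMap E M
  i : X.cx ⟶ M.cx
  p : M.cx ⟶ X.cx
  acyclic : (Q R).map (𝟙 X.cx) = 0
  i_p : i ≫ p = 𝟙 _
  ι_p : ι.hom ≫ p = 0
  i_ι : i ≫ adj ι.hom = 0
  i_i : i ≫ M.θ.hom ≫ dualCxMap i = 0
  p_p : dualCxMap p ≫ M.θ.inv ≫ p = 0
  total : adj ι.hom ≫ ι.hom + p ≫ i + adj (p ≫ i) = 𝟙 _

section

variable (E : SelfDualRep 𝔼) (X : VBComplex R)

/-- The model is `E ⊕ X ⊕ X^∨` with the form of `E` plus the hyperbolic form, symmetric by the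
triangle identity of biduality. As `X` and its dual are acyclic, the projection to `E` is an
isomorphism in `D(R)` and transports `α`. -/
lemma nonempty_stabilization (hX : (Q R).map (𝟙 X.cx) = 0) : Nonempty (Stabilization E X) := by
  let V : VBComplex R := E.toVBComplex.biprod (X.biprod X.dual)
  have := X.isIso_toBidual
  let pE : V.cx ⟶ E.cx := biprod.fst
  let pX : V.cx ⟶ X.cx := biprod.snd ≫ biprod.fst
  let pX' : V.cx ⟶ dualCx X.cx := biprod.snd ≫ biprod.snd
  let iE : E.cx ⟶ V.cx := biprod.inl
  let iX : X.cx ⟶ V.cx := biprod.inl ≫ biprod.inr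
  let iX' : dualCx X.cx ⟶ V.cx := biprod.inr ≫ biprod.inr
  have h₁₁ : iE ≫ pE = 𝟙 _ := by simp [iE, pE]
  have h₁₂ : iE ≫ pX = 0 := by simp [iE, pX]
  have h₁₃ : iE ≫ pX' = 0 := by simp [iE, pX']
  have h₂₁ : iX ≫ pE = 0 := by simp [iX, pE]
  have h₂₂ : iX ≫ pX = 𝟙 _ := by simp [iX, pX]
  have h₂₃ : iX ≫ pX' = 0 := by simp [iX, pX']
  have h₃₁ : iX' ≫ pE = 0 := by simp [iX', pE]
  have h₃₂ : iX' ≫ pX = 0 := by simp [iX', pX]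
  have h₃₃ : iX' ≫ pX' = 𝟙 _ := by simp [iX', pX']
  have htot : pE ≫ iE + pX ≫ iX + pX' ≫ iX' = 𝟙 V.cx := by
    have h : pX ≫ iX + pX' ≫ iX' = biprod.snd ≫
        (biprod.fst ≫ biprod.inl + biprod.snd ≫ biprod.inr) ≫ biprod.inr := by
      simp only [pX, iX, pX', iX', Category.assoc, Preadditive.add_comp, Preadditive.comp_add]
    rw [add_assoc, h, biprod.total, Category.id_comp, biprod.total]
  clear_value pE pX pX' iE iX iX'
  have d₁₁ := congrArg dualCxMap h₁₁
  have d₁₂ := congrArg dualCxMap h₁₂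
  have d₁₃ := congrArg dualCxMap h₁₃
  have d₂₁ := congrArg dualCxMap h₂₁
  have d₂₂ := congrArg dualCxMap h₂₂
  have d₂₃ := congrArg dualCxMap h₂₃
  have d₃₁ := congrArg dualCxMap h₃₁
  have d₃₂ := congrArg dualCxMap h₃₂
  have d₃₃ := congrArg dualCxMap h₃₃
  have dtot := congrArg dualCxMap htot
  simp only [dualCxMap_comp, dualCxMap_id, dualCxMap_zero, dualCxMap_add] at d₁₁ d₁₂ d₁₃ d₂₁ d₂₂ d₂₃ d₃₁ d₃₂ d₃₃ dtot
  let θ : V.cx ≅ dualCx V.cx :=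
    { hom := pE ≫ E.θ.hom ≫ dualCxMap pE + pX ≫ toBidualCx X.cx ≫ dualCxMap pX' +
        pX' ≫ dualCxMap pX
      inv := dualCxMap iE ≫ E.θ.inv ≫ iE + dualCxMap iX' ≫ inv (toBidualCx X.cx) ≫ iX +
        dualCxMap iX ≫ iX'
      hom_inv_id := by
        simp only [Preadditive.add_comp, Preadditive.comp_add, Category.assoc,
          reassoc_of% d₁₁, reassoc_of% d₁₂, reassoc_of% d₁₃, reassoc_of% d₂₁, reassoc_of% d₂₂,
          reassoc_of% d₂₃, reassoc_of% d₃₁, reassoc_of% d₃₂, reassoc_of% d₃₃, zero_comp, comp_zero,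
          add_zero, zero_add, Iso.hom_inv_id_assoc, IsIso.hom_inv_id_assoc, htot]
      inv_hom_id := by
        simp only [Preadditive.add_comp, Preadditive.comp_add, Category.assoc,
          reassoc_of% h₁₁, reassoc_of% h₁₂, reassoc_of% h₁₃, reassoc_of% h₂₁, reassoc_of% h₂₂,
          reassoc_of% h₂₃, reassoc_of% h₃₁, reassoc_of% h₃₂, reassoc_of% h₃₃, zero_comp, comp_zero,
          add_zero, zero_add, Iso.inv_hom_id_assoc, IsIso.inv_hom_id_assoc]
        rw [← dtot]; abel }
  have QX' := X.Q_map_id_dual hX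
  have hQ : (Q R).map (pE ≫ iE) = 𝟙 _ := by
    have := congrArg (Q R).map htot
    rwa [Functor.map_add, Functor.map_add, Q_map_eq_zero_of_factor hX,
      Q_map_eq_zero_of_factor QX', add_zero, add_zero, CategoryTheory.Functor.map_id] at this
  let α : (Q R).obj V.cx ≅ 𝔼.obj :=
    { hom := (Q R).map pE ≫ E.α.hom
      inv := E.α.inv ≫ (Q R).map iE
      hom_inv_id := by simp [← Functor.map_comp, hQ]
      inv_hom_id := by simp [← Functor.map_comp_assoc, h₁₁] }
  let M : SelfDualRep 𝔼 :=
    { V with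
      θ := θ
      symm := by
        simp only [θ, dualCxMap_add, dualCxMap_comp, Preadditive.comp_add, Category.assoc,
          ← reassoc_of% toBidualCx_naturality]
        rw [reassoc_of% E.symm, reassoc_of% toBidualCx_dual]
        abel
      α := α
      compat := by
        have h₁ : 𝔼.dualHomTo (P := V) α.hom =
            𝔼.dualHomTo (P := E.toVBComplex) E.α.hom ≫ (Q R).map (dualCxMap pE) := by
          rw [PerfectComplex.dualHomTo, PerfectComplex.dualHomTo, Category.assoc,
            derivedDual_comp (P := V) (P' := E.toVBComplex) (P'' := 𝔼.rep)]
          exact congrArg _ (derivedDual_map (P := V) (P' := E.toVBComplex) pE)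
        rw [h₁]
        simp only [α, θ, Functor.map_add, Category.assoc]
        rw [Q_map_eq_zero_of_factor hX, Q_map_eq_zero_of_factor QX', add_zero, add_zero,
          Functor.map_comp, Functor.map_comp, ← E.compat]
        simp only [Category.assoc] }
  have hι : adj (E := E) (F := M) iE = pE := by
    change θ.hom ≫ dualCxMap iE ≫ E.θ.inv = pE
    simp only [θ, Preadditive.add_comp, Category.assoc, reassoc_of% d₁₁, reassoc_of% d₁₂,
      reassoc_of% d₁₃, zero_comp, comp_zero, add_zero, Iso.hom_inv_id, Category.comp_id]
  refine ⟨⟨M, ⟨iE, by rw [hι, h₁₁], ?_⟩, iX, pX, hX, h₂₂, h₁₂, by rw [hι, h₂₁], ?_, ?_, ?_⟩⟩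
  · simp [M, α, ← Functor.map_comp_assoc, h₁₁]
  · change iX ≫ θ.hom ≫ _ = 0
    simp only [θ, Preadditive.add_comp, Preadditive.comp_add, Category.assoc, reassoc_of% h₂₁,
      reassoc_of% h₂₃, d₂₃, zero_comp, comp_zero, add_zero]
  · change _ ≫ θ.inv ≫ _ = 0
    simp only [θ, Preadditive.add_comp, Preadditive.comp_add, Category.assoc, h₁₂, h₂₂, h₃₂,
      reassoc_of% d₃₂, zero_comp, comp_zero, add_zero]
  · have : adj (E := M) (F := M) (pX ≫ iX) = pX' ≫ iX' := by
      change θ.hom ≫ dualCxMap (pX ≫ iX) ≫ θ.inv = _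
      simp only [θ, Preadditive.add_comp, Preadditive.comp_add, Category.assoc, dualCxMap_comp,
        reassoc_of% d₂₁, reassoc_of% d₂₂, reassoc_of% d₂₃, reassoc_of% d₁₂, reassoc_of% d₃₂,
        zero_comp, comp_zero, add_zero, zero_add]
    exact (congrArg₂ (fun a b => a ≫ iE + pX ≫ iX + b) hι this).trans htot

end

section

variable {E F : SelfDualRep 𝔼}

lemma Q_map_adj_eq_zero {f : F.cx ⟶ E.cx} (h : (Q R).map f = 0) : (Q R).map (adj f) = 0 := by
  obtain ⟨k, hk⟩ := F.exists_nul (f := f) (g := 0) (by rw [h, Functor.map_zero])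
  rw [sub_zero] at hk
  rw [hk, adj_nul, Q_map_nul]

namespace Stabilization

variable {X : VBComplex R} (S : Stabilization E X)

/-- `X` is isotropic in the stabilization. The next lemma is the same for the dual summand; together
they allow exponentials to terminate. -/
lemma a_a (u : F.cx ⟶ X.cx) : (u ≫ S.i) ≫ adj (u ≫ S.i) = 0 := by
  have h := S.i_i
  simp only [adj, dualCxMap_comp, Category.assoc, reassoc_of% h, zero_comp, comp_zero]

lemma v_v (w : X.cx ⟶ F.cx) : adj (S.p ≫ w) ≫ S.p ≫ w = 0 := by
  have h := S.p_p
  simp only [adj, dualCxMap_comp, Category.assoc, reassoc_of% h, zero_comp, comp_zero]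

lemma a_ι (u : F.cx ⟶ X.cx) : (u ≫ S.i) ≫ adj S.ι.hom = 0 := by
  rw [Category.assoc, S.i_ι, comp_zero]

lemma ι_v (w : X.cx ⟶ F.cx) : S.ι.hom ≫ S.p ≫ w = 0 := by
  rw [reassoc_of% S.ι_p, zero_comp]

lemma i_adj_π : S.i ≫ adj (S.p ≫ S.i) = 0 := by
  have h := S.i_i
  simp only [adj, dualCxMap_comp, Category.assoc, reassoc_of% h, zero_comp]

lemma adj_π_p : adj (S.p ≫ S.i) ≫ S.p = 0 := by
  have h := S.p_p
  simp only [adj, dualCxMap_comp, Category.assoc, h, comp_zero]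

lemma adj_π_ι : adj (S.p ≫ S.i) ≫ adj S.ι.hom = 0 := by
  rw [← adj_comp, reassoc_of% S.ι_p, zero_comp, adj_zero]

lemma ι_adj_π : S.ι.hom ≫ adj (S.p ≫ S.i) = 0 := by
  rw [← adj_adj (S.ι.hom ≫ _), adj_comp, adj_adj, Category.assoc, S.i_ι, comp_zero, adj_zero]

lemma adj_π_adj_π : adj (S.p ≫ S.i) ≫ adj (S.p ≫ S.i) = adj (S.p ≫ S.i) := by
  rw [← adj_comp, Category.assoc, reassoc_of% S.i_p]

/-- The linear map that multiplies by `r` on `X` and by `s` on its dual. -/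
def scale (r s : R) : S.M.cx ⟶ S.M.cx :=
  adj S.ι.hom ≫ S.ι.hom + r • (S.p ≫ S.i) + s • adj (S.p ≫ S.i)

lemma adj_scale (r s : R) : adj (S.scale r s) = S.scale s r := by
  rw [scale, scale, adj_add, adj_add, adj_smul, adj_smul, adj_comp, adj_adj, adj_adj]
  abel

lemma scale_scale {r s : R} (h : r * s = 1) : S.scale r s ≫ S.scale s r = 𝟙 _ := by
  have h₁ : S.ι.hom ≫ adj S.ι.hom = 𝟙 _ := S.ι.isom
  have h' : s * r = 1 := by rw [mul_comm, h]
  rw [← S.total]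
  simp only [scale, Preadditive.add_comp, Preadditive.comp_add, Linear.smul_comp, Linear.comp_smul,
    Category.assoc, reassoc_of% h₁, reassoc_of% S.i_ι, reassoc_of% S.ι_p,
    reassoc_of% S.i_p, S.i_adj_π, reassoc_of% S.adj_π_p, reassoc_of% S.adj_π_ι, S.ι_adj_π,
    S.adj_π_adj_π, zero_comp, comp_zero, smul_zero, add_zero, zero_add,
    smul_smul, h, h', one_smul]

lemma Q_map_scale (r s : R) : (Q R).map (S.scale r s) = 𝟙 _ := by
  have key (t : R) {f : S.M.cx ⟶ S.M.cx} (hf : (Q R).map f = 0) : (Q R).map (t • f) = 0 := by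
    obtain ⟨k, hk⟩ := S.M.exists_nul (f := f) (g := 0) (by rw [hf, Functor.map_zero])
    rw [sub_zero] at hk
    rw [hk, ← nul_smul, Q_map_nul]
  have h : (Q R).map (S.p ≫ S.i) = 0 := Q_map_eq_zero_of_factor S.acyclic _ _
  rw [scale, Functor.map_add, Functor.map_add, key r h, key s (Q_map_adj_eq_zero h),
    S.ι.Q_map_proj, add_zero, add_zero]

variable [Invertible (2 : R)]

/-- The isometry that multiplies by `2` on `X` and by `1/2` on its dual. -/
def ρ : IsometricMap S.M S.M where
  hom := S.scale 2 ⅟2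
  isom := by rw [adj_scale, S.scale_scale (mul_invOf_self _)]
  compat := by rw [Q_map_scale, Category.id_comp]

lemma adj_ρ_ρ : adj S.ρ.hom ≫ S.ρ.hom = 𝟙 _ := by
  rw [ρ, adj_scale, S.scale_scale (invOf_mul_self _)]

lemma ι_ρ : S.ι.hom ≫ S.ρ.hom = S.ι.hom := by
  simp only [ρ, scale, Preadditive.comp_add, Linear.comp_smul, S.ι_adj_π, reassoc_of% S.ι.isom,
    reassoc_of% S.ι_p, zero_comp, smul_zero, add_zero]

lemma a_ρ (u : F.cx ⟶ X.cx) : (u ≫ S.i) ≫ S.ρ.hom = (2 : R) • (u ≫ S.i) := by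
  simp only [ρ, scale, Preadditive.comp_add, Linear.comp_smul, Category.assoc, S.i_adj_π,
    reassoc_of% S.i_p, reassoc_of% S.i_ι, zero_comp, comp_zero, smul_zero, add_zero, zero_add]

lemma ρ_v (w : X.cx ⟶ F.cx) : S.ρ.hom ≫ S.p ≫ w = (2 : R) • (S.p ≫ w) := by
  simp only [ρ, scale, Preadditive.add_comp, Linear.smul_comp, Category.assoc, reassoc_of% S.adj_π_p,
    reassoc_of% S.i_p, reassoc_of% S.ι_p, zero_comp, comp_zero, smul_zero, add_zero, zero_add]

end Stabilization

end

end QuadCx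
end

noncomputable section
open CategoryTheory Limits
namespace QuadCx
variable {R : Type u} [CommRing R]

/-! ### Isometries that act trivially -/

section

variable {𝔼 : QuadraticComplex R} {E F : SelfDualRep 𝔼}

lemma Q_map_smul_eq_zero {f : E.cx ⟶ F.cx} (r : R) (hf : (Q R).map f = 0) :
    (Q R).map (r • f) = 0 := by
  obtain ⟨k, hk⟩ := E.exists_nul (f := f) (g := 0) (by rw [hf, Functor.map_zero])
  rw [sub_zero] at hk
  rw [hk, ← nul_smul, Q_map_nul]

variable [Invertible (2 : R)]

lemma smul_half_two {C D : CochainComplex (ModuleCat.{u} R) ℤ} (f : C ⟶ D) :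
    (⅟2 : R) • f + (⅟2 : R) • f = f := by
  rw [← smul_add, half_add]

/-- The exponential of a skew-adjoint endomorphism `Z` with `Z ^ 3 = 0`. -/
@[simps]
def expMap (Z : E.cx ⟶ E.cx) (hZ : adj Z = -Z) (h3 : Z ≫ Z ≫ Z = 0) (hQ : (Q R).map Z = 0) :
    IsometricMap E E where
  hom := 𝟙 _ + Z + (⅟2 : R) • (Z ≫ Z)
  isom := by
    rw [adj_add, adj_add, adj_id, adj_smul, adj_comp, hZ]
    have h₁ : Z ≫ Z = (⅟2 : R) • (Z ≫ Z) + (⅟2 : R) • (Z ≫ Z) := (smul_half_two _).symm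
    have h₂ : Z ≫ ((⅟2 : R) • (Z ≫ Z)) = 0 := by rw [Linear.comp_smul, h3, smul_zero]
    have h₃ : ((⅟2 : R) • (Z ≫ Z)) ≫ Z = 0 := by
      rw [Linear.smul_comp, Category.assoc, h3, smul_zero]
    have h₄ : ((⅟2 : R) • (Z ≫ Z)) ≫ ((⅟2 : R) • (Z ≫ Z)) = 0 := by
      rw [Linear.comp_smul, reassoc_of% h₃, zero_comp, smul_zero]
    rw [Preadditive.neg_comp, Preadditive.comp_neg, neg_neg]
    generalize (⅟2 : R) • (Z ≫ Z) = W at *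
    simp only [Preadditive.add_comp, Preadditive.comp_add, Preadditive.comp_neg, Category.id_comp,
      Category.comp_id, h₁, h₂, h₃, h₄]
    abel
  compat := by
    rw [Functor.map_add, Functor.map_add, hQ, Q_map_smul_eq_zero, add_zero, add_zero,
      CategoryTheory.Functor.map_id, Category.id_comp]
    rw [Functor.map_comp, hQ, zero_comp]

variable {𝒢 : Type v} [Groupoid.{w} 𝒢] (Φ : SelfDualRep 𝔼 ⥤ 𝒢)

/-- The scaling argument: an exponential that is conjugate to its square acts trivially. -/
lemma map_expMap (Z : E.cx ⟶ E.cx) (hZ : adj Z = -Z) (h3 : Z ≫ Z ≫ Z = 0)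
    (hQ : (Q R).map Z = 0) (s : IsometricMap F E) (ρ : IsometricMap E E)
    (hs : s.hom ≫ ρ.hom = s.hom)
    (h : Z ≫ ρ.hom = (2 : R) • (ρ.hom ≫ Z) ∨ ρ.hom ≫ Z = (2 : R) • (Z ≫ ρ.hom)) :
    Φ.map (expMap Z hZ h3 hQ).red = 𝟙 _ := by
  set T := expMap Z hZ h3 hQ with hT
  -- `ρ` fixes the isometry `s`, whose image is invertible in the groupoid.
  have hρ : Φ.map ρ.red = 𝟙 _ := by
    have h₁ : s.comp ρ = s := IsometricMap.ext hs
    rw [← cancel_epi (Φ.map s.red), ← Functor.map_comp, ← IsometricMap.red_comp, h₁,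
      Category.comp_id]
  have hTZ : T.hom = 𝟙 _ + Z + (⅟2 : R) • (Z ≫ Z) := rfl
  have hTT : (T.comp T).hom = 𝟙 _ + (2 : R) • Z + (2 : R) • (Z ≫ Z) := by
    have h₁ := smul_half_two (R := R) (Z ≫ Z)
    simp only [IsometricMap.comp_hom, hTZ, Preadditive.add_comp, Preadditive.comp_add,
      Category.id_comp, Category.comp_id, Linear.smul_comp, Linear.comp_smul,
      Category.assoc, h3, smul_zero, comp_zero, add_zero]
    rw [two_smul, two_smul]
    conv_rhs => rw [← h₁]
    conv_lhs => enter [1, 2, 2]; rw [← h₁]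
    abel
  -- Either `T ρ = ρ T²` or `ρ T = T² ρ`. As `ρ` acts trivially, the image of `T` equals its square.
  rcases h with h | h
  · have h₂ : T.comp ρ = ρ.comp (T.comp T) := by
      apply IsometricMap.ext
      rw [IsometricMap.comp_hom, IsometricMap.comp_hom ρ, hTT, hTZ]
      simp only [Preadditive.add_comp, Preadditive.comp_add, Category.id_comp, Category.comp_id,
        Linear.smul_comp, Linear.comp_smul, Category.assoc, h, reassoc_of% h, smul_smul]
      rw [invOf_mul_cancel_left]
    have h₃ := congr(Φ.map $(h₂).red)
    simp only [IsometricMap.red_comp, Functor.map_comp, hρ, Category.comp_id,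
      Category.id_comp] at h₃
    rw [← cancel_epi (Φ.map T.red), ← h₃, Category.comp_id]
  · have h₂ : ρ.comp T = (T.comp T).comp ρ := by
      apply IsometricMap.ext
      rw [IsometricMap.comp_hom ρ, IsometricMap.comp_hom (T.comp T), hTT, hTZ]
      simp only [Preadditive.add_comp, Preadditive.comp_add, Category.id_comp, Category.comp_id,
        Linear.smul_comp, Linear.comp_smul, Category.assoc, h, reassoc_of% h, smul_smul]
      rw [invOf_mul_cancel_left]
    have h₃ := congr(Φ.map $(h₂).red)
    simp only [IsometricMap.red_comp, Functor.map_comp, hρ, Category.comp_id,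
      Category.id_comp] at h₃
    rw [← cancel_epi (Φ.map T.red), ← h₃, Category.comp_id]

/-- The Eichler transformation of an isotropic map `u` into `X`. -/
lemma Stabilization.map_eichler_a {X : VBComplex R} (S : Stabilization E X) (u : E.cx ⟶ X.cx) :
    ∃ T : IsometricMap S.M S.M, Φ.map T.red = 𝟙 _ ∧
      T.hom = 𝟙 _ + adj S.ι.hom ≫ u ≫ S.i - adj (u ≫ S.i) ≫ S.ι.hom -
        (⅟2 : R) • (adj (u ≫ S.i) ≫ u ≫ S.i) := by
  have h₁ : S.ι.hom ≫ adj S.ι.hom = 𝟙 _ := S.ι.isom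
  have h₂ := S.a_a u
  have h₃ := S.a_ι u
  have h₄ : S.ι.hom ≫ adj (u ≫ S.i) = 0 := by
    rw [← adj_adj (S.ι.hom ≫ _), adj_comp, adj_adj, h₃, adj_zero]
  have h₅ := S.a_ρ u
  -- `ρ` is an isometry, so the doubling of `u ≫ S.i` forces its adjoint to scale inversely. Hence
  -- both terms of `Z` have the same weight.
  have h₆ : adj (u ≫ S.i) = (2 : R) • (S.ρ.hom ≫ adj (u ≫ S.i)) := by
    have := congr(S.ρ.hom ≫ adj $h₅)
    rwa [adj_comp, reassoc_of% S.ρ.isom, adj_smul, Linear.comp_smul] at this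
  have h₇ : S.ρ.hom ≫ adj S.ι.hom = adj S.ι.hom := by
    have := congr(S.ρ.hom ≫ adj $(S.ι_ρ))
    rwa [adj_comp, reassoc_of% S.ρ.isom, eq_comm] at this
  have hQ : (Q R).map (u ≫ S.i) = 0 := Q_map_eq_zero_of_factor S.acyclic _ _
  generalize u ≫ S.i = a at *
  have hZ : adj (adj S.ι.hom ≫ a - adj a ≫ S.ι.hom) = -(adj S.ι.hom ≫ a - adj a ≫ S.ι.hom) := by
    rw [adj_sub, adj_comp, adj_comp, adj_adj, adj_adj, neg_sub]
  have hZZ : (adj S.ι.hom ≫ a - adj a ≫ S.ι.hom) ≫ (adj S.ι.hom ≫ a - adj a ≫ S.ι.hom) =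
      -(adj a ≫ a) := by
    simp only [Preadditive.sub_comp, Preadditive.comp_sub, Category.assoc, reassoc_of% h₁,
      reassoc_of% h₂, reassoc_of% h₃, reassoc_of% h₄, zero_comp, comp_zero, sub_zero, zero_sub]
  refine ⟨expMap (adj S.ι.hom ≫ a - adj a ≫ S.ι.hom) hZ ?_ ?_,
    map_expMap Φ _ _ _ _ S.ι S.ρ S.ι_ρ (Or.inl ?_), ?_⟩
  · rw [hZZ]
    simp only [Preadditive.sub_comp, Preadditive.comp_neg, Category.assoc, reassoc_of% h₂,
      reassoc_of% h₄, zero_comp, comp_zero, sub_zero, neg_zero]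
  · rw [Functor.map_sub, Functor.map_comp, hQ, Functor.map_comp, Q_map_adj_eq_zero hQ, comp_zero,
      zero_comp, sub_zero]
  · rw [Preadditive.sub_comp, Category.assoc, Category.assoc, h₅, S.ι_ρ, Preadditive.comp_sub,
      reassoc_of% h₇, smul_sub, Linear.comp_smul]
    congr 1
    conv_lhs => rw [h₆]
    rw [Linear.smul_comp, Category.assoc]
  · rw [expMap_hom, hZZ, smul_neg]
    abel

/-- The transvection of an isotropic map `w` out of `X`. -/
lemma Stabilization.map_eichler_v {X : VBComplex R} (S : Stabilization E X) (w : X.cx ⟶ E.cx)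
    (hw : (S.p ≫ w) ≫ adj (S.p ≫ w) = 0) :
    ∃ T : IsometricMap S.M S.M, Φ.map T.red = 𝟙 _ ∧
      T.hom = 𝟙 _ + S.p ≫ w ≫ S.ι.hom - adj S.ι.hom ≫ adj (S.p ≫ w) := by
  have h₁ : S.ι.hom ≫ adj S.ι.hom = 𝟙 _ := S.ι.isom
  have h₂ := S.v_v w
  have h₃ := S.ι_v w
  have h₄ : adj (S.p ≫ w) ≫ adj S.ι.hom = 0 := by
    rw [← adj_comp, h₃, adj_zero]
  have h₅ := S.ρ_v w
  have h₆ : adj (S.p ≫ w) = (2 : R) • (adj (S.p ≫ w) ≫ S.ρ.hom) := by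
    have := congr(adj $h₅ ≫ S.ρ.hom)
    rwa [adj_comp, Category.assoc, S.adj_ρ_ρ, Category.comp_id, adj_smul, Linear.smul_comp] at this
  have h₇ : S.ρ.hom ≫ adj S.ι.hom = adj S.ι.hom := by
    have := congr(S.ρ.hom ≫ adj $(S.ι_ρ))
    rwa [adj_comp, reassoc_of% S.ρ.isom, eq_comm] at this
  have hQ : (Q R).map (S.p ≫ w) = 0 := Q_map_eq_zero_of_factor S.acyclic _ _
  rw [← Category.assoc S.p]
  generalize S.p ≫ w = v at *
  have hZ : adj (v ≫ S.ι.hom - adj S.ι.hom ≫ adj v) = -(v ≫ S.ι.hom - adj S.ι.hom ≫ adj v) := by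
    rw [adj_sub, adj_comp, adj_comp, adj_adj, adj_adj, neg_sub]
  -- Isotropy of `v` is exactly what kills the square, so no quadratic term appears.
  have hZZ : (v ≫ S.ι.hom - adj S.ι.hom ≫ adj v) ≫ (v ≫ S.ι.hom - adj S.ι.hom ≫ adj v) = 0 := by
    simp only [Preadditive.sub_comp, Preadditive.comp_sub, Category.assoc, reassoc_of% h₁, hw,
      reassoc_of% h₂, reassoc_of% h₃, reassoc_of% h₄, zero_comp, comp_zero, sub_zero]
  refine ⟨expMap (v ≫ S.ι.hom - adj S.ι.hom ≫ adj v) hZ ?_ ?_,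
    map_expMap Φ _ _ _ _ S.ι S.ρ S.ι_ρ (Or.inr ?_), ?_⟩
  · rw [hZZ, comp_zero]
  · rw [Functor.map_sub, Functor.map_comp, hQ, Functor.map_comp, Q_map_adj_eq_zero hQ, comp_zero,
      zero_comp, sub_zero]
  · rw [Preadditive.sub_comp, Category.assoc, Category.assoc, S.ι_ρ, Preadditive.comp_sub,
      reassoc_of% h₅, reassoc_of% h₇, smul_sub, Linear.smul_comp]
    congr 1
    conv_lhs => rw [h₆]
    rw [Linear.comp_smul]
  · rw [expMap_hom, hZZ, smul_zero]
    abel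

end
end QuadCx
end

noncomputable section
open CategoryTheory Limits
namespace QuadCx
variable {R : Type u} [CommRing R]

/-! ### Isometries homotopic to the identity -/

section

variable {𝔼 : QuadraticComplex R} {E F G : SelfDualRep 𝔼}
  {A B C : CochainComplex (ModuleCat.{u} R) ℤ}

/-- A surjective endomorphism of a finite module is injective, so the one-sided inverse is
two-sided. -/
lemma IsometricMap.adj_comp_self (g : IsometricMap E E) : adj g.hom ≫ g.hom = 𝟙 _ := by
  have h := g.isom
  have (i : ℤ) : IsIso ((adj g.hom).f i) := by
    have := E.finite i
    have hs : Function.Surjective ((adj g.hom).f i).hom := fun y =>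
      ⟨g.hom.f i y, congr(($h).f i y)⟩
    exact isIso_of_bijective _ ⟨OrzechProperty.injective_of_surjective_endomorphism _ hs, hs⟩
  have : IsIso (adj g.hom) := HomologicalComplex.Hom.isIso_of_components _
  rw [← cancel_mono (adj g.hom), Category.assoc, h, Category.comp_id, Category.id_comp]

/-- A map that vanishes in positive degrees and takes boundary values in degree `0`. -/
def IsLow (f : A ⟶ B) : Prop :=
  (∀ n : ℤ, 0 < n → f.f n = 0) ∧ ∃ c : A.X 0 ⟶ B.X (-1), f.f 0 = c ≫ B.d (-1) 0

lemma IsLow.comp {f : A ⟶ C} (hf : IsLow f) (g : C ⟶ B) : IsLow (f ≫ g) := by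
  obtain ⟨h, c, hc⟩ := hf
  refine ⟨fun n hn => by rw [HomologicalComplex.comp_f, h n hn, zero_comp], c ≫ g.f (-1), ?_⟩
  rw [HomologicalComplex.comp_f, hc, Category.assoc, Category.assoc, g.comm]

lemma IsLow.precomp {f : C ⟶ B} (hf : IsLow f) (g : A ⟶ C) : IsLow (g ≫ f) := by
  obtain ⟨h, c, hc⟩ := hf
  refine ⟨fun n hn => by rw [HomologicalComplex.comp_f, h n hn, comp_zero], g.f 0 ≫ c, ?_⟩
  rw [HomologicalComplex.comp_f, hc, Category.assoc]

/-- The adjoint of a low map vanishes in negative degrees. In degree 0 the values of `f` are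
boundaries coming from degree -1, where that adjoint is zero. -/
lemma IsLow.comp_adj {f : A ⟶ E.cx} (hf : IsLow f) {g : F.cx ⟶ E.cx} (hg : IsLow g) :
    f ≫ adj g = 0 := by
  have hg' (n : ℤ) (hn : n < 0) : (adj g).f n = 0 := adj_f_eq_zero (hg.1 (-n) (by omega))
  obtain ⟨h, c, hc⟩ := hf
  ext1 n
  rw [HomologicalComplex.comp_f, HomologicalComplex.zero_f]
  rcases lt_trichotomy n 0 with hn | rfl | hn
  · rw [hg' n hn, comp_zero]
  · rw [hc, Category.assoc, ← (adj g).comm, hg' (-1) (by omega), zero_comp, comp_zero]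
  · rw [h n hn, zero_comp]

lemma Fam.neg_adj (k : Fam E.cx F.cx) : (-k).adj = -k.adj := by
  rw [← neg_one_smul R k, Fam.smul_adj, neg_one_smul]

lemma nul_neg (k : Fam A B) : nul (-k) = -nul k := by
  rw [← neg_one_smul R k, nul_smul, neg_one_smul]

lemma Fam.low_neg (n : ℤ) (k : Fam A B) : (-k).low n = -k.low n := by
  funext i j
  simp only [Fam.low, Pi.neg_apply]
  split_ifs <;> simp

/-- A chain map concentrated in degree 0 is killed by the differential on both sides, which removes
both summands `d h` and `h d`. -/
lemma comp_nul_comp_eq_zero {f g : A ⟶ A} (hf : ∀ i : ℤ, i ≠ 0 → f.f i = 0)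
    (hg : ∀ i : ℤ, i ≠ 0 → g.f i = 0) (h : Fam A A) : f ≫ nul h ≫ g = 0 := by
  ext1 i
  rw [HomologicalComplex.comp_f, HomologicalComplex.zero_f]
  by_cases hi : i = 0
  · subst hi
    rw [HomologicalComplex.comp_f, nul_f_eq h (a := -1) (b := 1) (by omega) (by omega),
      Preadditive.add_comp, Category.assoc, Category.assoc, ← g.comm, hg (-1) (by omega),
      Preadditive.comp_add, f.comm_assoc, hf 1 (by omega)]
    simp
  · rw [hf i hi, zero_comp]

lemma isLow_nul (k : Fam A B) : IsLow (nul (k.low 0)) :=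
  ⟨fun _ hn => nul_low_gt k hn, _, nul_low_self (a := -1) (by omega) k⟩

lemma isLow_fromCone (K : VBComplex R) (k : Fam K.cx B) : IsLow (K.fromCone (k.low 0)) :=
  ⟨fun _ hn => K.fromCone_low_gt k hn, K.fromCone_low_zero k⟩

variable [Invertible (2 : R)] {𝒢 : Type v} [Groupoid.{w} 𝒢] (Φ : SelfDualRep 𝔼 ⥤ 𝒢)

/-- With `Y = u w`, the hypothesis says `g = (1 + Y*)⁻¹ (1 + Y + ½ Y* Y)`. Such a `g`, followed by
the embedding into the stabilization by `X`, is that embedding followed by four Eichler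
transformations. This imitates the factorization of an automorphism `1 + u w` into elementary
matrices. Lowness of `w` makes the maps out of `X` isotropic, so that the transvections `T₁` and
`T₃` exist. -/
lemma map_red_eq_id_of_isLow {X : VBComplex R} (hX : (Q R).map (𝟙 X.cx) = 0)
    (g : IsometricMap E E) (u : E.cx ⟶ X.cx) (w : X.cx ⟶ E.cx) (hw : IsLow w)
    (c : E.cx ⟶ E.cx) (h₁ : (𝟙 _ + u ≫ w) ≫ c = 𝟙 _) (h₂ : c ≫ (𝟙 _ + u ≫ w) = 𝟙 _)
    (hg : (𝟙 _ + adj (u ≫ w)) ≫ g.hom =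
      𝟙 _ + u ≫ w + (⅟2 : R) • (adj (u ≫ w) ≫ u ≫ w)) :
    Φ.map g.red = 𝟙 _ := by
  obtain ⟨S⟩ := nonempty_stabilization E X hX
  have hw' (w' : X.cx ⟶ E.cx) (h : IsLow w') : (S.p ≫ w') ≫ adj (S.p ≫ w') = 0 :=
    IsLow.comp_adj (F := S.M) (h.precomp S.p) (h.precomp S.p)
  obtain ⟨T₁, hT₁, e₁⟩ := S.map_eichler_v Φ (-(w ≫ c)) (by
    have := hw' _ (hw.comp c)
    rw [Preadditive.comp_neg, adj_neg, Preadditive.neg_comp_neg, this])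
  obtain ⟨T₂, hT₂, e₂⟩ := S.map_eichler_a Φ u
  obtain ⟨T₃, hT₃, e₃⟩ := S.map_eichler_v Φ w (hw' w hw)
  obtain ⟨T₄, hT₄, e₄⟩ := S.map_eichler_a Φ
    (-(adj g.hom ≫ (𝟙 _ - (⅟2 : R) • adj (u ≫ w ≫ c)) ≫ u))
  have key : g.comp S.ι = (((S.ι.comp T₁).comp T₂).comp T₃).comp T₄ := by
    have ιι : S.ι.hom ≫ adj S.ι.hom = 𝟙 _ := S.ι.isom
    have aι := S.a_ι u
    have ιa : S.ι.hom ≫ adj (u ≫ S.i) = 0 := by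
      rw [← adj_adj (S.ι.hom ≫ _), adj_comp, adj_adj, aι, adj_zero]
    have aa := S.a_a u
    have ιv := S.ι_v w
    have vι : adj (S.p ≫ w) ≫ adj S.ι.hom = 0 := by rw [← adj_comp, ιv, adj_zero]
    have vv := S.v_v w
    have av : u ≫ w = (u ≫ S.i) ≫ S.p ≫ w := by rw [Category.assoc, reassoc_of% S.i_p]
    have va : adj (S.p ≫ w) ≫ adj (u ≫ S.i) = adj (u ≫ w) := by rw [av, adj_comp]
    have hc : c = 𝟙 _ - u ≫ w ≫ c := by
      rw [← h₁, Preadditive.add_comp, Category.id_comp, Category.assoc, add_sub_cancel_right]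
    have hℓ : adj (u ≫ w ≫ c) = adj c ≫ adj (u ≫ w) := by rw [← Category.assoc, adj_comp]
    have hc' : adj c = 𝟙 _ - adj c ≫ adj (u ≫ w) := by
      conv_lhs => rw [hc]
      rw [adj_sub, adj_id, hℓ]
    have hcY : (𝟙 _ + adj (u ≫ w)) ≫ adj c = 𝟙 _ := by
      rw [← adj_id, ← adj_add, ← adj_comp, h₂]
    have hcY' : adj c ≫ (𝟙 _ + adj (u ≫ w)) = 𝟙 _ := by
      rw [← adj_id, ← adj_add, ← adj_comp, h₁]
    have hg' : g.hom = adj c + (𝟙 _ - (⅟2 : R) • (adj c ≫ adj (u ≫ w))) ≫ u ≫ w := by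
      have e₁ : g.hom = adj c ≫ (𝟙 _ + u ≫ w + (⅟2 : R) • (adj (u ≫ w) ≫ u ≫ w)) := by
        rw [← hg, reassoc_of% hcY']
      have e₂ : adj c ≫ u ≫ w = u ≫ w - adj c ≫ adj (u ≫ w) ≫ u ≫ w := by
        conv_lhs => rw [hc', Preadditive.sub_comp, Category.id_comp, Category.assoc]
      have e₃ := smul_half_two (R := R) (adj c ≫ adj (u ≫ w) ≫ u ≫ w)
      rw [e₁, Preadditive.comp_add, Preadditive.comp_add, Category.comp_id, e₂, Linear.comp_smul,
        Preadditive.sub_comp, Category.id_comp, Linear.smul_comp, Category.assoc]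
      conv_lhs => enter [1, 2, 2]; rw [← e₃]
      abel
    have gg := g.isom
    apply IsometricMap.ext
    simp only [IsometricMap.comp_hom, e₁, e₂, e₃, e₄]
    rw [hℓ]
    have av' : (u ≫ S.i) ≫ S.p ≫ w = u ≫ w := av.symm
    -- The embedding is followed through the four factors, with `a = u ≫ S.i` and `v = S.p ≫ w`:
    -- `T₁` adds a component `c* v*`, `T₂` creates an `a`-component, `T₃` cancels `c* v*` and turns
    -- the `E`-component into `g`, and `T₄` removes the `a`-component.
    have x₁ : S.ι.hom ≫ (𝟙 _ + S.p ≫ (-(w ≫ c)) ≫ S.ι.hom -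
        adj S.ι.hom ≫ adj (S.p ≫ (-(w ≫ c)))) = S.ι.hom + adj c ≫ adj (S.p ≫ w) := by
      have : adj (S.p ≫ (-(w ≫ c))) = -(adj c ≫ adj (S.p ≫ w)) := by
        rw [Preadditive.comp_neg, adj_neg, ← Category.assoc, adj_comp]
      rw [this, Preadditive.comp_sub, Preadditive.comp_add, Category.comp_id,
        reassoc_of% S.ι_p, reassoc_of% ιι, zero_comp, add_zero, sub_neg_eq_add]
    have x₂ : (S.ι.hom + adj c ≫ adj (S.p ≫ w)) ≫ (𝟙 _ + adj S.ι.hom ≫ u ≫ S.i -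
        adj (u ≫ S.i) ≫ S.ι.hom - (⅟2 : R) • (adj (u ≫ S.i) ≫ u ≫ S.i)) =
        adj c ≫ S.ι.hom + (𝟙 _ - (⅟2 : R) • (adj c ≫ adj (u ≫ w))) ≫ u ≫ S.i +
          adj c ≫ adj (S.p ≫ w) := by
      simp only [Preadditive.add_comp, Preadditive.comp_add, Preadditive.comp_sub,
        Preadditive.sub_comp, Category.comp_id, Category.id_comp, Category.assoc,
        reassoc_of% ιι, reassoc_of% ιa, reassoc_of% vι, reassoc_of% va, Linear.comp_smul,
        Linear.smul_comp, zero_comp, comp_zero, add_zero]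
      conv_rhs => enter [1, 1]; rw [hc']
      rw [Preadditive.sub_comp, Category.id_comp, Category.assoc]
      abel_nf
    have x₃ : (adj c ≫ S.ι.hom + (𝟙 _ - (⅟2 : R) • (adj c ≫ adj (u ≫ w))) ≫ u ≫ S.i +
        adj c ≫ adj (S.p ≫ w)) ≫ (𝟙 _ + S.p ≫ w ≫ S.ι.hom - adj S.ι.hom ≫ adj (S.p ≫ w)) =
        g.hom ≫ S.ι.hom + (𝟙 _ - (⅟2 : R) • (adj c ≫ adj (u ≫ w))) ≫ u ≫ S.i := by
      rw [hg']
      generalize 𝟙 _ - (⅟2 : R) • (adj c ≫ adj (u ≫ w)) = ℓ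
      simp only [Preadditive.add_comp, Preadditive.comp_add, Preadditive.comp_sub,
        Category.comp_id, Category.assoc,
        reassoc_of% ιι, reassoc_of% vι, reassoc_of% vv, reassoc_of% ιv, reassoc_of% S.i_p,
        reassoc_of% S.i_ι, zero_comp, comp_zero, add_zero, zero_add]
      abel
    have x₄ : (g.hom ≫ S.ι.hom + (𝟙 _ - (⅟2 : R) • (adj c ≫ adj (u ≫ w))) ≫ u ≫ S.i) ≫
        (𝟙 _ + adj S.ι.hom ≫
          (-(adj g.hom ≫ (𝟙 _ - (⅟2 : R) • (adj c ≫ adj (u ≫ w))) ≫ u)) ≫ S.i -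
          adj ((-(adj g.hom ≫ (𝟙 _ - (⅟2 : R) • (adj c ≫ adj (u ≫ w))) ≫ u)) ≫ S.i) ≫ S.ι.hom -
        (⅟2 : R) • (adj ((-(adj g.hom ≫ (𝟙 _ - (⅟2 : R) • (adj c ≫ adj (u ≫ w))) ≫ u)) ≫ S.i) ≫
          (-(adj g.hom ≫ (𝟙 _ - (⅟2 : R) • (adj c ≫ adj (u ≫ w))) ≫ u)) ≫ S.i)) =
        g.hom ≫ S.ι.hom := by
      generalize 𝟙 _ - (⅟2 : R) • (adj c ≫ adj (u ≫ w)) = ℓ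
      have : adj ((-(adj g.hom ≫ ℓ ≫ u)) ≫ S.i) =
          -(adj (u ≫ S.i) ≫ adj (adj g.hom ≫ ℓ)) := by
        rw [← adj_comp, ← adj_neg, Preadditive.neg_comp, Category.assoc, Category.assoc,
          Category.assoc]
      rw [this]
      have aa' : u ≫ S.i ≫ adj (u ≫ S.i) = 0 := by rw [← Category.assoc, aa]
      simp only [Preadditive.add_comp, Preadditive.comp_add, Preadditive.comp_sub,
        Preadditive.neg_comp, Preadditive.comp_neg, neg_neg, smul_zero, sub_neg_eq_add,
        Category.comp_id, Category.assoc, Linear.comp_smul,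
        reassoc_of% ιι, reassoc_of% ιa, reassoc_of% aa', reassoc_of% gg,
        reassoc_of% S.i_ι, zero_comp, comp_zero, sub_zero, add_zero]
      abel
    rw [x₁, x₂, x₃, x₄]
  have := congr(Φ.map ($key).red)
  simp only [IsometricMap.red_comp, Functor.map_comp, hT₁, hT₂, hT₃, hT₄, Category.comp_id] at this
  rw [← cancel_mono (Φ.map S.ι.red), this, Category.id_comp]

/-- The lower half of a null-homotopic map factors through the cone of the identity, with a low
second factor. -/
lemma map_red_eq_id_of_nul_low (g : IsometricMap E E) (k : Fam E.cx E.cx)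
    (hk : IsIso (𝟙 _ + nul (k.low 0)))
    (hg : (𝟙 _ + adj (nul (k.low 0))) ≫ g.hom = 𝟙 _ + nul (k.low 0) +
      (⅟2 : R) • (adj (nul (k.low 0)) ≫ nul (k.low 0))) :
    Φ.map g.red = 𝟙 _ := by
  have h : E.toCone ≫ E.fromCone (k.low 0) = nul (k.low 0) := E.toCone_fromCone _
  rw [← h] at hk hg
  exact map_red_eq_id_of_isLow Φ E.Q_map_id_cone g E.toCone _ (isLow_fromCone E.toVBComplex k)
    (inv (𝟙 _ + E.toCone ≫ E.fromCone (k.low 0))) (IsIso.hom_inv_id _) (IsIso.inv_hom_id _) hg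

/-- An isometry that is the identity off degree `0` and homotopic to the identity acts trivially. -/
lemma map_red_eq_id_of_f_eq (g : IsometricMap E E) (hQ : (Q R).map g.hom = 𝟙 _)
    (hg : ∀ i : ℤ, i ≠ 0 → g.hom.f i = 𝟙 _) : Φ.map g.red = 𝟙 _ := by
  obtain ⟨h, hh⟩ := E.exists_nul (f := g.hom) (g := 𝟙 _)
    (by rw [hQ, CategoryTheory.Functor.map_id])
  set X := g.hom - 𝟙 _ with hX
  have hgX : g.hom = 𝟙 _ + X := by rw [hX, add_sub_cancel]
  have hX0 (i : ℤ) (hi : i ≠ 0) : X.f i = 0 := by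
    rw [hX, HomologicalComplex.sub_f_apply, hg i hi, HomologicalComplex.id_f, sub_self]
  have hX0' (i : ℤ) (hi : i ≠ 0) : (adj X).f i = 0 := adj_f_eq_zero (hX0 _ (by omega))
  clear_value X
  -- The skew part of the homotopy. Its lower half `Y` satisfies `Y - Y* = ½ (X - X*)`.
  set k : Fam E.cx E.cx := (⅟2 : R) • (h - h.adj) with hk
  have hk' : k.adj = -k := by
    rw [hk, Fam.smul_adj, sub_eq_add_neg, Fam.add_adj, Fam.neg_adj, Fam.adj_adj, ← smul_neg,
      neg_add_rev, neg_neg]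
  set Y := nul (k.low 0) with hY
  have hD : nul k = (⅟2 : R) • (X - adj X) := by
    rw [hk, nul_smul, nul_sub, ← adj_nul, ← hh]
  have hYY : Y - adj Y = (⅟2 : R) • (X - adj X) := by
    rw [hY, adj_nul_low, hk', Fam.low_neg, nul_neg, nul_neg, hD]
    abel
  have hY0 (i : ℤ) (hi : i ≠ 0) : Y.f i = 0 := by
    rcases lt_or_gt_of_ne hi with hi | hi
    · rw [hY, nul_low_lt k hi, hD, HomologicalComplex.smul_f_apply, HomologicalComplex.sub_f_apply,
        hX0 i hi.ne, hX0' i hi.ne, sub_zero, smul_zero]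
    · rw [hY, nul_low_gt k hi]
  have hY0' (i : ℤ) (hi : i ≠ 0) : (adj Y).f i = 0 := adj_f_eq_zero (hY0 _ (by omega))
  -- in degree `0` the map `Y` is a boundary
  have hYz (Z : E.cx ⟶ E.cx) (hZ : ∀ i : ℤ, i ≠ 0 → Z.f i = 0) : Y ≫ Z = 0 := by
    ext1 i
    rw [HomologicalComplex.comp_f, HomologicalComplex.zero_f]
    by_cases hi : i = 0
    · subst hi
      rw [hY, nul_low_self (a := -1) (by omega), Category.assoc, ← Z.comm, hZ (-1) (by omega),
        zero_comp, comp_zero]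
    · rw [hZ i hi, comp_zero]
  have hzY (Z : E.cx ⟶ E.cx) (hZ : ∀ i : ℤ, i ≠ 0 → (adj Z).f i = 0) : Z ≫ adj Y = 0 := by
    rw [← adj_adj (Z ≫ _), adj_comp, adj_adj, hYz _ hZ, adj_zero]
  have Y₁ := hYz Y hY0
  have Y₂ := hYz _ hY0'
  have Y₃ := hzY (adj Y) (by simpa using hY0)
  -- The isometry equation for `1 + X`, in its two orders.
  have g₁ : X + adj X = -(X ≫ adj X) := by
    have := g.isom
    rw [hgX, adj_add, adj_id, Preadditive.add_comp, Preadditive.comp_add, Preadditive.comp_add,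
      Category.comp_id, Category.comp_id, Category.id_comp, add_assoc, add_eq_left] at this
    rw [eq_neg_iff_add_eq_zero, ← this]
    abel
  have g₂ : X + adj X = -(adj X ≫ X) := by
    have := g.adj_comp_self
    rw [hgX, adj_add, adj_id, Preadditive.add_comp, Preadditive.comp_add, Preadditive.comp_add,
      Category.comp_id, Category.comp_id, Category.id_comp, add_assoc, add_eq_left] at this
    rw [eq_neg_iff_add_eq_zero, ← this]
    abel
  have g₃ : X ≫ X = -(X ≫ adj X) := by
    have := congr(X ≫ $g₁)
    -- `X` is both concentrated in degree 0 and null-homotopic, so a product of three such factors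
    -- vanishes.
    have h₀ : X ≫ X ≫ adj X = 0 := by
      conv_lhs => enter [2, 1]; rw [hh]
      exact comp_nul_comp_eq_zero hX0 hX0' h
    rwa [Preadditive.comp_add, Preadditive.comp_neg, h₀, neg_zero, add_eq_zero_iff_eq_neg] at this
  have g₄ : adj X ≫ adj X = -(X ≫ adj X) := by
    have := congr(adj $g₃)
    rwa [adj_neg, adj_comp, adj_comp, adj_adj] at this
  have g₅ : adj X ≫ X = X ≫ adj X := neg_injective (g₂.symm.trans g₁)
  -- Compare the squares of `Y - Y*` and `½ (X - X*)`: they are `-Y* Y` and `-X X*`.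
  have g₆ : X ≫ adj X = adj Y ≫ Y := by
    have h₁ : (Y - adj Y) ≫ (Y - adj Y) = -(adj Y ≫ Y) := by
      rw [Preadditive.sub_comp, Preadditive.comp_sub, Preadditive.comp_sub, Y₁, Y₂, Y₃]
      abel
    have h₂ : (X - adj X) ≫ (X - adj X) =
        -(X ≫ adj X + X ≫ adj X + (X ≫ adj X + X ≫ adj X)) := by
      rw [Preadditive.sub_comp, Preadditive.comp_sub, Preadditive.comp_sub, g₃, g₄, g₅]
      abel
    rw [hYY, Linear.smul_comp, Linear.comp_smul, h₂, smul_neg, smul_neg, half_add, half_add] at h₁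
    exact neg_injective h₁
  have g₇ : X = Y - adj Y - (⅟2 : R) • (adj Y ≫ Y) := by
    rw [hYY, ← g₆, ← smul_sub, sub_eq_add_neg, ← g₁, sub_add_add_cancel, half_add]
  refine map_red_eq_id_of_nul_low Φ g k ⟨𝟙 _ - Y, ?_, ?_⟩ ?_
  · simp [← hY, Y₁]
  · simp [← hY, Y₁]
  · rw [← hY, hgX, g₇]
    simp only [Preadditive.add_comp, Preadditive.comp_add, Preadditive.comp_sub, Category.comp_id,
      Category.id_comp, Linear.comp_smul, Y₃, reassoc_of% Y₃, zero_comp, add_zero]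
    obtain ⟨W, hW⟩ : ∃ W, W + W = adj Y ≫ Y := ⟨_, smul_half_two (R := R) _⟩
    rw [← hW, half_add]
    abel

/-- An isometry that is homotopic to the identity acts trivially. -/
lemma map_red_eq_id (g : IsometricMap E E) (hQ : (Q R).map g.hom = 𝟙 _) :
    Φ.map g.red = 𝟙 _ := by
  obtain ⟨h, hh⟩ := E.exists_nul (f := g.hom) (g := 𝟙 _)
    (by rw [hQ, CategoryTheory.Functor.map_id])
  set Y := nul (h.low 0) with hY
  have hlow : IsLow Y := isLow_nul h
  have hYY : Y ≫ adj Y = 0 := hlow.comp_adj hlow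
  have hiso (i : ℤ) : IsIso (g.hom.f i) := 
    ⟨(adj g.hom).f i, congr(($g.isom).f i), congr(($g.adj_comp_self).f i)⟩
  have hneg (i : ℤ) (hi : i < 0) : (𝟙 _ + Y).f i = g.hom.f i := by
    rw [HomologicalComplex.add_f_apply, hY, nul_low_lt h hi, ← hh, HomologicalComplex.sub_f_apply,
      add_sub_cancel]
  have hpos (i : ℤ) (hi : 0 < i) : (𝟙 _ + Y).f i = 𝟙 _ := by
    rw [HomologicalComplex.add_f_apply, hlow.1 i hi, add_zero, HomologicalComplex.id_f]
  have hQY : (Q R).map Y = 0 := Q_map_nul _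
  have h1Y : IsIso (𝟙 _ + Y) := by
    refine VBComplex.isIso_of_isIso_f_of_ne (K := E.toVBComplex) (L := E.toVBComplex) _ ?_ 0
      fun i hi => ?_
    · rw [Functor.map_add, hQY, add_zero]
      infer_instance
    · rcases lt_or_gt_of_ne hi with hi | hi
      · rw [hneg i hi]; exact hiso i
      · rw [hpos i hi]; infer_instance
  obtain ⟨c, hc₁, hc₂⟩ := h1Y.out
  have c₁ : (𝟙 _ + adj Y) ≫ adj c = 𝟙 _ := by
    rw [← adj_id, ← adj_add, ← adj_comp, hc₂]
  have c₂ : adj c ≫ (𝟙 _ + adj Y) = 𝟙 _ := by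
    rw [← adj_id, ← adj_add, ← adj_comp, hc₁]
  -- The model isometry built from the lower half `Y` of `g - 1`. It acts trivially, and it is
  -- designed to agree with `g` off degree 0, so that the quotient falls under the preceding lemma.
  let gY : IsometricMap E E :=
    { hom := adj c ≫ (𝟙 _ + Y + (⅟2 : R) • (adj Y ≫ Y))
      isom := by
        have : (𝟙 _ + Y + (⅟2 : R) • (adj Y ≫ Y)) ≫ adj (𝟙 _ + Y + (⅟2 : R) • (adj Y ≫ Y)) =
            (𝟙 _ + adj Y) ≫ (𝟙 _ + Y) := by
          rw [adj_add, adj_add, adj_id, adj_smul, adj_comp, adj_adj]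
          simp only [Preadditive.add_comp, Preadditive.comp_add, Category.comp_id, Category.assoc,
            Category.id_comp, Linear.comp_smul, Linear.smul_comp, hYY, reassoc_of% hYY, zero_comp,
            comp_zero, smul_zero, add_zero]
          conv_rhs => rw [← smul_half_two (R := R) (adj Y ≫ Y)]
          abel
        rw [adj_comp, adj_adj, Category.assoc, reassoc_of% this, hc₁, Category.comp_id, c₂]
      compat := by
        have h₁ : (Q R).map (adj c) = 𝟙 _ := by
          have := congr((Q R).map $c₁)
          rwa [Functor.map_comp, Functor.map_add, Q_map_adj_eq_zero hQY, add_zero,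
            CategoryTheory.Functor.map_id, Category.id_comp] at this
        rw [Functor.map_comp, h₁, Functor.map_add, Functor.map_add, hQY, Q_map_smul_eq_zero,
          add_zero, add_zero, CategoryTheory.Functor.map_id, Category.id_comp, Category.id_comp]
        rw [Functor.map_comp, hQY, comp_zero] }
  have hgY : Φ.map gY.red = 𝟙 _ := map_red_eq_id_of_nul_low Φ gY h h1Y ((reassoc_of% c₁) _)
  have hgYQ : (Q R).map gY.hom = 𝟙 _ := by
    rw [← cancel_mono E.α.hom, gY.compat, Category.id_comp]
  let gY' : IsometricMap E E :=
    { hom := adj gY.hom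
      isom := by rw [adj_adj, gY.adj_comp_self]
      compat := by
        have := congr((Q R).map $(gY.isom))
        rw [Functor.map_comp, hgYQ, Category.id_comp, CategoryTheory.Functor.map_id] at this
        rw [this, Category.id_comp] }
  have hgY' : Φ.map (gY'.comp g).red = 𝟙 _ := by
    refine map_red_eq_id_of_f_eq Φ _ ?_ fun i hi => ?_
    · rw [← cancel_mono E.α.hom, (gY'.comp g).compat, Category.id_comp]
    · have : gY.hom.f i = g.hom.f i := by
        have hc' : (𝟙 _ + adj Y).f i ≫ gY.hom.f i =
            (𝟙 _ + Y).f i + (⅟2 : R) • ((adj Y).f i ≫ Y.f i) :=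
          congrArg (fun t => t.f i) ((reassoc_of% c₁) (𝟙 _ + Y + (⅟2 : R) • (adj Y ≫ Y)))
        -- In negative degrees `Y* = 0` and the model is `1 + Y = g`. In positive degrees `Y = 0`
        -- and `1 + Y* = g*`, so the model is the inverse of `g*`, which is `g`.
        rcases lt_or_gt_of_ne hi with hi | hi
        · have h0 : (adj Y).f i = 0 := adj_f_eq_zero (hlow.1 _ (by omega))
          rw [HomologicalComplex.add_f_apply, h0, hneg i hi] at hc'
          simpa using hc'
        · have h0 : (adj (𝟙 _ + Y - g.hom)).f i = 0 := adj_f_eq_zero (by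
            rw [HomologicalComplex.sub_f_apply, hneg _ (by omega), sub_self])
          rw [adj_sub, adj_add, adj_id, HomologicalComplex.sub_f_apply, sub_eq_zero] at h0
          rw [h0, hpos i hi, hlow.1 i hi, comp_zero, smul_zero, add_zero] at hc'
          have h1 : g.hom.f i ≫ (adj g.hom).f i = 𝟙 _ := congr(($g.isom).f i)
          rw [← Category.comp_id (g.hom.f i), ← hc', reassoc_of% h1]
      rw [IsometricMap.comp_hom, HomologicalComplex.comp_f, ← this]
      exact congr(($gY.adj_comp_self).f i)
  have h₂ : gY.comp (gY'.comp g) = g := IsometricMap.ext ((reassoc_of% gY.isom) _)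
  rw [← h₂, IsometricMap.red_comp, Functor.map_comp, hgY, hgY', Category.comp_id]

end
end QuadCx
end

noncomputable section
open CategoryTheory Limits
namespace QuadCx
variable {R : Type u} [CommRing R]

/-! ### Parallel isometries -/

section

variable {𝔼 : QuadraticComplex R} {E F : SelfDualRep 𝔼}
  [Invertible (2 : R)] {𝒢 : Type v} [Groupoid.{w} 𝒢] (Φ : SelfDualRep 𝔼 ⥤ 𝒢)

/-- A linear automorphism carrying `s` to `t` compares the complements but need not respect the
forms. Only its effect on the Lagrangian of the first complement is kept; the dual Lagrangian is
transported by the adjoint of the inverse. With `s* t` on the image of `F`, this gives an isometry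
`g` with `s g = t`, homotopic to the identity. -/
lemma map_red_eq_of_conj (s t : IsometricMap F E) (Ω Ω' : E.cx ⟶ E.cx) (h₁ : Ω ≫ Ω' = 𝟙 _)
    (hst : s.hom ≫ Ω = t.hom) : Φ.map s.red = Φ.map t.red := by
  obtain ⟨h, hε, hpost, hpre, hπ⟩ := s.exists_polarization
  obtain ⟨h', hε', hpost', hpre', hπ'⟩ := t.exists_polarization
  have ss := s.isom
  have tt := t.isom
  have hts : t.hom ≫ Ω' = s.hom := by rw [← hst, Category.assoc, h₁, Category.comp_id]
  have ωω : (𝟙 _ - adj s.hom ≫ s.hom) ≫ Ω ≫ (𝟙 _ - adj t.hom ≫ t.hom) ≫ Ω' ≫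
      (𝟙 _ - adj s.hom ≫ s.hom) = 𝟙 _ - adj s.hom ≫ s.hom := by
    simp [hts, reassoc_of% hts, h₁, reassoc_of% h₁, reassoc_of% ss]
  have sε : s.hom ≫ (𝟙 _ - adj s.hom ≫ s.hom) = 0 := by simp [reassoc_of% ss]
  have εs : (𝟙 _ - adj s.hom ≫ s.hom) ≫ adj s.hom = 0 := by simp [ss]
  have tε : t.hom ≫ (𝟙 _ - adj t.hom ≫ t.hom) = 0 := by simp [reassoc_of% tt]
  have εt : (𝟙 _ - adj t.hom ≫ t.hom) ≫ adj t.hom = 0 := by simp [tt]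
  have hsum : adj s.hom ≫ s.hom + (𝟙 _ - adj s.hom ≫ s.hom) = 𝟙 _ := by simp
  have εε : (𝟙 _ - adj s.hom ≫ s.hom) ≫ (𝟙 _ - adj s.hom ≫ s.hom) =
      𝟙 _ - adj s.hom ≫ s.hom := by simp [reassoc_of% ss]
  have εε' : (𝟙 _ - adj t.hom ≫ t.hom) ≫ (𝟙 _ - adj t.hom ≫ t.hom) =
      𝟙 _ - adj t.hom ≫ t.hom := by simp [reassoc_of% tt]
  generalize 𝟙 _ - adj s.hom ≫ s.hom = ε at *
  generalize 𝟙 _ - adj t.hom ≫ t.hom = ε' at *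
  have πω : nul (h.low 0) ≫ (ε ≫ Ω ≫ ε') ≫ nul (h'.low 0) = nul (h.low 0) ≫ ε ≫ Ω ≫ ε' :=
    nul_low_intertwine 0 h h' _ (by rw [hε, hpost]) (by
      rw [hε, hε', reassoc_of% εε, Category.assoc, Category.assoc, εε'])
  have ππ : nul (h'.low 0) ≫ nul (h'.low 0) = nul (h'.low 0) :=
    nul_low_idem 0 h' (by rw [hε', hpost'])
  have πε : nul (h.low 0) ≫ ε = nul (h.low 0) := by rw [← nul_post, Fam.low_post, hpost]
  have επ : ε ≫ nul (h.low 0) = nul (h.low 0) := by rw [← nul_pre, Fam.low_pre, hpre]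
  have πε' : nul (h'.low 0) ≫ ε' = nul (h'.low 0) := by rw [← nul_post, Fam.low_post, hpost']
  have επ' : ε' ≫ nul (h'.low 0) = nul (h'.low 0) := by rw [← nul_pre, Fam.low_pre, hpre']
  generalize nul (h.low 0) = π at *
  generalize nul (h'.low 0) = π' at *
  have sπ : s.hom ≫ π = 0 := by rw [← επ, reassoc_of% sε, zero_comp]
  have tπ : t.hom ≫ π' = 0 := by rw [← επ', reassoc_of% tε, zero_comp]
  have hωt : (π ≫ ε ≫ Ω ≫ ε') ≫ adj t.hom = 0 := by simp [εt]
  have hω's : (π' ≫ ε' ≫ Ω' ≫ ε) ≫ adj s.hom = 0 := by simp [εs]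
  have tω : t.hom ≫ adj (π ≫ ε ≫ Ω ≫ ε') = 0 := by
    rw [← adj_adj (t.hom ≫ _), adj_comp, adj_adj, hωt, adj_zero]
  have sω : s.hom ≫ adj (π' ≫ ε' ≫ Ω' ≫ ε) = 0 := by
    rw [← adj_adj (s.hom ≫ _), adj_comp, adj_adj, hω's, adj_zero]
  have hωω : (π ≫ ε ≫ Ω ≫ ε') ≫ π' ≫ ε' ≫ Ω' ≫ ε = π := by
    simp only [Category.assoc] at πω ⊢
    rw [reassoc_of% πω, reassoc_of% εε', ωω, πε]
  have tx : t.hom ≫ π' ≫ ε' ≫ Ω' ≫ ε = 0 := by rw [reassoc_of% tπ, zero_comp]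
  have sx : s.hom ≫ π ≫ ε ≫ Ω ≫ ε' = 0 := by rw [reassoc_of% sπ, zero_comp]
  have iso₁ : (π ≫ ε ≫ Ω ≫ ε') ≫ adj (π ≫ ε ≫ Ω ≫ ε') = 0 := by
    have : π ≫ ε ≫ Ω ≫ ε' = (π ≫ ε ≫ Ω ≫ ε') ≫ π' := by simpa using πω.symm
    rw [this, adj_comp, hπ', Category.assoc, Preadditive.sub_comp, Preadditive.comp_sub,
      reassoc_of% πε', reassoc_of% ππ, sub_self, comp_zero]
  have iso₂ : adj (π' ≫ ε' ≫ Ω' ≫ ε) ≫ π' ≫ ε' ≫ Ω' ≫ ε = 0 := by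
    rw [adj_comp, hπ', Category.assoc, Preadditive.sub_comp, reassoc_of% επ', reassoc_of% ππ,
      sub_self, comp_zero]
  generalize π ≫ ε ≫ Ω ≫ ε' = x at *
  generalize π' ≫ ε' ≫ Ω' ≫ ε = x' at *
  have xt : adj x' ≫ adj t.hom = 0 := by rw [← adj_comp, tx, adj_zero]
  have hgs : s.hom ≫ (adj s.hom ≫ t.hom + x + adj x') = t.hom := by
    rw [Preadditive.comp_add, Preadditive.comp_add, reassoc_of% ss, sx, sω, add_zero, add_zero]
  let g : IsometricMap E E :=
    { hom := adj s.hom ≫ t.hom + x + adj x'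
      isom := by
        rw [adj_add, adj_add, adj_comp, adj_adj, adj_adj]
        have e : adj x' ≫ adj x = ε - π := by rw [← adj_comp, hωω, hπ]
        simp only [Preadditive.add_comp, Preadditive.comp_add, Category.assoc,
          reassoc_of% tt, tω, reassoc_of% hωt, iso₁, hωω, iso₂, tx, e, reassoc_of% xt, comp_zero, zero_comp,
          add_zero, zero_add]
        rw [← hsum]
        abel
      compat := by
        rw [← cancel_epi ((Q R).map s.hom), ← Functor.map_comp_assoc, hgs, s.compat, t.compat] }
  have hg : Φ.map g.red = 𝟙 _ := map_red_eq_id Φ g (by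
    rw [← cancel_mono E.α.hom, g.compat, Category.id_comp])
  have : s.comp g = t := IsometricMap.ext hgs
  rw [← this, IsometricMap.red_comp, Functor.map_comp, hg, Category.comp_id]

/-- Parallel isometries are identified in every groupoid. -/
lemma map_red_eq (s t : IsometricMap F E) : Φ.map s.red = Φ.map t.red := by
  obtain ⟨k, hk⟩ := F.exists_nul (f := t.hom) (g := s.hom)
    (by rw [← cancel_mono E.α.hom, s.compat, t.compat])
  obtain ⟨S⟩ := nonempty_stabilization E F.cone F.Q_map_id_cone
  have hjw : F.toCone ≫ S.i ≫ S.p ≫ F.fromCone k = t.hom - s.hom := by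
    rw [reassoc_of% S.i_p, hk, F.toCone_fromCone]
  have aι : (F.toCone ≫ S.i) ≫ adj S.ι.hom = 0 := S.a_ι F.toCone
  have ιv : S.ι.hom ≫ S.p ≫ F.fromCone k = 0 := S.ι_v _
  have ιι := S.ι.isom
  rw [← Category.assoc] at hjw
  generalize F.toCone ≫ S.i = a at *
  generalize S.p ≫ F.fromCone k = v at *
  have inv_add {D : SelfDualRep 𝔼} {n : D.cx ⟶ D.cx} (hn : n ≫ n = 0) :
      (𝟙 _ + n) ≫ (𝟙 _ - n) = 𝟙 _ ∧ (𝟙 _ - n) ≫ (𝟙 _ + n) = 𝟙 _ := by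
    constructor <;> simp [hn]
  obtain ⟨l₁, -⟩ := inv_add (D := S.M) (n := adj S.ι.hom ≫ adj s.hom ≫ a) (by
    simp [reassoc_of% aι])
  obtain ⟨l₂, -⟩ := inv_add (D := S.M) (n := v ≫ S.ι.hom) (by simp [reassoc_of% ιv])
  obtain ⟨-, l₃⟩ := inv_add (D := S.M) (n := adj S.ι.hom ≫ adj t.hom ≫ a) (by
    simp [reassoc_of% aι])
  have := map_red_eq_of_conj Φ (s.comp S.ι) (t.comp S.ι)
    ((𝟙 _ + adj S.ι.hom ≫ adj s.hom ≫ a) ≫ (𝟙 _ + v ≫ S.ι.hom) ≫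
      (𝟙 _ - adj S.ι.hom ≫ adj t.hom ≫ a))
    ((𝟙 _ + adj S.ι.hom ≫ adj t.hom ≫ a) ≫ (𝟙 _ - v ≫ S.ι.hom) ≫
      (𝟙 _ - adj S.ι.hom ≫ adj s.hom ≫ a))
    (by simp only [Category.assoc, reassoc_of% l₃, reassoc_of% l₂, l₁])
    (by
      have e₁ : (s.comp S.ι).hom ≫ (𝟙 _ + adj S.ι.hom ≫ adj s.hom ≫ a) = s.hom ≫ S.ι.hom + a := by
        simp [reassoc_of% ιι, reassoc_of% s.isom]
      have e₂ : (s.hom ≫ S.ι.hom + a) ≫ (𝟙 _ + v ≫ S.ι.hom) = t.hom ≫ S.ι.hom + a := by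
        simp only [Preadditive.add_comp, Preadditive.comp_add, Category.assoc, reassoc_of% ιv,
          reassoc_of% hjw, Category.comp_id, zero_comp, comp_zero, Preadditive.sub_comp]
        abel
      have e₃ : (t.hom ≫ S.ι.hom + a) ≫ (𝟙 _ - adj S.ι.hom ≫ adj t.hom ≫ a) =
          t.hom ≫ S.ι.hom := by
        simp [reassoc_of% ιι, reassoc_of% t.isom, reassoc_of% aι]
      rw [reassoc_of% e₁, reassoc_of% e₂, e₃]
      rfl)
  rwa [IsometricMap.red_comp, IsometricMap.red_comp, Functor.map_comp, Functor.map_comp,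
    cancel_mono] at this

end
end QuadCx
end

noncomputable section
open CategoryTheory Limits
namespace QuadCx
variable {R : Type u} [CommRing R]

/-! ### Cospans of isometries -/

section

variable {𝔼 : QuadraticComplex R} [Invertible (2 : R)]

/-- Any two self-dual representatives embed isometrically into a third one. -/
lemma exists_cospan (F E : SelfDualRep 𝔼) :
    ∃ M : SelfDualRep 𝔼, Nonempty (IsometricMap F M) ∧ Nonempty (IsometricMap E M) := by
  obtain ⟨φ, hφ⟩ := F.exists_chainMap (F.α.hom ≫ E.α.inv)
  have hφα : (Q R).map φ ≫ E.α.hom = F.α.hom := by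
    rw [hφ, Category.assoc, Iso.inv_hom_id, Category.comp_id]
  obtain ⟨l, hl⟩ := F.exists_nul (f := φ ≫ adj φ) (g := 𝟙 _)
    (by rw [Q_map_adj φ hφα, CategoryTheory.Functor.map_id])
  -- The failure of `φ` to be isometric is self-adjoint, so its null-homotopy can be averaged to a
  -- self-adjoint one.
  obtain ⟨k, hk, hk'⟩ : ∃ k : Fam F.cx F.cx, φ ≫ adj φ - 𝟙 _ = nul k ∧ k.adj = k := by
    refine ⟨(⅟2 : R) • (l + l.adj), ?_, ?_⟩
    · rw [nul_smul, nul_add, ← adj_nul, ← hl, adj_sub, adj_id, adj_comp, adj_adj, half_add]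
    · rw [Fam.smul_adj, Fam.add_adj, Fam.adj_adj, add_comm]
  obtain ⟨S⟩ := nonempty_stabilization E F.cone F.Q_map_id_cone
  have ιι := S.ι.isom
  have aι := S.a_ι F.toCone
  have ιa : S.ι.hom ≫ adj (F.toCone ≫ S.i) = 0 := by
    rw [← adj_adj (S.ι.hom ≫ _), adj_comp, adj_adj, aι, adj_zero]
  have aa := S.a_a F.toCone
  have ιv := S.ι_v (F.fromCone (k.low 0))
  have vι : adj (S.p ≫ F.fromCone (k.low 0)) ≫ adj S.ι.hom = 0 := by rw [← adj_comp, ιv, adj_zero]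
  have vv := S.v_v (F.fromCone (k.low 0))
  have av : (F.toCone ≫ S.i) ≫ S.p ≫ F.fromCone (k.low 0) = nul (k.low 0) := by
    rw [Category.assoc, reassoc_of% S.i_p, F.toCone_fromCone]
  have Qa : (Q R).map (F.toCone ≫ S.i) = 0 := Q_map_eq_zero_of_factor S.acyclic _ _
  have Qv : (Q R).map (S.p ≫ F.fromCone (k.low 0)) = 0 := Q_map_eq_zero_of_factor S.acyclic _ _
  generalize F.toCone ≫ S.i = a at *
  generalize S.p ≫ F.fromCone (k.low 0) = v at *
  have va : adj v ≫ adj a = nul k - nul (k.low 0) := by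
    rw [← adj_comp, av, adj_nul_low, hk']
  -- The cross terms of the hyperbolic part are `-(a v + v* a*)`. As `a v` is the lower half of `nul
  -- k` and `v* a*` the upper half, they cancel the defect `φ φ* - 1`.
  refine ⟨S.M, ⟨⟨φ ≫ S.ι.hom + a - adj v, ?_, ?_⟩⟩, ⟨S.ι⟩⟩
  · rw [adj_sub, adj_add, adj_comp, adj_adj]
    simp only [Preadditive.add_comp, Preadditive.comp_add, Preadditive.sub_comp,
      Preadditive.comp_sub, Category.assoc, reassoc_of% ιι, ιa, aa, av, va, ιv, vv,
      reassoc_of% aι, reassoc_of% vι, comp_zero, zero_comp, ← hk]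
    abel
  · rw [Functor.map_sub, Functor.map_add, Qa, Q_map_adj_eq_zero Qv, add_zero, sub_zero,
      Functor.map_comp, Category.assoc, S.ι.compat, hφα]

end

/-! ### Splitting a reduction after stabilization -/

section

variable {𝔼 : QuadraticComplex R} {E F : SelfDualRep 𝔼}
  {A B C : CochainComplex (ModuleCat.{u} R) ℤ}

/-- The pairing of two maps into a self-dual complex. -/
def SelfDualRep.pair (E : SelfDualRep 𝔼) (f : A ⟶ E.cx) (g : B ⟶ E.cx) : A ⟶ dualCx B :=
  f ≫ E.θ.hom ≫ dualCxMap g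

lemma SelfDualRep.pair_symm (E : SelfDualRep 𝔼) (f : A ⟶ E.cx) (g : B ⟶ E.cx) :
    E.pair g f = toBidualCx B ≫ dualCxMap (E.pair f g) := by
  rw [pair, pair, dualCxMap_comp, dualCxMap_comp, Category.assoc,
    ← reassoc_of% toBidualCx_naturality g, reassoc_of% E.symm]

lemma SelfDualRep.pair_add (E : SelfDualRep 𝔼) (f : A ⟶ E.cx) (g g' : B ⟶ E.cx) :
    E.pair f (g + g') = E.pair f g + E.pair f g' := by
  simp only [pair, dualCxMap_add, Preadditive.comp_add]

lemma SelfDualRep.add_pair (E : SelfDualRep 𝔼) (f f' : A ⟶ E.cx) (g : B ⟶ E.cx) :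
    E.pair (f + f') g = E.pair f g + E.pair f' g := by
  simp only [pair, Preadditive.add_comp]

lemma SelfDualRep.comp_pair (E : SelfDualRep 𝔼) (a : C ⟶ A) (f : A ⟶ E.cx) (g : B ⟶ E.cx) :
    E.pair (a ≫ f) g = a ≫ E.pair f g := by
  simp only [pair, Category.assoc]

lemma SelfDualRep.pair_comp (E : SelfDualRep 𝔼) (f : A ⟶ E.cx) (b : C ⟶ B) (g : B ⟶ E.cx) :
    E.pair f (b ≫ g) = E.pair f g ≫ dualCxMap b := by
  simp only [pair, Category.assoc, dualCxMap_comp]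

lemma pair_adj (f : F.cx ⟶ E.cx) (g : A ⟶ E.cx) (h : B ⟶ F.cx) :
    F.pair (g ≫ adj f) h = E.pair g (h ≫ f) := by
  simp only [SelfDualRep.pair, Category.assoc, dualCxMap_comp, reassoc_of% θ_dualCxMap]

lemma pair_desc_eq {f : A ⟶ F.cx} {g : B ⟶ F.cx} {f' : A ⟶ E.cx} {g' : B ⟶ E.cx}
    (h₁ : F.pair f f = E.pair f' f') (h₂ : F.pair g f = E.pair g' f')
    (h₃ : F.pair g g = E.pair g' g') :
    F.pair (biprod.desc f g) (biprod.desc f g) = E.pair (biprod.desc f' g') (biprod.desc f' g') := by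
  have h₄ : F.pair f g = E.pair f' g' := by rw [F.pair_symm, E.pair_symm, h₂]
  have (D : SelfDualRep 𝔼) (x : A ⟶ D.cx) (y : B ⟶ D.cx) :
      biprod.desc x y = biprod.fst ≫ x + biprod.snd ≫ y := by
    apply biprod.hom_ext' <;> simp
  simp only [this, SelfDualRep.pair_add, SelfDualRep.add_pair, SelfDualRep.comp_pair,
    SelfDualRep.pair_comp, h₁, h₂, h₃, h₄]

variable [Invertible (2 : R)]

/-- A reduction whose left leg has a section comes from an isometry. -/
lemma Reduction.exists_eq_red (ξ : Reduction F E) (σ : F.cx ⟶ ξ.A.cx) (hσ : σ ≫ ξ.f = 𝟙 _) :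
    ∃ s : IsometricMap F E, (⟦ξ⟧ : IsotropicReduction F E) = s.red := by
  refine ⟨⟨σ ≫ ξ.e, ?_, ?_⟩, IsometricMap.eq_red _ ⟨σ, hσ, rfl⟩⟩
  · have h := congr(σ ≫ $(ξ.comm) ≫ dualCxMap σ ≫ F.θ.inv)
    have h' := congr(dualCxMap $hσ)
    simp only [Category.assoc, reassoc_of% hσ] at h
    rw [dualCxMap_comp, dualCxMap_id] at h'
    rw [reassoc_of% h', Iso.hom_inv_id] at h
    rw [h, adj, dualCxMap_comp, Category.assoc, Category.assoc]
  · rw [Functor.map_comp, Category.assoc, ← ξ.compat, ← Functor.map_comp_assoc, hσ,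
      CategoryTheory.Functor.map_id, Category.id_comp]

end
end QuadCx
end

/-! ### Acyclic covers and surjectivity of the enlarged left leg -/

noncomputable section
open CategoryTheory Limits
namespace QuadCx
variable {R : Type u} [CommRing R]

section

variable {𝔼 : QuadraticComplex R} {E F : SelfDualRep 𝔼}

/-- There is an acyclic complex in negative degrees that covers `F` in degrees at most `-2`. -/
lemma exists_acyclic_cover (F : SelfDualRep 𝔼) : ∃ (C : VBComplex R) (w : C.cx ⟶ F.cx),
    (Q R).map (𝟙 C.cx) = 0 ∧ (∀ i : ℤ, 0 ≤ i → IsZero (C.cx.X i)) ∧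
      ∀ i : ℤ, i ≤ -2 → Function.Surjective (w.f i) := by
  have hX : (Q R).map (𝟙 F.cone.dual.cx) = 0 := F.cone.Q_map_id_dual F.Q_map_id_cone
  obtain ⟨h, hh⟩ := F.cone.dual.exists_nul (f := 𝟙 F.cone.dual.cx) (g := 0)
    (by rw [hX, Functor.map_zero])
  rw [sub_zero] at hh
  -- The dual cone covers `F^∨ ≅ F` in all degrees. The cut at -1 keeps it entire in degrees at most
  -- -2 and kills it from degree 0 on.
  obtain ⟨C, ι, r, hιr, hrι⟩ := F.cone.dual.exists_splitting (nul (h.low (-1)))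
    (nul_low_idem (-1) h (by rw [← hh, Fam.post_id]))
  have hιr' (i : ℤ) : ι.f i ≫ r.f i = 𝟙 _ := congr(($hιr).f i)
  have hrι' (i : ℤ) : r.f i ≫ ι.f i = (nul (h.low (-1))).f i := congr(($hrι).f i)
  refine ⟨C, ι ≫ dualCxMap F.toCone ≫ F.θ.inv, ?_, fun i hi => ?_, fun i hi => ?_⟩
  · rw [← hιr, ← Category.id_comp r, Functor.map_comp, Functor.map_comp, hX, zero_comp, comp_zero]
  · have h₁ : ι.f i ≫ r.f i ≫ ι.f i = 0 := by rw [hrι', nul_low_gt h (by omega), comp_zero]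
    rw [reassoc_of% hιr'] at h₁
    rw [IsZero.iff_id_eq_zero, ← hιr', h₁, zero_comp]
  · obtain ⟨t, ht⟩ : ∃ t : (dualCx F.cx).X i ⟶ F.cone.dual.cx.X i,
        t ≫ (dualCxMap F.toCone).f i = 𝟙 _ := by
      obtain ⟨t, ht⟩ := F.toCone_f_split (-i)
      exact ⟨dualModMap t, congrArg dualModMap ht⟩
    have h₁ : (nul (h.low (-1))).f i = 𝟙 _ := by
      rw [nul_low_lt h (by omega), ← hh, HomologicalComplex.id_f]
    have h₂ : (F.θ.hom.f i ≫ t ≫ r.f i) ≫ (ι ≫ dualCxMap F.toCone ≫ F.θ.inv).f i = 𝟙 _ := by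
      rw [HomologicalComplex.comp_f, HomologicalComplex.comp_f, Category.assoc, Category.assoc,
        reassoc_of% hrι', h₁, Category.id_comp, reassoc_of% ht]
      exact congr(($(F.θ.hom_inv_id)).f i)
    exact fun y => ⟨_, congr($h₂ y)⟩

/-- The inclusion condition on a reduction, in terms of `F`. -/
lemma Reduction.exists_add_d (ξ : Reduction F E) (x : F.cx.X (-1)) :
    ∃ (a : ξ.A.cx.X (-1)) (z : F.cx.X (-2)), x = ξ.f.f (-1) a + F.cx.d (-2) (-1) z := by
  have h₁ := ξ.isIso_f 1 le_rfl
  have h₂ := ξ.isIso_f 2 (by norm_num)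
  have h₃ := ξ.isIso_e (-1) (by norm_num)
  let bF : F.cx.X (-1) →ₗ[R] Module.Dual R (F.cx.X 1) := (F.θ.hom.f (-1)).hom
  let bF' : F.cx.X (-2) →ₗ[R] Module.Dual R (F.cx.X 2) := (F.θ.hom.f (-2)).hom
  let bE : E.cx.X (-1) →ₗ[R] Module.Dual R (E.cx.X 1) := (E.θ.hom.f (-1)).hom
  have hbF : Function.Bijective bF := bijective_of_isIso (F.θ.hom.f (-1))
  have hbF' : Function.Bijective bF' := bijective_of_isIso (F.θ.hom.f (-2))
  have hbE : Function.Bijective bE := bijective_of_isIso (E.θ.hom.f (-1))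
  have hcomm (a : ξ.A.cx.X (-1)) (y : ξ.A.cx.X 1) :
      bF (ξ.f.f (-1) a) (ξ.f.f 1 y) = bE (ξ.e.f (-1) a) (ξ.e.f 1 y) := by
    have : (ξ.f ≫ F.θ.hom ≫ dualCxMap ξ.f).f (-1) a = (ξ.e ≫ E.θ.hom ≫ dualCxMap ξ.e).f (-1) a :=
      congr($(ξ.comm).f (-1) a)
    exact congrArg (fun ψ : Module.Dual R (ξ.A.cx.X 1) => ψ y) this
  have hd (z : F.cx.X (-2)) (y : F.cx.X 1) : bF (F.cx.d (-2) (-1) z) y = bF' z (F.cx.d 1 2 y) :=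
    congrArg (fun ψ : Module.Dual R (F.cx.X 1) => ψ y) (comm_apply F.θ.hom (-2) (-1) z)
  -- Pairing with `x` is a functional on `A^1`; it extends to `E^1 ⊕ A^2`. The component on `E^1` is
  -- represented by an element of `E^{-1} ≅ A^{-1}`, and the one on `A^2 ≅ F^2` by an element of
  -- `F^{-2}`.
  obtain ⟨β, hβ⟩ := ξ.incl (bF x ∘ₗ (ξ.f.f 1).hom)
  have hβ' (y : ξ.A.cx.X 1) : β (ξ.e.f 1 y, ξ.A.cx.d 1 2 y) = bF x (ξ.f.f 1 y) := congr($hβ y)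
  obtain ⟨y, hy⟩ := hbE.surjective (β ∘ₗ LinearMap.inl R _ _)
  obtain ⟨a, rfl⟩ := (bijective_of_isIso (ξ.e.f (-1))).surjective y
  obtain ⟨z, hz⟩ := hbF'.surjective (β ∘ₗ LinearMap.inr R _ _ ∘ₗ (inv (ξ.f.f 2)).hom)
  refine ⟨a, z, hbF.injective (LinearMap.ext fun u => ?_)⟩
  obtain ⟨y, rfl⟩ := (bijective_of_isIso (ξ.f.f 1)).surjective u
  have e₁ : bE (ξ.e.f (-1) a) (ξ.e.f 1 y) = β (ξ.e.f 1 y, 0) := congr($hy (ξ.e.f 1 y))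
  have e₂ : bF' z (F.cx.d 1 2 (ξ.f.f 1 y)) = β (0, ξ.A.cx.d 1 2 y) := by
    rw [← comm_apply, hz]
    exact congrArg (fun t => β (0, t)) congr($(IsIso.hom_inv_id (ξ.f.f 2)) (ξ.A.cx.d 1 2 y))
  rw [map_add, LinearMap.add_apply, hcomm, hd, e₁, e₂, ← map_add, Prod.mk_add_mk, add_zero,
    zero_add, hβ']

/-- As the leg is an isomorphism in degrees 1 and 2, `d x` lifts to a cocycle of `A`, exact because
its image is. Subtracting a primitive leaves a cocycle, handled by surjectivity on cohomology. -/
lemma Reduction.exists_preimage_zero (ξ : Reduction F E) (x : F.cx.X 0) :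
    ∃ (a : ξ.A.cx.X 0) (z : F.cx.X (-1)), x = ξ.f.f 0 a + F.cx.d (-1) 0 z := by
  have := ξ.isIso_f 1 le_rfl
  have := ξ.isIso_f 2 (by norm_num)
  obtain ⟨b, hb⟩ := (bijective_of_isIso (ξ.f.f 1)).surjective (F.cx.d 0 1 x)
  have hdb : ξ.A.cx.d 1 2 b = 0 := by
    apply (bijective_of_isIso (ξ.f.f 2)).injective
    rw [comm_apply, hb, d_d_apply, map_zero]
  obtain ⟨a, ha⟩ := VBComplex.exists_of_map_coboundary (L := F.toVBComplex) ξ.f (a := 0) (i := 1)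
    (b := 2) (by norm_num) (by norm_num) b hdb x hb
  obtain ⟨a', z, -, hz⟩ := VBComplex.exists_of_cocycle (L := F.toVBComplex) ξ.f (a := -1) (i := 0)
    (b := 1) (by norm_num) (by norm_num) (x - ξ.f.f 0 a) (by
      rw [map_sub, ← comm_apply, ← ha, hb, sub_self])
  exact ⟨a + a', z, by rw [map_add, add_assoc, ← hz, add_sub_cancel]⟩

/-- The map from the sum of the middle complex and an acyclic cover is surjective. -/
lemma Reduction.desc_surjective (ξ : Reduction F E) {C : VBComplex R} (w : C.cx ⟶ F.cx)
    (hw : ∀ i : ℤ, i ≤ -2 → Function.Surjective (w.f i)) (i : ℤ) :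
    Function.Surjective ((biprod.desc ξ.f w).f i) := by
  have h₁ (a : ξ.A.cx.X i) : (biprod.desc ξ.f w).f i
      ((biprod.inl : ξ.A.cx ⟶ ξ.A.cx ⊞ C.cx).f i a) = ξ.f.f i a :=
    congr(($(biprod.inl_desc ξ.f w)).f i a)
  have h₂ (c : C.cx.X i) : (biprod.desc ξ.f w).f i
      ((biprod.inr : C.cx ⟶ ξ.A.cx ⊞ C.cx).f i c) = w.f i c :=
    congr(($(biprod.inr_desc ξ.f w)).f i c)
  suffices h : ∀ x, ∃ a c, x = ξ.f.f i a + w.f i c by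
    intro x
    obtain ⟨a, c, rfl⟩ := h x
    exact ⟨(biprod.inl : ξ.A.cx ⟶ ξ.A.cx ⊞ C.cx).f i a +
      (biprod.inr : C.cx ⟶ ξ.A.cx ⊞ C.cx).f i c, by rw [map_add, h₁, h₂]⟩
  have key (z : F.cx.X (-2)) : ∃ c, F.cx.d (-2) (-1) z = w.f (-1) c := by
    obtain ⟨c, rfl⟩ := hw (-2) le_rfl z
    exact ⟨C.cx.d (-2) (-1) c, (comm_apply _ _ _ _).symm⟩
  intro x
  rcases lt_trichotomy i (-1) with hi | rfl | hi
  · obtain ⟨c, rfl⟩ := hw i (by omega) x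
    exact ⟨0, c, by rw [map_zero, zero_add]⟩
  · obtain ⟨a, z, rfl⟩ := ξ.exists_add_d x
    obtain ⟨c, hc⟩ := key z
    exact ⟨a, c, by rw [hc]⟩
  · refine (eq_or_lt_of_le (show 0 ≤ i by omega)).elim ?_ fun hi => ?_
    · rintro rfl
      obtain ⟨a, z, rfl⟩ := ξ.exists_preimage_zero x
      obtain ⟨a', z', rfl⟩ := ξ.exists_add_d z
      exact ⟨a + ξ.A.cx.d (-1) 0 a', 0, by
        rw [map_zero, add_zero, map_add, map_add, comm_apply, d_d_apply, add_zero]⟩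
    · have := ξ.isIso_f i (by omega)
      obtain ⟨a, rfl⟩ := (bijective_of_isIso (ξ.f.f i)).surjective x
      exact ⟨a, 0, by rw [map_zero, add_zero]⟩

end
end QuadCx
end

/-! ### The reduction of a stabilization to the original complex -/

noncomputable section
open CategoryTheory Limits
namespace QuadCx
variable {R : Type u} [CommRing R]

section

variable {𝔼 : QuadraticComplex R} {E F : SelfDualRep 𝔼}

lemma biprod_desc_eq {K L D : CochainComplex (ModuleCat.{u} R) ℤ} (f : K ⟶ D) (g : L ⟶ D) :
    biprod.desc f g = biprod.fst ≫ f + biprod.snd ≫ g := by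
  apply biprod.hom_ext' <;> simp

lemma isIso_Q_map_fst (K : CochainComplex (ModuleCat.{u} R) ℤ)
    {L : CochainComplex (ModuleCat.{u} R) ℤ} (hL : (Q R).map (𝟙 L) = 0) :
    IsIso ((Q R).map (biprod.fst : K ⊞ L ⟶ K)) := by
  refine ⟨(Q R).map biprod.inl, ?_, ?_⟩
  · rw [← Functor.map_comp, ← CategoryTheory.Functor.map_id, ← biprod.total, Functor.map_add,
      Q_map_eq_zero_of_factor hL, add_zero]
  · rw [← Functor.map_comp, biprod.inl_fst, CategoryTheory.Functor.map_id]

lemma Q_map_desc {K L D : CochainComplex (ModuleCat.{u} R) ℤ} (hL : (Q R).map (𝟙 L) = 0)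
    (f : K ⟶ D) (g : L ⟶ D) :
    (Q R).map (biprod.desc f g) = (Q R).map biprod.fst ≫ (Q R).map f := by
  rw [biprod_desc_eq, Functor.map_add, Q_map_eq_zero_of_factor hL, add_zero, Functor.map_comp]

lemma f_eq_zero_of_isZero {K L D : CochainComplex (ModuleCat.{u} R) ℤ} (f : K ⟶ L) (g : L ⟶ D)
    {i : ℤ} (h : IsZero (L.X i)) : (f ≫ g).f i = 0 := by
  rw [HomologicalComplex.comp_f, h.eq_of_tgt (f.f i) 0, zero_comp]

lemma isZero_dualCx {K : CochainComplex (ModuleCat.{u} R) ℤ} {i : ℤ} (h : IsZero (K.X (-i))) :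
    IsZero ((dualCx K).X i) := by
  have := ModuleCat.subsingleton_of_isZero h
  exact ModuleCat.isZero_of_subsingleton (dualMod (K.X (-i)))

/-- A contractible complex with no term in degree 0 has a split injective differential out of degree
1. -/
lemma contraction_apply_d {D : CochainComplex (ModuleCat.{u} R) ℤ} {k : Fam D D}
    (hk : 𝟙 D - 0 = nul k) (h0 : IsZero (D.X 0)) (x : D.X 1) : k 2 1 (D.d 1 2 x) = x := by
  have := apply_eq_of_nul hk (a := 0) (i := 1) (b := 2) (by norm_num) (by norm_num) x
  rw [h0.eq_of_tgt (k 1 0) 0] at this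
  simpa using this.symm

namespace Stabilization

variable {C : VBComplex R} (S : Stabilization E C)

/-- The inclusion of the dual summand. -/
def κ : dualCx C.cx ⟶ S.M.cx := dualCxMap S.p ≫ S.M.θ.inv

/-- The projection to the dual summand. -/
def q : S.M.cx ⟶ dualCx C.cx := S.M.θ.hom ≫ dualCxMap S.i

lemma κ_q : S.κ ≫ S.q = 𝟙 _ := by
  rw [κ, q, Category.assoc, Iso.inv_hom_id_assoc, ← dualCxMap_comp, S.i_p, dualCxMap_id]

lemma pair_i_ι : S.M.pair S.i S.ι.hom = 0 := by
  rw [SelfDualRep.pair, θ_dualCxMap, reassoc_of% S.i_ι, zero_comp]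

lemma ι_q : S.ι.hom ≫ S.q = 0 := by
  have := S.M.pair_symm S.i S.ι.hom
  rwa [S.pair_i_ι, dualCxMap_zero, comp_zero] at this

lemma q_κ : S.q ≫ S.κ = adj (S.p ≫ S.i) := by
  rw [q, κ, adj, dualCxMap_comp, Category.assoc, Category.assoc]

lemma κ_p : S.κ ≫ S.p = 0 := by
  rw [κ, Category.assoc, S.p_p]

lemma κ_ι : S.κ ≫ adj S.ι.hom = 0 := by
  rw [κ, adj, Category.assoc, Iso.inv_hom_id_assoc, ← Category.assoc, ← dualCxMap_comp, S.ι_p,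
    dualCxMap_zero, zero_comp]

lemma pair_κ {B : CochainComplex (ModuleCat.{u} R) ℤ} (g : B ⟶ S.M.cx) :
    S.M.pair S.κ g = dualCxMap (g ≫ S.p) := by
  rw [SelfDualRep.pair, κ, Category.assoc, Iso.inv_hom_id_assoc, dualCxMap_comp]

lemma pair_ι_ι : S.M.pair S.ι.hom S.ι.hom = E.θ.hom := by
  rw [SelfDualRep.pair, θ_dualCxMap, reassoc_of% S.ι.isom]

lemma desc_lift : biprod.desc S.ι.hom S.κ ≫ biprod.lift (adj S.ι.hom) S.q = 𝟙 _ := by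
  apply biprod.hom_ext <;> apply biprod.hom_ext' <;>
    simp [S.κ_q, S.ι_q, S.κ_ι, S.ι.isom]

lemma lift_desc : biprod.lift (adj S.ι.hom) S.q ≫ biprod.desc S.ι.hom S.κ = 𝟙 _ - S.p ≫ S.i := by
  rw [biprod.lift_desc, q_κ, eq_sub_iff_add_eq, ← S.total]
  abel

/-- The reduction of a stabilization to the original complex. -/
def reduction (hC : ∀ i : ℤ, 0 ≤ i → IsZero (C.cx.X i)) : Reduction S.M E where
  A := E.toVBComplex.biprod C.dual
  f := biprod.desc S.ι.hom S.κ
  e := biprod.fst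
  quasiIso_f := by
    have := isIso_Q_map_fst E.cx (C.Q_map_id_dual S.acyclic)
    refine (DerivedCategory.isIso_Q_map_iff_quasiIso _ _).1 ?_
    rw [Q_map_desc (C.Q_map_id_dual S.acyclic)]
    infer_instance
  quasiIso_e := (DerivedCategory.isIso_Q_map_iff_quasiIso _ _).1
    (isIso_Q_map_fst E.cx (C.Q_map_id_dual S.acyclic))
  compat := by
    rw [Q_map_desc (C.Q_map_id_dual S.acyclic), Category.assoc, S.ι.compat]
  isIso_f i hi := by
    refine ⟨(biprod.lift (adj S.ι.hom) S.q).f i, congr(($S.desc_lift).f i), ?_⟩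
    rw [← HomologicalComplex.comp_f, S.lift_desc, HomologicalComplex.sub_f_apply,
      f_eq_zero_of_isZero _ _ (hC i (by omega)), sub_zero]
    rfl
  isIso_e i hi := by
    refine ⟨(biprod.inl : E.cx ⟶ E.cx ⊞ dualCx C.cx).f i, ?_, ?_⟩
    · rw [← HomologicalComplex.comp_f, eq_sub_of_add_eq biprod.total,
        HomologicalComplex.sub_f_apply,
        f_eq_zero_of_isZero _ _ (isZero_dualCx (hC (-i) (by omega))), sub_zero]
      rfl
    · rw [← HomologicalComplex.comp_f, biprod.inl_fst]
      rfl
  -- The `E`-component is recovered from the first coordinate, the `C^∨`-component from its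
  -- differential, which has a retraction in degree 1.
  incl φ := by
    obtain ⟨k, hk⟩ : ∃ k : Fam (dualCx C.cx) (dualCx C.cx), 𝟙 _ - 0 = nul k :=
      C.dual.exists_nul (by rw [C.Q_map_id_dual S.acyclic, Functor.map_zero])
    have h0 : IsZero ((dualCx C.cx).X 0) := isZero_dualCx (hC (-0) (by omega))
    have hk' := contraction_apply_d hk h0
    refine ⟨φ ∘ₗ (((biprod.inl : E.cx ⟶ E.cx ⊞ dualCx C.cx).f 1).hom ∘ₗ LinearMap.fst R _ _ +
      ((biprod.inr : dualCx C.cx ⟶ E.cx ⊞ dualCx C.cx).f 1).hom ∘ₗ (k 2 1).hom ∘ₗ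
        ((biprod.snd : E.cx ⊞ dualCx C.cx ⟶ dualCx C.cx).f 2).hom ∘ₗ LinearMap.snd R _ _),
      LinearMap.ext fun (x : (E.cx ⊞ dualCx C.cx).X 1) => congrArg φ ?_⟩
    have h₁ : x = (biprod.inl : E.cx ⟶ E.cx ⊞ dualCx C.cx).f 1
          ((biprod.fst : E.cx ⊞ dualCx C.cx ⟶ E.cx).f 1 x) +
        (biprod.inr : dualCx C.cx ⟶ E.cx ⊞ dualCx C.cx).f 1
          ((biprod.snd : E.cx ⊞ dualCx C.cx ⟶ dualCx C.cx).f 1 x) :=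
      congr(($((biprod.total (X := E.cx) (Y := dualCx C.cx)).symm)).f 1 x)
    conv_rhs => rw [h₁, ← hk' ((biprod.snd : E.cx ⊞ dualCx C.cx ⟶ dualCx C.cx).f 1 x),
      ← comm_apply]
    rfl
  comm := by
    refine pair_desc_eq (F := S.M) (E := E) (f := S.ι.hom) (g := S.κ) (f' := 𝟙 _) (g' := 0)
      ?_ ?_ ?_ |>.trans ?_
    · rw [S.pair_ι_ι]
      simp [SelfDualRep.pair, dualCxMap_id]
    · rw [S.pair_κ, S.ι_p, dualCxMap_zero]
      simp [SelfDualRep.pair]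
    · rw [S.pair_κ, S.κ_p, dualCxMap_zero]
      simp [SelfDualRep.pair]
    · have : biprod.desc (𝟙 E.cx) (0 : dualCx C.cx ⟶ E.cx) = biprod.fst := by
        apply biprod.hom_ext' <;> simp
      rw [this]
      rfl

variable [Invertible (2 : R)]

/-- The composite is split by the identity isometry: the given section and the inclusion of `E` have
the same image in the stabilization. -/
lemma red_comp_reduction (hC : ∀ i : ℤ, 0 ≤ i → IsZero (C.cx.X i)) :
    S.ι.red ≫ (⟦S.reduction hC⟧ : IsotropicReduction S.M E) = 𝟙 E := by
  obtain ⟨σ, hσ₁, hσ₂⟩ := S.ι.exists_reduction.choose_spec.1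
  obtain ⟨τ, hτ₁, hτ₂⟩ : ∃ τ : E.cx ⟶ (S.reduction hC).A.cx,
      τ ≫ (S.reduction hC).f = S.ι.hom ∧ τ ≫ (S.reduction hC).e = 𝟙 _ :=
    ⟨biprod.inl, biprod.inl_desc _ _, biprod.inl_fst⟩
  rw [← IsometricMap.red_refl]
  refine IsometricMap.eq_red (ξ := S.ι.exists_reduction.choose.comp (S.reduction hC)) _
    ⟨(Reduction.isPullback_comp _ _).lift σ τ (by rw [hσ₂, hτ₁]), ?_, ?_⟩
  · rw [Reduction.comp_f, IsPullback.lift_fst_assoc, hσ₁]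
  · rw [Reduction.comp_e, IsPullback.lift_snd_assoc, hτ₂]
    rfl

end Stabilization

end
end QuadCx
end

/-! ### Enlarging the middle complex of a reduction -/

noncomputable section
open CategoryTheory Limits
namespace QuadCx
variable {R : Type u} [CommRing R]

section

variable {𝔼 : QuadraticComplex R} {E F : SelfDualRep 𝔼}

lemma isIso_inl_f {K L : CochainComplex (ModuleCat.{u} R) ℤ} {i : ℤ} (h : IsZero (L.X i)) :
    IsIso ((biprod.inl : K ⟶ K ⊞ L).f i) := by
  refine ⟨(biprod.fst : K ⊞ L ⟶ K).f i, ?_, ?_⟩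
  · rw [← HomologicalComplex.comp_f, biprod.inl_fst, HomologicalComplex.id_f]
  · rw [← HomologicalComplex.comp_f, eq_sub_of_add_eq biprod.total,
      HomologicalComplex.sub_f_apply, f_eq_zero_of_isZero _ _ h, sub_zero, HomologicalComplex.id_f]

namespace Reduction

variable {C : VBComplex R}

/-- The correction `ξ.f ≫ (S.p ≫ w)*` has values in the dual summand; it is isotropic, orthogonal to
`E`, and pairs with `C` as `w` pairs with `ξ.f`. The pairings of `C` with itself vanish for degree
reasons, as `C` lives in negative and its dual in positive degrees. -/
lemma stabilize_comm (ξ : Reduction F E) (S : Stabilization E C)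
    (hC : ∀ i : ℤ, 0 ≤ i → IsZero (C.cx.X i)) (w : C.cx ⟶ F.cx) :
    F.pair (biprod.desc ξ.f w) (biprod.desc ξ.f w) =
      S.M.pair (biprod.desc (ξ.e ≫ S.ι.hom + ξ.f ≫ adj (S.p ≫ w)) S.i)
        (biprod.desc (ξ.e ≫ S.ι.hom + ξ.f ≫ adj (S.p ≫ w)) S.i) := by
  have h₀ {B : CochainComplex (ModuleCat.{u} R) ℤ} (g : B ⟶ S.M.cx) :
      S.M.pair (ξ.f ≫ adj (S.p ≫ w)) g = F.pair ξ.f (g ≫ S.p ≫ w) := pair_adj _ _ _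
  apply pair_desc_eq
  · have h₁ : S.M.pair (ξ.f ≫ adj (S.p ≫ w)) (ξ.e ≫ S.ι.hom) = 0 := by
      rw [h₀, Category.assoc, reassoc_of% S.ι_p]
      simp [SelfDualRep.pair, dualCxMap_zero]
    have h₂ : S.M.pair (ξ.e ≫ S.ι.hom) (ξ.f ≫ adj (S.p ≫ w)) = 0 := by
      rw [S.M.pair_symm, h₁, dualCxMap_zero, comp_zero]
    have h₃ : S.M.pair (ξ.f ≫ adj (S.p ≫ w)) (ξ.f ≫ adj (S.p ≫ w)) = 0 := by
      rw [h₀, Category.assoc, S.v_v]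
      simp [SelfDualRep.pair, dualCxMap_zero]
    rw [SelfDualRep.pair_add, SelfDualRep.add_pair, SelfDualRep.add_pair, h₁, h₂, h₃, add_zero,
      add_zero, add_zero, SelfDualRep.comp_pair, SelfDualRep.pair_comp, S.pair_ι_ι]
    exact ξ.comm
  · have h₁ : S.M.pair S.i (ξ.f ≫ adj (S.p ≫ w)) = F.pair w ξ.f := by
      rw [S.M.pair_symm, h₀, reassoc_of% S.i_p, ← F.pair_symm]
    rw [SelfDualRep.pair_add, h₁, SelfDualRep.pair_comp, S.pair_i_ι, zero_comp, zero_add]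
  · ext1 i
    rcases le_or_gt 0 i with hi | hi
    · exact (hC i hi).eq_of_src _ _
    · exact (isZero_dualCx (hC (-i) (by omega))).eq_of_tgt _ _

/-- The reduction to a stabilization whose middle complex is enlarged by an acyclic complex. -/
def stabilize (ξ : Reduction F E) (S : Stabilization E C)
    (hC : ∀ i : ℤ, 0 ≤ i → IsZero (C.cx.X i)) (w : C.cx ⟶ F.cx) : Reduction F S.M where
  A := ξ.A.biprod C
  f := biprod.desc ξ.f w
  e := biprod.desc (ξ.e ≫ S.ι.hom + ξ.f ≫ adj (S.p ≫ w)) S.i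
  quasiIso_f := by
    have := isIso_Q_map_fst ξ.A.cx S.acyclic
    refine (DerivedCategory.isIso_Q_map_iff_quasiIso _ _).1 ?_
    rw [Q_map_desc S.acyclic]
    infer_instance
  quasiIso_e := by
    have := isIso_Q_map_fst ξ.A.cx S.acyclic
    refine (DerivedCategory.isIso_Q_map_iff_quasiIso _ _).1 ?_
    have h : (Q R).map (S.p ≫ w) = 0 := Q_map_eq_zero_of_factor S.acyclic _ _
    rw [Q_map_desc S.acyclic, Functor.map_add, Functor.map_comp _ ξ.f, Q_map_adj_eq_zero h,
      comp_zero, add_zero, Functor.map_comp]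
    infer_instance
  compat := by
    have h : (Q R).map (S.p ≫ w) = 0 := Q_map_eq_zero_of_factor S.acyclic _ _
    rw [Q_map_desc S.acyclic, Q_map_desc S.acyclic, Functor.map_add, Functor.map_comp _ ξ.f,
      Q_map_adj_eq_zero h, comp_zero, add_zero, Functor.map_comp, Category.assoc, Category.assoc,
      Category.assoc, S.ι.compat, ξ.compat]
  isIso_f i hi := by
    have := isIso_inl_f (K := ξ.A.cx) (hC i (by omega))
    have h : (biprod.inl : ξ.A.cx ⟶ ξ.A.cx ⊞ C.cx).f i ≫ (biprod.desc ξ.f w).f i = ξ.f.f i :=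
      congr(($(biprod.inl_desc ξ.f w)).f i)
    have := ξ.isIso_f i hi
    have : IsIso ((biprod.inl : ξ.A.cx ⟶ ξ.A.cx ⊞ C.cx).f i ≫ (biprod.desc ξ.f w).f i) := by
      rwa [h]
    exact IsIso.of_isIso_comp_left ((biprod.inl : ξ.A.cx ⟶ ξ.A.cx ⊞ C.cx).f i) _
  isIso_e i hi := by
    have := ξ.isIso_e i hi
    have hz (D : CochainComplex (ModuleCat.{u} R) ℤ) (f : D ⟶ dualCx C.cx)
        (g : dualCx C.cx ⟶ S.M.cx) : (f ≫ g).f i = 0 :=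
      f_eq_zero_of_isZero _ _ (isZero_dualCx (hC (-i) (by omega)))
    -- In negative degrees the dual of `C` vanishes. The correction term disappears there and `M` is
    -- `E ⊕ C`.
    have h₁ : (biprod.desc (ξ.e ≫ S.ι.hom + ξ.f ≫ adj (S.p ≫ w)) S.i).f i =
        (biprod.fst : ξ.A.cx ⊞ C.cx ⟶ _).f i ≫ ξ.e.f i ≫ S.ι.hom.f i +
          (biprod.snd : ξ.A.cx ⊞ C.cx ⟶ _).f i ≫ S.i.f i := by
      have : (ξ.f ≫ adj (S.p ≫ w)).f i = 0 := by
        have : ξ.f ≫ adj (S.p ≫ w) = (ξ.f ≫ F.θ.hom ≫ dualCxMap w) ≫ S.κ := by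
          simp [adj, Stabilization.κ, dualCxMap_comp]
        rw [this, hz]
      rw [biprod_desc_eq, HomologicalComplex.add_f_apply, HomologicalComplex.comp_f,
        HomologicalComplex.add_f_apply, this, add_zero]
      rfl
    have h₂ : (adj S.ι.hom).f i ≫ S.ι.hom.f i + S.p.f i ≫ S.i.f i = 𝟙 _ := by
      have h := congr(($(S.total)).f i)
      rwa [← S.q_κ, HomologicalComplex.add_f_apply, hz, add_zero] at h
    have ιι : S.ι.hom.f i ≫ (adj S.ι.hom).f i = 𝟙 _ := congr(($(S.ι.isom)).f i)
    have ip : S.i.f i ≫ S.p.f i = 𝟙 _ := congr(($(S.i_p)).f i)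
    have ιp : S.ι.hom.f i ≫ S.p.f i = 0 := congr(($(S.ι_p)).f i)
    have iι : S.i.f i ≫ (adj S.ι.hom).f i = 0 := congr(($(S.i_ι)).f i)
    have b₁ : (biprod.inl : ξ.A.cx ⟶ ξ.A.cx ⊞ C.cx).f i ≫
        (biprod.fst : ξ.A.cx ⊞ C.cx ⟶ _).f i = 𝟙 _ :=
      congrArg (fun t : ξ.A.cx ⟶ ξ.A.cx => t.f i) biprod.inl_fst
    have b₂ : (biprod.inl : ξ.A.cx ⟶ ξ.A.cx ⊞ C.cx).f i ≫
        (biprod.snd : ξ.A.cx ⊞ C.cx ⟶ _).f i = 0 :=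
      congrArg (fun t : ξ.A.cx ⟶ C.cx => t.f i) biprod.inl_snd
    have b₃ : (biprod.inr : C.cx ⟶ ξ.A.cx ⊞ C.cx).f i ≫
        (biprod.fst : ξ.A.cx ⊞ C.cx ⟶ _).f i = 0 :=
      congrArg (fun t : C.cx ⟶ ξ.A.cx => t.f i) biprod.inr_fst
    have b₄ : (biprod.inr : C.cx ⟶ ξ.A.cx ⊞ C.cx).f i ≫
        (biprod.snd : ξ.A.cx ⊞ C.cx ⟶ _).f i = 𝟙 _ :=
      congrArg (fun t : C.cx ⟶ C.cx => t.f i) biprod.inr_snd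
    have b₅ : (biprod.fst : ξ.A.cx ⊞ C.cx ⟶ _).f i ≫
        (biprod.inl : ξ.A.cx ⟶ ξ.A.cx ⊞ C.cx).f i +
          (biprod.snd : ξ.A.cx ⊞ C.cx ⟶ _).f i ≫
            (biprod.inr : C.cx ⟶ ξ.A.cx ⊞ C.cx).f i = 𝟙 _ :=
      congrArg (fun t : ξ.A.cx ⊞ C.cx ⟶ ξ.A.cx ⊞ C.cx => t.f i) (biprod.total (X := ξ.A.cx) (Y := C.cx))
    rw [h₁]
    refine ⟨(adj S.ι.hom).f i ≫ inv (ξ.e.f i) ≫ (biprod.inl : ξ.A.cx ⟶ ξ.A.cx ⊞ C.cx).f i +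
      S.p.f i ≫ (biprod.inr : C.cx ⟶ ξ.A.cx ⊞ C.cx).f i, ?_, ?_⟩
    · simp only [Preadditive.add_comp, Preadditive.comp_add, Category.assoc, reassoc_of% ιι,
        reassoc_of% ip, reassoc_of% ιp, reassoc_of% iι, zero_comp, comp_zero, add_zero, zero_add,
        IsIso.hom_inv_id_assoc]
      exact b₅
    · simp only [Preadditive.add_comp, Preadditive.comp_add, Category.assoc, reassoc_of% b₁,
        reassoc_of% b₂, reassoc_of% b₃, reassoc_of% b₄, zero_comp, comp_zero, add_zero, zero_add,
        IsIso.inv_hom_id_assoc]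
      exact h₂
  incl φ := by
    have h₀ : biprod.desc (ξ.e ≫ S.ι.hom + ξ.f ≫ adj (S.p ≫ w)) S.i ≫ adj S.ι.hom =
        biprod.fst ≫ ξ.e := by
      have : adj (S.p ≫ w) ≫ adj S.ι.hom = 0 := by
        rw [← adj_comp, S.ι_v, adj_zero]
      apply biprod.hom_ext' <;> simp [S.i_ι, S.ι.isom, this]
    -- `C` is zero in degree 1, so the condition reduces to the one for the original reduction.
    obtain ⟨δ, hδ⟩ := ξ.incl (φ ∘ₗ ((biprod.inl : ξ.A.cx ⟶ ξ.A.cx ⊞ C.cx).f 1).hom)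
    refine ⟨δ ∘ₗ LinearMap.prodMap ((adj S.ι.hom).f 1).hom
      ((biprod.fst : ξ.A.cx ⊞ C.cx ⟶ _).f 2).hom,
      LinearMap.ext fun (x : (ξ.A.cx ⊞ C.cx).X 1) => ?_⟩
    have h₁ : (biprod.inl : ξ.A.cx ⟶ ξ.A.cx ⊞ C.cx).f 1
        ((biprod.fst : ξ.A.cx ⊞ C.cx ⟶ _).f 1 x) = x := by
      have : (biprod.fst ≫ biprod.inl : ξ.A.cx ⊞ C.cx ⟶ ξ.A.cx ⊞ C.cx).f 1 = 𝟙 _ := by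
        rw [eq_sub_of_add_eq biprod.total, HomologicalComplex.sub_f_apply,
          f_eq_zero_of_isZero _ _ (hC 1 (by norm_num)), sub_zero, HomologicalComplex.id_f]
      exact congr($this x)
    have h₂ : (adj S.ι.hom).f 1 ((biprod.desc (ξ.e ≫ S.ι.hom + ξ.f ≫ adj (S.p ≫ w)) S.i).f 1 x) =
        ξ.e.f 1 ((biprod.fst : ξ.A.cx ⊞ C.cx ⟶ _).f 1 x) := congr(($h₀).f 1 x)
    have h₃ : δ (ξ.e.f 1 ((biprod.fst : ξ.A.cx ⊞ C.cx ⟶ _).f 1 x),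
        ξ.A.cx.d 1 2 ((biprod.fst : ξ.A.cx ⊞ C.cx ⟶ _).f 1 x)) =
        φ ((biprod.inl : ξ.A.cx ⟶ ξ.A.cx ⊞ C.cx).f 1 ((biprod.fst : ξ.A.cx ⊞ C.cx ⟶ _).f 1 x)) :=
      congr($hδ ((biprod.fst : ξ.A.cx ⊞ C.cx ⟶ _).f 1 x))
    have h₄ : δ ((adj S.ι.hom).f 1
        ((biprod.desc (ξ.e ≫ S.ι.hom + ξ.f ≫ adj (S.p ≫ w)) S.i).f 1 x),
        (biprod.fst : ξ.A.cx ⊞ C.cx ⟶ _).f 2 ((ξ.A.cx ⊞ C.cx).d 1 2 x)) = φ x := by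
      rw [h₂, comm_apply, h₃, h₁]
    exact h₄
  comm := ξ.stabilize_comm S hC w

/-- The original reduction is the composition of the enlarged one with the reduction of the
stabilization. -/
lemma stabilize_comp (ξ : Reduction F E) (S : Stabilization E C)
    (hC : ∀ i : ℤ, 0 ≤ i → IsZero (C.cx.X i)) (w : C.cx ⟶ F.cx) :
    (ξ.stabilize S hC w).comp (S.reduction hC) ≈ ξ := by
  refine comp_equiv_of_isPullback (ξ.stabilize S hC w) (S.reduction hC) ξ
    (biprod.inl : ξ.A.cx ⟶ ξ.A.cx ⊞ C.cx)
    (biprod.lift ξ.e (ξ.f ≫ F.θ.hom ≫ dualCxMap w) : ξ.A.cx ⟶ E.cx ⊞ dualCx C.cx) ?_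
    (biprod.inl_desc _ _) (biprod.lift_fst _ _)
  change IsPullback (biprod.inl : ξ.A.cx ⟶ ξ.A.cx ⊞ C.cx)
    (biprod.lift ξ.e (ξ.f ≫ F.θ.hom ≫ dualCxMap w))
    (biprod.desc (ξ.e ≫ S.ι.hom + ξ.f ≫ adj (S.p ≫ w)) S.i) (biprod.desc S.ι.hom S.κ)
  -- Projecting to `C` reads off the `C`-component on one side and gives zero on the other. Hence
  -- the fibre product is the original middle complex.
  have hp₁ : biprod.desc (ξ.e ≫ S.ι.hom + ξ.f ≫ adj (S.p ≫ w)) S.i ≫ S.p = biprod.snd := by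
    have : adj (S.p ≫ w) ≫ S.p = 0 := by
      have : adj (S.p ≫ w) = F.θ.hom ≫ dualCxMap w ≫ S.κ := by
        simp [adj, Stabilization.κ, dualCxMap_comp]
      rw [this, Category.assoc, Category.assoc, S.κ_p, comp_zero, comp_zero]
    apply biprod.hom_ext' <;> simp [S.i_p, S.ι_p, this]
  have hp₂ : biprod.desc S.ι.hom S.κ ≫ S.p = 0 := by
    apply biprod.hom_ext' <;> simp [S.ι_p, S.κ_p]
  have hw : (biprod.inl : ξ.A.cx ⟶ ξ.A.cx ⊞ C.cx) ≫
      biprod.desc (ξ.e ≫ S.ι.hom + ξ.f ≫ adj (S.p ≫ w)) S.i =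
      biprod.lift ξ.e (ξ.f ≫ F.θ.hom ≫ dualCxMap w) ≫ biprod.desc S.ι.hom S.κ := by
    simp [adj, Stabilization.κ, dualCxMap_comp]
  refine ⟨⟨hw⟩, ⟨PullbackCone.IsLimit.mk _ (fun s => s.fst ≫ biprod.fst) (fun s => ?_)
    (fun s => ?_) (fun s m h₁ _ => ?_)⟩⟩
  · have h : s.fst ≫ biprod.snd = 0 := by
      rw [← hp₁, ← Category.assoc, s.condition, Category.assoc, hp₂, comp_zero]
    apply biprod.hom_ext <;> simp [h]
  · have h : s.fst ≫ biprod.snd = 0 := by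
      rw [← hp₁, ← Category.assoc, s.condition, Category.assoc, hp₂, comp_zero]
    have h' : (s.fst ≫ biprod.fst) ≫ biprod.inl = s.fst := by
      apply biprod.hom_ext <;> simp [h]
    have : Mono (biprod.desc S.ι.hom S.κ) := mono_of_mono_fac S.desc_lift
    rw [← cancel_mono (biprod.desc S.ι.hom S.κ), Category.assoc, ← hw, ← Category.assoc, h',
      s.condition]
  · rw [← h₁, Category.assoc, biprod.inl_fst, Category.comp_id]

end Reduction

/-! ### Fractions of isometries and constancy of functors to groupoids -/

variable [Invertible (2 : R)] {𝒢 : Type v} [Groupoid.{w} 𝒢] (Φ : SelfDualRep 𝔼 ⥤ 𝒢)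

/-- In a groupoid, every reduction becomes a fraction of isometries. -/
lemma exists_map_eq (ξ : F ⟶ E) : ∃ (M : SelfDualRep 𝔼) (s : IsometricMap F M)
    (t : IsometricMap E M), Φ.map ξ ≫ Φ.map t.red = Φ.map s.red := by
  obtain ⟨ζ, hζ⟩ := Quotient.exists_rep ξ
  obtain ⟨C, w, hC₀, hC, hw⟩ := exists_acyclic_cover F
  obtain ⟨S⟩ := nonempty_stabilization E C hC₀
  have hQ : IsIso ((Q R).map (biprod.desc ζ.f w)) :=
    (DerivedCategory.isIso_Q_map_iff_quasiIso _ _).2 (ζ.stabilize S hC w).quasiIso_f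
  obtain ⟨σ, hσ⟩ := VBComplex.exists_section (K := ζ.A.biprod C) (L := F.toVBComplex)
    (biprod.desc ζ.f w) (ζ.desc_surjective w hw)
  obtain ⟨s, hs⟩ := (ζ.stabilize S hC w).exists_eq_red σ hσ
  obtain ⟨ρ, h₁, h₂⟩ : ∃ ρ : S.M ⟶ E, s.red ≫ ρ = ξ ∧ S.ι.red ≫ ρ = 𝟙 E := by
    refine ⟨(⟦S.reduction hC⟧ : IsotropicReduction S.M E), ?_, S.red_comp_reduction hC⟩
    rw [← hs, ← hζ]
    exact Quotient.sound (ζ.stabilize_comp S hC w)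
  have h₃ : Φ.map S.ι.red ≫ Φ.map ρ = 𝟙 _ := by
    rw [← Functor.map_comp, h₂, CategoryTheory.Functor.map_id]
  -- A one-sided inverse is two-sided in a groupoid.
  have h₄ : Φ.map ρ ≫ Φ.map S.ι.red = 𝟙 _ := by
    rw [← cancel_epi (Φ.map S.ι.red), reassoc_of% h₃, Category.comp_id]
  refine ⟨S.M, s, S.ι, ?_⟩
  rw [← h₁, Functor.map_comp, Category.assoc, h₄, Category.comp_id]

/-- A functor to a groupoid is constant up to isomorphism. -/
lemma nonempty_iso_const (E₀ : SelfDualRep 𝔼) :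
    Nonempty (Φ ≅ (Functor.const (SelfDualRep 𝔼)).obj (Φ.obj E₀)) := by
  choose M s t using fun E : SelfDualRep 𝔼 => exists_cospan E E₀
  -- Two cospans from `E` and `E₀` are joined in a common target, where parallel isometries have the
  -- same image.
  have key {E N : SelfDualRep 𝔼} (x : IsometricMap E N) (y : IsometricMap E₀ N) :
      Φ.map x.red ≫ inv (Φ.map y.red) =
        Φ.map (s E).some.red ≫ inv (Φ.map (t E).some.red) := by
    obtain ⟨L, ⟨a⟩, ⟨b⟩⟩ := exists_cospan N (M E)
    have h₁ := map_red_eq Φ (x.comp a) ((s E).some.comp b)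
    have h₂ := map_red_eq Φ (y.comp a) ((t E).some.comp b)
    rw [IsometricMap.red_comp, IsometricMap.red_comp, Functor.map_comp, Functor.map_comp] at h₁ h₂
    rw [← cancel_mono (Φ.map (t E).some.red), ← cancel_mono (Φ.map b.red), Category.assoc,
      Category.assoc, ← h₂]
    simp [h₁]
  refine ⟨NatIso.ofComponents
    (fun E => asIso (Φ.map (s E).some.red ≫ inv (Φ.map (t E).some.red))) fun {F E} ξ => ?_⟩
  obtain ⟨N, x, y, hξ⟩ := exists_map_eq Φ ξ
  obtain ⟨L, ⟨a⟩, ⟨b⟩⟩ := exists_cospan N E₀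
  have h₁ := key (x.comp a) b
  have h₂ := key (y.comp a) b
  rw [IsometricMap.red_comp, Functor.map_comp] at h₁ h₂
  simp only [asIso_hom, Functor.const_obj_map]
  rw [← h₁, ← h₂, ← hξ]
  simp

end
end QuadCx
end

noncomputable section
open CategoryTheory Limits
namespace QuadCx
variable {R : Type u} [CommRing R]

/-! ### Existence of a self-dual representative -/

section

/-- The transpose of a map to a dual complex. -/
def transposeMap {C : CochainComplex (ModuleCat.{u} R) ℤ} (f : C ⟶ dualCx C) : C ⟶ dualCx C :=
  toBidualCx C ≫ dualCxMap f

section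

variable {C D : CochainComplex (ModuleCat.{u} R) ℤ}

lemma transposeMap_transposeMap (f : C ⟶ dualCx C) : transposeMap (transposeMap f) = f := by
  rw [transposeMap, transposeMap, dualCxMap_comp, ← reassoc_of% toBidualCx_naturality,
    toBidualCx_dual, Category.comp_id]

lemma transposeMap_add (f g : C ⟶ dualCx C) :
    transposeMap (f + g) = transposeMap f + transposeMap g := by
  rw [transposeMap, dualCxMap_add, Preadditive.comp_add]; rfl

lemma transposeMap_sub (f g : C ⟶ dualCx C) :
    transposeMap (f - g) = transposeMap f - transposeMap g := by
  rw [transposeMap, dualCxMap_sub, Preadditive.comp_sub]; rfl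

lemma transposeMap_smul (r : R) (f : C ⟶ dualCx C) :
    transposeMap (r • f) = r • transposeMap f := by
  rw [transposeMap, dualCxMap_smul, Linear.comp_smul]; rfl

lemma transposeMap_conj (e : D ⟶ C) (f : C ⟶ dualCx C) :
    transposeMap (e ≫ f ≫ dualCxMap e) = e ≫ transposeMap f ≫ dualCxMap e := by
  rw [transposeMap, dualCxMap_comp, dualCxMap_comp, Category.assoc,
    ← reassoc_of% toBidualCx_naturality]
  simp [transposeMap]

lemma transposeMap_f_eq_zero {f : C ⟶ dualCx C} {i : ℤ} (h : f.f (-i) = 0) :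
    (transposeMap f).f i = 0 := by
  have : (dualCxMap f).f i = 0 := (congrArg dualModMap h).trans (dualModMap_zero _ _)
  rw [transposeMap, HomologicalComplex.comp_f, this, comp_zero]

lemma Q_map_transposeMap_nul (k : Fam C (dualCx C)) :
    (Q R).map (transposeMap (nul k)) = 0 := by
  rw [transposeMap, dualCxMap_nul, Functor.map_comp, Q_map_nul, comp_zero]

end

/-- Two surjections with acyclic kernels can be spliced: there is a subcomplex that maps isomorphically
to the first target in negative degrees and to the second target in positive degrees. -/
lemma exists_splice {C A B : VBComplex R} (a : C.cx ⟶ A.cx) (b : C.cx ⟶ B.cx)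
    (hQa : IsIso ((Q R).map a)) (hQb : IsIso ((Q R).map b))
    (s : A.cx ⟶ C.cx) (t : B.cx ⟶ C.cx) (hs : s ≫ a = 𝟙 _) (ht : t ≫ b = 𝟙 _) :
    ∃ (E : VBComplex R) (ι : E.cx ⟶ C.cx), IsIso ((Q R).map ι) ∧
      (∀ i < 0, IsIso ((ι ≫ a).f i)) ∧ ∀ i > 0, IsIso ((ι ≫ b).f i) := by
  have key {D : VBComplex R} (f : C.cx ⟶ D.cx) (hQf : IsIso ((Q R).map f)) (g : D.cx ⟶ C.cx)
      (hg : g ≫ f = 𝟙 _) : ∃ k : Fam C.cx C.cx, nul k = 𝟙 _ - f ≫ g ∧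
        k.post (𝟙 _ - f ≫ g) = k ∧ k.pre (𝟙 _ - f ≫ g) = k := by
    obtain ⟨k, hk⟩ := C.exists_nul (f := 𝟙 _) (g := f ≫ g) (by
      rw [← cancel_mono ((Q R).map f), ← Functor.map_comp, ← Functor.map_comp, Category.assoc, hg,
        Category.comp_id, Category.id_comp])
    exact exists_normalized (by simp [reassoc_of% hg]) k hk
  obtain ⟨k, hk, hpost, hpre⟩ := key a hQa s hs
  obtain ⟨l, hl, hpost', hpre'⟩ := key b hQb t ht
  -- The lower half of the kernel of `a` and the upper half of the kernel of `b` are to be removed.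
  -- The product of the two projections vanishes in one order, which makes the product of their
  -- complements an idempotent.
  have hBB : (nul l - nul (l.low 0)) ≫ (nul l - nul (l.low 0)) = nul l - nul (l.low 0) := by
    have h₁ : nul (l.low 0) ≫ nul (l.low 0) = nul (l.low 0) :=
      nul_low_idem 0 l (by rw [hl, hpost'])
    have h₂ : nul (l.low 0) ≫ nul l = nul (l.low 0) := by
      rw [← nul_post, Fam.low_post, hl, hpost']
    have h₃ : nul l ≫ nul (l.low 0) = nul (l.low 0) := by
      rw [← nul_pre, Fam.low_pre, hl, hpre']
    have h₄ : nul l ≫ nul l = nul l := by rw [← nul_post, hl, hpost']; exact hl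
    rw [Preadditive.sub_comp, Preadditive.comp_sub, Preadditive.comp_sub, h₁, h₂, h₃, h₄]
    abel
  have hAA : nul (k.low 0) ≫ nul (k.low 0) = nul (k.low 0) :=
    nul_low_idem 0 k (by rw [hk, hpost])
  have hAp (i : ℤ) (hi : 0 < i) : (nul (k.low 0)).f i = 0 := nul_low_gt k hi
  have hAn (i : ℤ) (hi : i < 0) : (nul (k.low 0)).f i = (𝟙 _ - a ≫ s).f i := by
    rw [nul_low_lt k hi, hk]
  have hBn (i : ℤ) (hi : i < 0) : (nul l - nul (l.low 0)).f i = 0 := by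
    rw [HomologicalComplex.sub_f_apply, nul_low_lt l hi, sub_self]
  have hBp (i : ℤ) (hi : 0 < i) : (nul l - nul (l.low 0)).f i = (𝟙 _ - b ≫ t).f i := by
    rw [HomologicalComplex.sub_f_apply, nul_low_gt l hi, hl, sub_zero]
  have hQA : (Q R).map (nul (k.low 0)) = 0 := Q_map_nul _
  have hQB : (Q R).map (nul l - nul (l.low 0)) = 0 := by
    rw [Functor.map_sub, Q_map_nul, Q_map_nul, sub_zero]
  have hAB : nul (k.low 0) ≫ (nul l - nul (l.low 0)) = 0 := by
    ext1 i
    rw [HomologicalComplex.comp_f, HomologicalComplex.zero_f]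
    rcases lt_trichotomy i 0 with hi | rfl | hi
    · rw [hBn i hi, comp_zero]
    · rw [nul_low_self (a := -1) (by norm_num), Category.assoc, ← HomologicalComplex.Hom.comm,
        hBn (-1) (by norm_num), zero_comp, comp_zero]
    · rw [hAp i hi, zero_comp]
  generalize nul l - nul (l.low 0) = b' at *
  generalize nul (k.low 0) = a' at *
  have hN : ((𝟙 _ - b') ≫ (𝟙 _ - a')) ≫ (𝟙 _ - b') ≫ (𝟙 _ - a') = (𝟙 _ - b') ≫ (𝟙 _ - a') := by
    simp only [Preadditive.sub_comp, Preadditive.comp_sub, Category.id_comp, Category.comp_id,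
      Category.assoc, hAA, hBB, hAB, reassoc_of% hAB, reassoc_of% hBB, zero_comp, comp_zero]
    abel
  obtain ⟨E, ι, r, hιr, hrι⟩ := C.exists_splitting _ hN
  have hιr' (i : ℤ) : ι.f i ≫ r.f i = 𝟙 _ := congr(($hιr).f i)
  have hrι' (i : ℤ) : r.f i ≫ ι.f i = (𝟙 _ - b').f i ≫ (𝟙 _ - a').f i := congr(($hrι).f i)
  have hs' (i : ℤ) : s.f i ≫ a.f i = 𝟙 _ := congr(($hs).f i)
  have ht' (i : ℤ) : t.f i ≫ b.f i = 𝟙 _ := congr(($ht).f i)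
  refine ⟨E, ι, ⟨(Q R).map r, ?_, ?_⟩, fun i hi => ⟨s.f i ≫ r.f i, ?_, ?_⟩,
    fun i hi => ⟨t.f i ≫ r.f i, ?_, ?_⟩⟩
  · rw [← Functor.map_comp, hιr, CategoryTheory.Functor.map_id]
  · rw [← Functor.map_comp, hrι, Functor.map_comp, Functor.map_sub, Functor.map_sub, hQA, hQB]
    simp
  all_goals
    have h : r.f i ≫ ι.f i = _ := hrι' i
    first
    | rw [HomologicalComplex.sub_f_apply _ b', hBn i hi, HomologicalComplex.sub_f_apply _ a',
        hAn i hi] at h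
    | rw [HomologicalComplex.sub_f_apply _ b', hBp i hi, HomologicalComplex.sub_f_apply _ a',
        hAp i hi] at h
    simp only [HomologicalComplex.sub_f_apply, HomologicalComplex.comp_f, sub_zero,
      sub_sub_cancel, HomologicalComplex.id_f, Category.comp_id, Category.id_comp] at h
  · rw [HomologicalComplex.comp_f, Category.assoc, ← reassoc_of% h, reassoc_of% hιr', hιr']
  · rw [HomologicalComplex.comp_f, Category.assoc, reassoc_of% h, reassoc_of% hs', hs']
  · rw [HomologicalComplex.comp_f, Category.assoc, ← reassoc_of% h, reassoc_of% hιr', hιr']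
  · rw [HomologicalComplex.comp_f, Category.assoc, reassoc_of% h, reassoc_of% ht', ht']

/-- A symmetric quasi-isomorphism is represented by a symmetric isomorphism. -/
lemma exists_symmetric_iso {P : VBComplex R} (φ : P.cx ⟶ dualCx P.cx) (hφ : transposeMap φ = φ)
    (hQ : IsIso ((Q R).map φ)) : ∃ (E : VBComplex R) (ε : E.cx ⟶ P.cx) (θ : E.cx ≅ dualCx E.cx),
      IsIso ((Q R).map ε) ∧ transposeMap θ.hom = θ.hom ∧
        (Q R).map θ.hom = (Q R).map (ε ≫ φ ≫ dualCxMap ε) := by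
  -- Adding the dual cone turns `φ` into a surjection `P ⊕ X ⟶ P^∨`. The splice then has the terms
  -- of `P` in negative and of `P^∨` in positive degrees, the shape of a self-dual complex.
  let X : VBComplex R := P.cone.dual
  have hX : (Q R).map (𝟙 X.cx) = 0 := P.cone.Q_map_id_dual P.Q_map_id_cone
  let j : X.cx ⟶ dualCx P.cx := dualCxMap P.toCone
  have hj (i : ℤ) : Function.Surjective (j.f i) := fun y => by
    obtain ⟨r, hr⟩ := P.toCone_f_split (-i)
    have : dualModMap r ≫ dualModMap (P.toCone.f (-i)) = 𝟙 _ := congrArg dualModMap hr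
    exact ⟨dualModMap r y, congr($this y)⟩
  have hQa : IsIso ((Q R).map (biprod.fst : P.cx ⊞ X.cx ⟶ P.cx)) := isIso_Q_map_fst P.cx hX
  have hQb : IsIso ((Q R).map (biprod.desc φ j)) := by
    rw [Q_map_desc hX]
    infer_instance
  obtain ⟨t, ht⟩ := VBComplex.exists_section (K := P.biprod X) (L := P.dual) (biprod.desc φ j)
    fun i y => by
      obtain ⟨x, rfl⟩ := hj i y
      exact ⟨(biprod.inr : X.cx ⟶ P.cx ⊞ X.cx).f i x, congr(($(biprod.inr_desc φ j)).f i x)⟩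
  obtain ⟨E, ι, hι, hε, hη⟩ := exists_splice (C := P.biprod X) (A := P) (B := P.dual)
    biprod.fst (biprod.desc φ j) hQa hQb biprod.inl t biprod.inl_fst ht
  have hQε : IsIso ((Q R).map (ι ≫ biprod.fst)) := by
    rw [Functor.map_comp]
    infer_instance
  have hQη : (Q R).map ((ι ≫ biprod.fst) ≫ φ) = (Q R).map (ι ≫ biprod.desc φ j) := by
    rw [Functor.map_comp _ ι, Q_map_desc hX, Category.assoc, Functor.map_comp, Functor.map_comp]
  generalize ι ≫ biprod.desc φ j = η at *
  generalize ι ≫ biprod.fst = ε at *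
  obtain ⟨H, hH⟩ := E.exists_nul (f := ε ≫ φ ≫ dualCxMap ε) (g := η ≫ dualCxMap ε) (by
    rw [← Category.assoc, Functor.map_comp, hQη, ← Functor.map_comp])
  have hU : ∀ i < 0, (nul H - nul (H.low 0)).f i = 0 := fun i hi => by
    rw [HomologicalComplex.sub_f_apply, nul_low_lt H hi, sub_self]
  have hU' : ∀ i > 0, (nul H - nul (H.low 0)).f i = (nul H).f i := fun i hi => by
    rw [HomologicalComplex.sub_f_apply, nul_low_gt H hi, sub_zero]
  have hQU : (Q R).map (nul H - nul (H.low 0)) = 0 := by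
    rw [← nul_sub, Q_map_nul]
  have hQU' : (Q R).map (transposeMap (nul H - nul (H.low 0))) = 0 := by
    rw [← nul_sub, Q_map_transposeMap_nul]
  generalize nul H - nul (H.low 0) = U at *
  -- The correction by the upper half of the homotopy changes the form in positive degrees to `η ≫
  -- ε^∨`, an isomorphism there. Subtracting the transpose as well restores symmetry, which gives
  -- the negative degrees; degree 0 follows because `θ` is a quasi-isomorphism.
  let θ : E.cx ⟶ dualCx E.cx := ε ≫ φ ≫ dualCxMap ε - U - transposeMap U
  have hθ : transposeMap θ = θ := by
    simp only [θ, transposeMap_sub, transposeMap_conj, transposeMap_transposeMap, hφ]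
    abel
  have hQθ : (Q R).map θ = (Q R).map (ε ≫ φ ≫ dualCxMap ε) := by
    rw [Functor.map_sub, Functor.map_sub, hQU, hQU', sub_zero, sub_zero]
  have hpos (i : ℤ) (hi : 0 < i) : IsIso (θ.f i) := by
    have h₁ : θ.f i = η.f i ≫ (dualCxMap ε).f i := by
      rw [HomologicalComplex.sub_f_apply, HomologicalComplex.sub_f_apply, hU' i hi,
        transposeMap_f_eq_zero (hU (-i) (by omega)), ← hH, HomologicalComplex.sub_f_apply,
        sub_zero, sub_sub_cancel]
      rfl
    have h₂ := hη i hi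
    have h₃ := hε (-i) (by omega)
    have h₄ : IsIso ((dualCxMap ε).f i) :=
      ⟨dualModMap (inv (ε.f (-i))), congrArg dualModMap (IsIso.inv_hom_id (ε.f (-i))),
        congrArg dualModMap (IsIso.hom_inv_id (ε.f (-i)))⟩
    rw [h₁]
    infer_instance
  have hneg (i : ℤ) (hi : i < 0) : IsIso (θ.f i) := by
    have := E.isIso_toBidual
    have h₃ := hpos (-i) (by omega)
    have h₄ : IsIso ((dualCxMap θ).f i) :=
      ⟨dualModMap (inv (θ.f (-i))), congrArg dualModMap (IsIso.inv_hom_id (θ.f (-i))),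
        congrArg dualModMap (IsIso.hom_inv_id (θ.f (-i)))⟩
    rw [← hθ, transposeMap, HomologicalComplex.comp_f]
    have h₅ : IsIso ((toBidualCx E.cx).f i) :=
      inferInstanceAs (IsIso ((HomologicalComplex.eval _ _ i).map (toBidualCx E.cx)))
    exact IsIso.comp_isIso
  have hQε' : IsIso ((Q R).map (dualCxMap ε)) := by
    obtain ⟨ψ, k, l, hk, hl⟩ := VBComplex.exists_homotopyInverse ε
    refine ⟨(Q R).map (dualCxMap ψ), ?_, ?_⟩
    · rw [← Functor.map_comp, ← dualCxMap_comp, eq_sub_of_add_eq (sub_eq_iff_eq_add'.1 hl).symm,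
        dualCxMap_sub, dualCxMap_nul, Functor.map_sub, Q_map_nul, sub_zero, dualCxMap_id,
        CategoryTheory.Functor.map_id]
    · rw [← Functor.map_comp, ← dualCxMap_comp, eq_sub_of_add_eq (sub_eq_iff_eq_add'.1 hk).symm,
        dualCxMap_sub, dualCxMap_nul, Functor.map_sub, Q_map_nul, sub_zero, dualCxMap_id,
        CategoryTheory.Functor.map_id]
  have hiso : IsIso θ := by
    refine VBComplex.isIso_of_isIso_f_of_ne (K := E) (L := E.dual) θ ?_ 0 fun i hi => ?_
    · rw [hQθ, Functor.map_comp, Functor.map_comp]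
      infer_instance
    · rcases lt_or_gt_of_ne hi with hi | hi
      · exact hneg i hi
      · exact hpos i hi
  exact ⟨E, ε, asIso θ, hQε, hθ, hQθ⟩

variable (𝔼 : QuadraticComplex R)

/-- The symmetry of `𝔼.θ` in `D(R)`, transported to the chosen representative. -/
lemma Q_map_transposeMap_rep {φ : 𝔼.rep.cx ⟶ dualCx 𝔼.rep.cx}
    (hφ : (Q R).map φ = 𝔼.repIso.hom ≫ 𝔼.θ.hom) :
    (Q R).map (transposeMap φ) = (Q R).map φ := by
  have h := 𝔼.symm
  rw [PerfectComplex.toBidual, PerfectComplex.dualHom, Category.assoc, Category.assoc,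
    ← derivedDual_comp, Iso.inv_comp_eq] at h
  rw [hφ, ← h, transposeMap, Functor.map_comp, ← derivedDual_map (P := 𝔼.rep) (P' := 𝔼.rep.dual), hφ]
  simp

variable [Invertible (2 : R)]

/-- A representing chain map is symmetric up to homotopy, so averaging it with its transpose does
not change its class. -/
lemma exists_symmetric_rep : ∃ φ : 𝔼.rep.cx ⟶ dualCx 𝔼.rep.cx,
    (Q R).map φ = 𝔼.repIso.hom ≫ 𝔼.θ.hom ∧ transposeMap φ = φ := by
  obtain ⟨φ, hφ⟩ := 𝔼.rep.exists_chainMap (𝔼.repIso.hom ≫ 𝔼.θ.hom)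
  obtain ⟨k, hk⟩ := 𝔼.rep.exists_nul (Q_map_transposeMap_rep 𝔼 hφ)
  refine ⟨(⅟2 : R) • (φ + transposeMap φ), ?_, ?_⟩
  · have : (⅟2 : R) • (φ + transposeMap φ) = φ + nul ((⅟2 : R) • k) := by
      rw [sub_eq_iff_eq_add'.1 hk, ← add_assoc, smul_add, half_add, nul_smul]
    rw [this, Functor.map_add, Q_map_nul, add_zero, hφ]
  · rw [transposeMap_smul, transposeMap_add, transposeMap_transposeMap, add_comm]

/-- Every quadratic complex has a self-dual representative. -/
lemma nonempty_selfDualRep : Nonempty (SelfDualRep 𝔼) := by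
  obtain ⟨φ, hφ, hφt⟩ := exists_symmetric_rep 𝔼
  have hQφ : IsIso ((Q R).map φ) := by
    rw [hφ]
    infer_instance
  obtain ⟨E, ε, θ, hε, hθ, hQθ⟩ := exists_symmetric_iso φ hφt hQφ
  refine ⟨{ E with
    θ := θ
    symm := hθ
    α := asIso ((Q R).map ε) ≪≫ 𝔼.repIso
    compat := ?_ }⟩
  have h : 𝔼.dualHomTo (P := E) (asIso ((Q R).map ε) ≪≫ 𝔼.repIso).hom =
      (Q R).map (dualCxMap ε) := by
    rw [PerfectComplex.dualHomTo, Iso.trans_hom, Category.assoc, Iso.hom_inv_id, Category.comp_id,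
      asIso_hom, derivedDual_map (P := E) (P' := 𝔼.rep)]
  rw [h, hQθ, Functor.map_comp, Functor.map_comp, hφ]
  simp

end
end QuadCx
end

theorem mainTheorem9 {R : Type u} [CommRing R] (h2 : IsUnit (2 : R))
    (𝔼 : QuadCx.QuadraticComplex R) {G : Type v} [CategoryTheory.Groupoid.{w} G]
    (Φ : CategoryTheory.Functor (QuadCx.SelfDualRep 𝔼) G) :
    ∃ c : G, Nonempty (Φ ≅ (CategoryTheory.Functor.const (QuadCx.SelfDualRep 𝔼)).obj c) := by
  let _ := h2.invertible
  -- Without an object of the category, `G` might be empty and there would be no value `c`.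
  obtain ⟨E₀⟩ := QuadCx.nonempty_selfDualRep 𝔼
  exact ⟨_, QuadCx.nonempty_iso_const Φ E₀⟩
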